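/- **Language.** Simple types are $\alpha,\beta ::= \mathbf R \mid \alpha\to\beta$. Fix a set of primitive operations, i.e. measurable functions $f:\mathbb R^{|f|}\to\mathbb R$. (Simply typed) symbolic terms and symbolic values are $$\mathcal V ::= x \mid \underline r \mid \lambda x.\mathcal M \mid \mu^\varphi_x.\mathcal M \mid \alpha_i \mid f(\mathcal V_1,\dots,\mathcal V_{|f|}),$$ $$\mathcal M ::= \mathcal V \mid \mathcal M\,\mathcal N \mid \mathsf{if}(\mathcal M,\mathcal N,\mathcal P) \mid f(\mathcal M_1,\dots,\mathcal M_{|f|}) \mid \mathsf{sample} \mid \mathsf{score}(\mathcal M),$$ where $r\in\mathbb R$, the $\alpha_i$ $(i\ge 1)$ are sample variables, and $\mu^\varphi_x.\mathcal M$ is a recursive function $\varphi$ with argument $x$. An interval is $[a,b]$ with $a\in\mathbb R\cup\{-\infty\}$, $b\in\mathbb R\cup\{\infty\}$, $a\le b$, regarded as a set of reals. Symbolic *interval* terms have intervals $[a,b]$ as literals in place of the reals $r$; $\underline r$ is identified with $[r,r]$. $\mathcal M;\mathcal N$ abbreviates $(\lambda\_.\mathcal N)\,\mathcal M$. **Symbolic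 execution.** A symbolic (interval) configuration is $\psi=(\mathcal M,n,\Delta,\Xi)$ with $\mathcal M$ a closed symbolic (interval) term of type $\mathbf R$, $n\in\mathbb N$, $\Delta$ a list of constraints $\mathcal V\bowtie r$ with $\bowtie\,\in\{\le,<,\ge,>\}$ and $r\in\mathbb R$, and $\Xi$ a list (with multiplicities) of values of type $\mathbf R$. Reduction $\rightsquigarrow$ is closed under call-by-value, left-to-right evaluation contexts and generated by: * $((\lambda x.\mathcal M)\mathcal V,n,\Delta,\Xi)\rightsquigarrow(\mathcal M[\mathcal V/x],n,\Delta,\Xi)$; * $((\mu^\varphi_x.\mathcal M)\mathcal V,n,\Delta,\Xi)\rightsquigarrow(\mathcal M[\mathcal V/x,(\mu^\varphi_x.\mathcal M)/\varphi],n,\Delta,\Xi)$; * $(\mathsf{sample},n,\Delta,\Xi)\rightsquigarrow(\alpha_{n+1},n+1,\Delta,\Xi)$; * $(\mathsf{if}(\mathcal V,\mathcal N,\mathcal P),n,\Delta,\Xi)\rightsquigarrow(\mathcal N,n,\Delta\cup\{\mathcal V\le 0\},\Xi)$ and $\rightsquigarrow(\mathcal P,n,\Delta\cup\{\mathcal V>0\},\Xi)$;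 * $(\mathsf{score}(\mathcal V),n,\Delta,\Xi)\rightsquigarrow(\mathcal V,n,\Delta\cup\{\mathcal V\ge 0\},\Xi\cup\{\mathcal V\})$. A symbolic (interval) path is a configuration whose term is a value; $\mathit{symPaths}(\psi)$ is the set of paths reachable from $\psi$. **Denotations.** For $\boldsymbol s\in[0,1]^n$ and an interval-free value $\mathcal V$ of type $\mathbf R$ let $\mathcal V[\boldsymbol s]\in\mathbb R$ be its value when $\alpha_i$ is replaced with $s_i$; for an interval value let $\ulcorner\mathcal V[\boldsymbol s]\urcorner\subseteq\mathbb R$ be the set of all its values when, in addition, every occurrence of an interval is replaced with one of its elements. Let $\mathsf{Sat}(\psi)=\{\boldsymbol s\in[0,1]^n \mid \mathcal C[\boldsymbol s]\bowtie r \text{ for all } (\mathcal C\bowtie r)\in\Delta\}$. For a path $\Psi=(\mathcal V,n,\Delta,\Xi)$ and Borel $U\subseteq\mathbb R$ put, with values in $[0,\infty]$ and Iverson brackets $[\cdot]$, $$\llbracket\Psi\rrbracket(U)=\int_{[0,1]^n}[\mathcal V[\boldsymbol s]\in U]\prod_{(\mathcal C\bowtie r)\in\Delta}[\mathcal C[\boldsymbol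 s]\bowtie r]\prod_{\mathcal W\in\Xi}\mathcal W[\boldsymbol s]\,d\boldsymbol s,$$ $$\llbracket\Psi\rrbracket_{lb}(U)=\int_{[0,1]^n}[\ulcorner\mathcal V[\boldsymbol s]\urcorner\subseteq U]\prod_{(\mathcal C\bowtie r)\in\Delta}[\forall t\in\ulcorner\mathcal C[\boldsymbol s]\urcorner.\,t\bowtie r]\prod_{\mathcal W\in\Xi}\inf\ulcorner\mathcal W[\boldsymbol s]\urcorner\,d\boldsymbol s,$$ $$\llbracket\Psi\rrbracket_{ub}(U)=\int_{[0,1]^n}[\ulcorner\mathcal V[\boldsymbol s]\urcorner\cap U\neq\emptyset]\prod_{(\mathcal C\bowtie r)\in\Delta}[\exists t\in\ulcorner\mathcal C[\boldsymbol s]\urcorner.\,t\bowtie r]\prod_{\mathcal W\in\Xi}\sup\ulcorner\mathcal W[\boldsymbol s]\urcorner\,d\boldsymbol s.$$ **Interval types.** Weightless types are $\sigma::=I\mid\sigma\to\mathcal A$ and weighted types $\mathcal A::=\langle\sigma\mid I\rangle$, with $I$ an interval. Subtyping $\sqsubseteq$ is interval inclusion on base types and weights, extended contravariantly in arguments and covariantly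 in results. For $f:\mathbb R^k\to\mathbb R$ let $f^{\mathbb I}(I_1,\dots,I_k)=[\inf F,\sup F]$ with $F=f(I_1\times\dots\times I_k)$; $\times^{\mathbb I}$ is the lifting of multiplication, and $\mathbf 1=[1,1]$. The typing rules are * $\Gamma\vdash x:\langle\sigma\mid\mathbf 1\rangle$ if $x:\sigma\in\Gamma$; $\ \Gamma\vdash\underline r:\langle[r,r]\mid\mathbf 1\rangle$; $\ \Gamma\vdash\mathsf{sample}:\langle[0,1]\mid\mathbf 1\rangle$; $\ \Gamma\vdash\alpha_i:\langle[0,1]\mid\mathbf 1\rangle$; * if $\Gamma\vdash\mathcal M:\mathcal A$ and $\mathcal A\sqsubseteq\mathcal B$ then $\Gamma\vdash\mathcal M:\mathcal B$; * if $\Gamma;x:\sigma\vdash\mathcal M:\mathcal A$ then $\Gamma\vdash\lambda x.\mathcal M:\langle\sigma\to\mathcal A\mid\mathbf 1\rangle$; * if $\Gamma;\varphi:\sigma\to\mathcal A;x:\sigma\vdash\mathcal M:\mathcal A$ then $\Gamma\vdash\mu^\varphi_x.\mathcal M:\langle\sigma\to\mathcal A\mid\mathbf 1\rangle$; * if $\Gamma\vdash\mathcal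 M:\langle\sigma\to\langle\tau\mid K\rangle\mid I\rangle$ and $\Gamma\vdash\mathcal N:\langle\sigma\mid J\rangle$ then $\Gamma\vdash\mathcal M\,\mathcal N:\langle\tau\mid I\times^{\mathbb I}J\times^{\mathbb I}K\rangle$; * if $\Gamma\vdash\mathcal M:\langle I\mid J\rangle$, $\Gamma\vdash\mathcal N:\langle\sigma\mid K\rangle$ and $\Gamma\vdash\mathcal P:\langle\sigma\mid K\rangle$ then $\Gamma\vdash\mathsf{if}(\mathcal M,\mathcal N,\mathcal P):\langle\sigma\mid J\times^{\mathbb I}K\rangle$; * if $\Gamma\vdash\mathcal M:\langle I\mid J\rangle$ and $I'=I\cap[0,\infty]\ne\emptyset$ then $\Gamma\vdash\mathsf{score}(\mathcal M):\langle I'\mid J\times^{\mathbb I}I'\rangle$; * if $\Gamma\vdash\mathcal M_i:\langle I_i\mid J_i\rangle$ for all $i$ then $\Gamma\vdash f(\mathcal M_1,\dots,\mathcal M_{|f|}):\langle f^{\mathbb I}(I_1,\dots,I_{|f|})\mid\prod^{\mathbb I}_i J_i\rangle$. **Approximation of fixpoints.** The summary of a weightless type is $\mathrm{sum}(I)=I$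 and $\mathrm{sum}(\sigma\to\langle\tau\mid J\rangle)=\lambda\_.\,(\mathsf{score}(J);\mathrm{sum}(\tau))$. Given an interval-free configuration $\psi=(\mathcal M,n,\Delta,\Xi)$ and a derivation of $\vdash\mathcal M:\mathcal A$ for some $\mathcal A$, the interval configuration $\mathit{approxFix}(\psi)$ arises from $\psi$ by replacing in $\mathcal M$ every (outermost) fixpoint subterm with the summary of the type $\sigma\to\mathcal A'$ that the fixpoint rule of the derivation gives to it. **Theorem.** Let $\psi=(\mathcal M,n,\Delta,\Xi)$ be an interval-free symbolic configuration in which only the sample variables $\alpha_1,\dots,\alpha_n$ occur, $\Delta$ and $\Xi$ contain values, and $\mathcal W[\boldsymbol s]\ge 0$ for all $\mathcal W\in\Xi$ and $\boldsymbol s\in\mathsf{Sat}(\psi)$ (as holds for all configurations reached from a program $(P,0,\emptyset,\emptyset)$). Let $\mathit{approxFix}(\psi)$ be formed from any derivation of a type for $\mathcal M$. Put $A=\mathit{symPaths}(\psi)$ and $B=\mathit{symPaths}(\mathit{approxFix}(\psi))$. Then $B$ is finite, and for every Borel set $U\subseteq\mathbb R$: 1. if $\psi$ terminates almost surely, i.e.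 $\sum_{\Psi\in A}\lambda(\mathsf{Sat}(\Psi))=\lambda(\mathsf{Sat}(\psi))$ for Lebesgue measure $\lambda$ (of the respective dimension), then $\displaystyle\sum_{\Psi\in B}\llbracket\Psi\rrbracket_{lb}(U)\le\sum_{\Psi\in A}\llbracket\Psi\rrbracket(U)$; 2. in every case $\displaystyle\sum_{\Psi\in A}\llbracket\Psi\rrbracket(U)\le\sum_{\Psi\in B}\llbracket\Psi\rrbracket_{ub}(U)$. -/

import Mathlib

open MeasureTheory
open scoped ENNReal

noncomputable section

namespace SPCF

/-! ### Intervals -/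

/-- Intervals `[a, b]` with `a ∈ ℝ ∪ {-∞}`, `b ∈ ℝ ∪ {∞}` and `a ≤ b`. -/
@[ext]
structure Interval where
  lo : EReal
  hi : EReal
  lo_ne_top : lo ≠ ⊤
  hi_ne_bot : hi ≠ ⊥
  le : lo ≤ hi

namespace Interval

/-- The set of reals denoted by an interval. -/
def toSet (I : Interval) : Set ℝ := {x | I.lo ≤ (x : EReal) ∧ (x : EReal) ≤ I.hi}

theorem toSet_nonempty (I : Interval) : I.toSet.Nonempty := by
  obtain ⟨lo, hi, h1, h2, h3⟩ := I
  induction lo using EReal.rec with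
  | bot =>
    induction hi using EReal.rec with
    | bot => exact absurd rfl h2
    | coe b => exact ⟨b, by simp [toSet]⟩
    | top => exact ⟨0, by simp [toSet]⟩
  | coe a => exact ⟨a, by simpa [toSet] using h3⟩
  | top => exact absurd rfl h1

/-- The interval `[inf F, sup F]` of a nonempty set `F` of reals. -/
def hull (F : Set ℝ) (hF : F.Nonempty) : Interval where
  lo := sInf ((fun x : ℝ => (x : EReal)) '' F)
  hi := sSup ((fun x : ℝ => (x : EReal)) '' F)
  lo_ne_top := by
    obtain ⟨x, hx⟩ := hF
    exact ne_of_lt ((sInf_le (Set.mem_image_of_mem _ hx)).trans_lt (EReal.coe_lt_top x))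
  hi_ne_bot := by
    obtain ⟨x, hx⟩ := hF
    exact ne_of_gt ((EReal.bot_lt_coe x).trans_le (le_sSup (Set.mem_image_of_mem _ hx)))
  le := by
    obtain ⟨x, hx⟩ := hF
    exact (sInf_le (Set.mem_image_of_mem _ hx)).trans (le_sSup (Set.mem_image_of_mem _ hx))

/-- The interval lifting of a function `f : ℝᵏ → ℝ`: the interval `[inf F, sup F]`, where `F` is
the image under `f` of the box `I₁ × ⋯ × Iₖ`. -/
def lift {k : ℕ} (f : (Fin k → ℝ) → ℝ) (I : Fin k → Interval) : Interval :=
  hull (f '' {x | ∀ i, x i ∈ (I i).toSet})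
    (Set.Nonempty.image f ⟨fun i => (I i).toSet_nonempty.some,
      fun i => (I i).toSet_nonempty.some_mem⟩)

/-- Interval multiplication. -/
def mul (I J : Interval) : Interval := lift (fun x : Fin 2 → ℝ => x 0 * x 1) ![I, J]

/-- The point interval `[r, r]`. -/
def point (r : ℝ) : Interval := ⟨r, r, EReal.coe_ne_top r, EReal.coe_ne_bot r, le_rfl⟩

/-- The interval `[1, 1]`. -/
def one : Interval := point 1

/-- The unit interval `[0, 1]`. -/
def unit : Interval :=
  ⟨0, 1, EReal.zero_ne_top, (EReal.coe_ne_bot 1), zero_le_one⟩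

/-- The meet `[a, b] ⊓ [0, ∞]`, which is an interval as soon as `0 ≤ b`. -/
def meetNonneg (I : Interval) (h : 0 ≤ I.hi) : Interval where
  lo := max I.lo 0
  hi := I.hi
  lo_ne_top := (max_lt (lt_top_iff_ne_top.2 I.lo_ne_top) EReal.zero_lt_top).ne
  hi_ne_bot := I.hi_ne_bot
  le := max_le I.le h

/-- Interval inclusion. -/
def Sub (I J : Interval) : Prop := J.lo ≤ I.lo ∧ I.hi ≤ J.hi

end Interval

/-! ### Terms -/

/-- Simple types: the type of reals and function types. -/
inductive Ty : Type
  | real : Ty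
  | arr : Ty → Ty → Ty

/-- The primitive operations of the language: measurable functions `ℝᵏ → ℝ`. -/
structure Signature where
  Op : Type
  arity : Op → ℕ
  fn : (f : Op) → (Fin (arity f) → ℝ) → ℝ
  measurable_fn : ∀ f, Measurable (fn f)

/-- Typed de Bruijn variables. -/
inductive Var : List Ty → Ty → Type
  | zero {Γ : List Ty} {τ : Ty} : Var (τ :: Γ) τ
  | succ {Γ : List Ty} {τ ρ : Ty} : Var Γ τ → Var (ρ :: Γ) τ

/-- Simply-typed symbolic terms with literals from `L`. Interval-free symbolic terms are the case
`L = ℝ`, symbolic interval terms the case `L = Interval`. `svar i` is the sample variable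
`α_{i+1}`. In the body of `fix`, variable `0` is the argument and variable `1` the recursive
function. `ite M N P` evaluates to `N` if `M ≤ 0` and to `P` otherwise. -/
inductive Tm (S : Signature) (L : Type) : List Ty → Ty → Type
  | var {Γ : List Ty} {τ : Ty} (x : Var Γ τ) : Tm S L Γ τ
  | lit {Γ : List Ty} (l : L) : Tm S L Γ Ty.real
  | svar {Γ : List Ty} (i : ℕ) : Tm S L Γ Ty.real
  | lam {Γ : List Ty} {τ ρ : Ty} (M : Tm S L (τ :: Γ) ρ) : Tm S L Γ (Ty.arr τ ρ)
  | fix {Γ : List Ty} {τ ρ : Ty} (M : Tm S L (τ :: Ty.arr τ ρ :: Γ) ρ) : Tm S L Γ (Ty.arr τ ρ)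
  | app {Γ : List Ty} {τ ρ : Ty} (M : Tm S L Γ (Ty.arr τ ρ)) (N : Tm S L Γ τ) : Tm S L Γ ρ
  | ite {Γ : List Ty} {τ : Ty} (M : Tm S L Γ Ty.real) (N P : Tm S L Γ τ) : Tm S L Γ τ
  | prim {Γ : List Ty} (f : S.Op) (M : Fin (S.arity f) → Tm S L Γ Ty.real) : Tm S L Γ Ty.real
  | sample {Γ : List Ty} : Tm S L Γ Ty.real
  | score {Γ : List Ty} (M : Tm S L Γ Ty.real) : Tm S L Γ Ty.real

/-- Lifting a renaming under a binder. -/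
def liftRen {Γ Δ : List Ty} (r : ∀ τ, Var Γ τ → Var Δ τ) (ρ : Ty) :
    ∀ τ, Var (ρ :: Γ) τ → Var (ρ :: Δ) τ
  | _, Var.zero => Var.zero
  | _, Var.succ x => Var.succ (r _ x)

namespace Tm

variable {S : Signature} {L : Type}

/-- Renaming of variables. -/
def ren : {Γ Δ : List Ty} → {τ : Ty} → (∀ τ, Var Γ τ → Var Δ τ) → Tm S L Γ τ → Tm S L Δ τ
  | _, _, _, r, var x => var (r _ x)
  | _, _, _, _, lit l => lit l
  | _, _, _, _, svar i => svar i
  | _, _, _, r, lam M => lam (ren (liftRen r _) M)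
  | _, _, _, r, fix M => fix (ren (liftRen (liftRen r _) _) M)
  | _, _, _, r, app M N => app (ren r M) (ren r N)
  | _, _, _, r, ite M N P => ite (ren r M) (ren r N) (ren r P)
  | _, _, _, r, prim f M => prim f (fun i => ren r (M i))
  | _, _, _, _, sample => sample
  | _, _, _, r, score M => score (ren r M)

/-- Lifting a substitution under a binder. -/
def liftSubst {Γ Δ : List Ty} (s : ∀ τ, Var Γ τ → Tm S L Δ τ) (ρ : Ty) :
    ∀ τ, Var (ρ :: Γ) τ → Tm S L (ρ :: Δ) τ
  | _, Var.zero => var Var.zero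
  | _, Var.succ x => ren (fun _ => Var.succ) (s _ x)

/-- Simultaneous capture-avoiding substitution. -/
def subst : {Γ Δ : List Ty} → {τ : Ty} → (∀ τ, Var Γ τ → Tm S L Δ τ) → Tm S L Γ τ → Tm S L Δ τ
  | _, _, _, s, var x => s _ x
  | _, _, _, _, lit l => lit l
  | _, _, _, _, svar i => svar i
  | _, _, _, s, lam M => lam (subst (liftSubst s _) M)
  | _, _, _, s, fix M => fix (subst (liftSubst (liftSubst s _) _) M)
  | _, _, _, s, app M N => app (subst s M) (subst s N)
  | _, _, _, s, ite M N P => ite (subst s M) (subst s N) (subst s P)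
  | _, _, _, s, prim f M => prim f (fun i => subst s (M i))
  | _, _, _, _, sample => sample
  | _, _, _, s, score M => score (subst s M)

/-- Extension of a substitution by a term for the newest variable. -/
def extend {Γ Δ : List Ty} {ρ : Ty} (s : ∀ τ, Var Γ τ → Tm S L Δ τ) (V : Tm S L Δ ρ) :
    ∀ τ, Var (ρ :: Γ) τ → Tm S L Δ τ
  | _, Var.zero => V
  | _, Var.succ x => s _ x

/-- `M[V/x]`, where `x` is the newest variable. -/
def inst {Γ : List Ty} {τ ρ : Ty} (M : Tm S L (τ :: Γ) ρ) (V : Tm S L Γ τ) : Tm S L Γ ρ :=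
  M.subst (extend (fun _ => var) V)

/-- `M[V/x, W/φ]`, where `x` is the newest variable and `φ` the next one. -/
def inst₂ {Γ : List Ty} {τ τ' ρ : Ty} (M : Tm S L (τ :: τ' :: Γ) ρ) (V : Tm S L Γ τ)
    (W : Tm S L Γ τ') : Tm S L Γ ρ :=
  M.subst (extend (extend (fun _ => var) W) V)

/-- Change of literals. -/
def mapLit {L' : Type} (g : L → L') : {Γ : List Ty} → {τ : Ty} → Tm S L Γ τ → Tm S L' Γ τ
  | _, _, var x => var x
  | _, _, lit l => lit (g l)
  | _, _, svar i => svar i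
  | _, _, lam M => lam (mapLit g M)
  | _, _, fix M => fix (mapLit g M)
  | _, _, app M N => app (mapLit g M) (mapLit g N)
  | _, _, ite M N P => ite (mapLit g M) (mapLit g N) (mapLit g P)
  | _, _, prim f M => prim f (fun i => mapLit g (M i))
  | _, _, sample => sample
  | _, _, score M => score (mapLit g M)

/-- Symbolic values: variables, literals, abstractions, fixpoints, sample variables, and
(postponed) applications of primitive operations to symbolic values. -/
inductive IsValue : {Γ : List Ty} → {τ : Ty} → Tm S L Γ τ → Prop
  | var {Γ : List Ty} {τ : Ty} (x : Var Γ τ) : IsValue (var x : Tm S L Γ τ)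
  | lit {Γ : List Ty} (l : L) : IsValue (lit l : Tm S L Γ Ty.real)
  | svar {Γ : List Ty} (i : ℕ) : IsValue (svar i : Tm S L Γ Ty.real)
  | lam {Γ : List Ty} {τ ρ : Ty} (M : Tm S L (τ :: Γ) ρ) : IsValue (lam M)
  | fix {Γ : List Ty} {τ ρ : Ty} (M : Tm S L (τ :: Ty.arr τ ρ :: Γ) ρ) : IsValue (fix M)
  | prim {Γ : List Ty} (f : S.Op) (M : Fin (S.arity f) → Tm S L Γ Ty.real)
      (h : ∀ i, IsValue (M i)) : IsValue (prim f M)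

/-- All sample variables of the term are among the first `n` ones. -/
def SvarsBelow (n : ℕ) : {Γ : List Ty} → {τ : Ty} → Tm S L Γ τ → Prop
  | _, _, var _ => True
  | _, _, lit _ => True
  | _, _, svar i => i < n
  | _, _, lam M => SvarsBelow n M
  | _, _, fix M => SvarsBelow n M
  | _, _, app M N => SvarsBelow n M ∧ SvarsBelow n N
  | _, _, ite M N P => SvarsBelow n M ∧ SvarsBelow n N ∧ SvarsBelow n P
  | _, _, prim _ M => ∀ i, SvarsBelow n (M i)
  | _, _, sample => True
  | _, _, score M => SvarsBelow n M

/-- The real number `𝒱[s/α]` denoted by an interval-free symbolic value `𝒱` of real type, where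
`s` assigns reals to the sample variables. The closed values of real type are built from the first
three cases; the last one is never used. -/
def eval (s : ℕ → ℝ) : {Γ : List Ty} → {τ : Ty} → Tm S ℝ Γ τ → ℝ
  | _, _, lit r => r
  | _, _, svar i => s i
  | _, _, prim f M => S.fn f (fun i => eval s (M i))
  | _, _, _ => 0

/-- The set `⌜𝒱[s/α]⌝` of all reals that a symbolic interval value `𝒱` of real type can evaluate
to when every occurrence of an interval is replaced with one of its elements. -/
def evalSet (s : ℕ → ℝ) : {Γ : List Ty} → {τ : Ty} → Tm S Interval Γ τ → Set ℝ
  | _, _, lit I => I.toSet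
  | _, _, svar i => {s i}
  | _, _, prim f M => S.fn f '' {x | ∀ i, x i ∈ evalSet s (M i)}
  | _, _, _ => ∅

end Tm

/-! ### Symbolic execution -/

/-- The comparisons allowed in symbolic constraints. -/
inductive Cmp : Type
  | le | lt | ge | gt

/-- The meaning of a comparison. -/
def Cmp.Holds : Cmp → ℝ → ℝ → Prop
  | Cmp.le, x, r => x ≤ r
  | Cmp.lt, x, r => x < r
  | Cmp.ge, x, r => x ≥ r
  | Cmp.gt, x, r => x > r

/-- A symbolic constraint `𝒱 ⋈ r`. -/
structure Constraint (S : Signature) (L : Type) where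
  val : Tm S L [] Ty.real
  cmp : Cmp
  bound : ℝ

/-- The part `(n, Δ, Ξ)` of a symbolic configuration: the number of sample variables used so far,
the list of the constraints and the list of the scored values on the current path. -/
structure State (S : Signature) (L : Type) where
  n : ℕ
  constraints : List (Constraint S L)
  scores : List (Tm S L [] Ty.real)

/-- Symbolic configurations `(ℳ, n, Δ, Ξ)` with `ℳ` a closed term of real type. -/
structure Config (S : Signature) (L : Type) extends State S L where
  term : Tm S L [] Ty.real

section Step

variable {S : Signature} {L : Type}

/-- Symbolic reduction of closed terms, with call-by-value evaluation contexts. -/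
inductive Step : {τ : Ty} → Tm S L [] τ → State S L → Tm S L [] τ → State S L → Prop
  | beta {τ ρ : Ty} (M : Tm S L [τ] ρ) (V : Tm S L [] τ) (st : State S L) (hV : V.IsValue) :
      Step (Tm.app (Tm.lam M) V) st (M.inst V) st
  | unfold {τ ρ : Ty} (M : Tm S L [τ, Ty.arr τ ρ] ρ) (V : Tm S L [] τ) (st : State S L)
      (hV : V.IsValue) :
      Step (Tm.app (Tm.fix M) V) st (M.inst₂ V (Tm.fix M)) st
  | sample (n : ℕ) (Δ : List (Constraint S L)) (Ξ : List (Tm S L [] Ty.real)) :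
      Step Tm.sample ⟨n, Δ, Ξ⟩ (Tm.svar n) ⟨n + 1, Δ, Ξ⟩
  | iteLe {τ : Ty} (V : Tm S L [] Ty.real) (N P : Tm S L [] τ) (n : ℕ)
      (Δ : List (Constraint S L)) (Ξ : List (Tm S L [] Ty.real)) (hV : V.IsValue) :
      Step (Tm.ite V N P) ⟨n, Δ, Ξ⟩ N ⟨n, ⟨V, Cmp.le, 0⟩ :: Δ, Ξ⟩
  | iteGt {τ : Ty} (V : Tm S L [] Ty.real) (N P : Tm S L [] τ) (n : ℕ)
      (Δ : List (Constraint S L)) (Ξ : List (Tm S L [] Ty.real)) (hV : V.IsValue) :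
      Step (Tm.ite V N P) ⟨n, Δ, Ξ⟩ P ⟨n, ⟨V, Cmp.gt, 0⟩ :: Δ, Ξ⟩
  | score (V : Tm S L [] Ty.real) (n : ℕ)
      (Δ : List (Constraint S L)) (Ξ : List (Tm S L [] Ty.real)) (hV : V.IsValue) :
      Step (Tm.score V) ⟨n, Δ, Ξ⟩ V ⟨n, ⟨V, Cmp.ge, 0⟩ :: Δ, V :: Ξ⟩
  | ctxAppLeft {τ ρ : Ty} (M M' : Tm S L [] (Ty.arr τ ρ)) (N : Tm S L [] τ) (st st' : State S L)
      (h : Step M st M' st') : Step (Tm.app M N) st (Tm.app M' N) st'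
  | ctxAppRight {τ ρ : Ty} (V : Tm S L [] (Ty.arr τ ρ)) (N N' : Tm S L [] τ) (st st' : State S L)
      (hV : V.IsValue) (h : Step N st N' st') : Step (Tm.app V N) st (Tm.app V N') st'
  | ctxIte {τ : Ty} (M M' : Tm S L [] Ty.real) (N P : Tm S L [] τ) (st st' : State S L)
      (h : Step M st M' st') : Step (Tm.ite M N P) st (Tm.ite M' N P) st'
  | ctxPrim (f : S.Op) (M : Fin (S.arity f) → Tm S L [] Ty.real) (i : Fin (S.arity f))
      (M' : Tm S L [] Ty.real) (st st' : State S L) (hM : ∀ j, j < i → (M j).IsValue)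
      (h : Step (M i) st M' st') :
      Step (Tm.prim f M) st (Tm.prim f (Function.update M i M')) st'
  | ctxScore (M M' : Tm S L [] Ty.real) (st st' : State S L)
      (h : Step M st M' st') : Step (Tm.score M) st (Tm.score M') st'

/-- One step of symbolic execution of configurations. -/
def Config.Red (ψ ψ' : Config S L) : Prop := Step ψ.term ψ.toState ψ'.term ψ'.toState

/-- The symbolic paths of `ψ`: the configurations reachable from `ψ` whose term is a value. -/
def symPaths (ψ : Config S L) : Set (Config S L) :=
  {Ψ | Relation.ReflTransGen Config.Red ψ Ψ ∧ Ψ.term.IsValue}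

end Step

/-! ### Denotations of paths -/

open Classical in
/-- Iverson brackets. -/
def iverson (p : Prop) : ℝ≥0∞ := if p then 1 else 0

/-- The unit cube `[0, 1]ⁿ`. -/
def cube (n : ℕ) : Set (Fin n → ℝ) := {s | ∀ i, 0 ≤ s i ∧ s i ≤ 1}

/-- The assignment of the sample variables given by a trace of length `n`; sample variables beyond
the first `n` ones do not occur in configurations with counter `n`. -/
def assign {n : ℕ} (s : Fin n → ℝ) (i : ℕ) : ℝ := if h : i < n then s ⟨i, h⟩ else 0

section Denotation

variable {S : Signature}

/-- The set `Satₙ(Δ)` of the traces in `[0, 1]ⁿ` that satisfy all constraints. -/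
def State.sat (st : State S ℝ) : Set (Fin st.n → ℝ) :=
  {s | s ∈ cube st.n ∧ ∀ C ∈ st.constraints, C.cmp.Holds (C.val.eval (assign s)) C.bound}

/-- The denotation `⟦Ψ⟧(U)` of an interval-free symbolic path. -/
def den (Ψ : Config S ℝ) (U : Set ℝ) : ℝ≥0∞ :=
  ∫⁻ s in cube Ψ.n,
    iverson (Ψ.term.eval (assign s) ∈ U)
    * (Ψ.constraints.map fun C =>
        iverson (C.cmp.Holds (C.val.eval (assign s)) C.bound)).prod
    * (Ψ.scores.map fun W => ENNReal.ofReal (W.eval (assign s))).prod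

/-- The lower bound `⟦Ψ⟧_lb(U)` of a symbolic interval path. -/
def denLB (Ψ : Config S Interval) (U : Set ℝ) : ℝ≥0∞ :=
  ∫⁻ s in cube Ψ.n,
    iverson (Ψ.term.evalSet (assign s) ⊆ U)
    * (Ψ.constraints.map fun C =>
        iverson (∀ t ∈ C.val.evalSet (assign s), C.cmp.Holds t C.bound)).prod
    * (Ψ.scores.map fun W => ⨅ t ∈ W.evalSet (assign s), ENNReal.ofReal t).prod

/-- The upper bound `⟦Ψ⟧_ub(U)` of a symbolic interval path. -/
def denUB (Ψ : Config S Interval) (U : Set ℝ) : ℝ≥0∞ :=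
  ∫⁻ s in cube Ψ.n,
    iverson ((Ψ.term.evalSet (assign s) ∩ U).Nonempty)
    * (Ψ.constraints.map fun C =>
        iverson (∃ t ∈ C.val.evalSet (assign s), C.cmp.Holds t C.bound)).prod
    * (Ψ.scores.map fun W => ⨆ t ∈ W.evalSet (assign s), ENNReal.ofReal t).prod

/-- The invariants of configurations that symbolic execution maintains: constraints and scores are
recorded for values, only the sample variables `α₁, …, αₙ` occur, and the recorded scores are
nonnegative on all traces that satisfy the constraints. -/
structure Config.WellFormed (ψ : Config S ℝ) : Prop where
  constraint_value : ∀ C ∈ ψ.constraints, C.val.IsValue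
  score_value : ∀ W ∈ ψ.scores, W.IsValue
  term_below : ψ.term.SvarsBelow ψ.n
  constraint_below : ∀ C ∈ ψ.constraints, C.val.SvarsBelow ψ.n
  score_below : ∀ W ∈ ψ.scores, W.SvarsBelow ψ.n
  score_nonneg : ∀ s ∈ ψ.sat, ∀ W ∈ ψ.scores, 0 ≤ W.eval (assign s)

/-- Almost sure termination: the traces that satisfy the constraints of one of the symbolic paths
of `ψ` carry the whole mass of the traces that satisfy the constraints of `ψ`. For the initial
configuration of a program, this says that the terminating traces have total measure `1`. -/
def Config.AST (ψ : Config S ℝ) : Prop :=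
  ∑' Ψ : symPaths ψ, volume Ψ.1.sat = volume ψ.sat

end Denotation

/-! ### The weight-aware interval type system -/

/-- Weightless interval types over a simple type: `I`, or `σ → ⟨τ | w⟩`. -/
inductive IType : Ty → Type
  | base (I : Interval) : IType Ty.real
  | arr {α β : Ty} (σ : IType α) (τ : IType β) (w : Interval) : IType (Ty.arr α β)

/-- Weighted interval types `⟨σ | w⟩`. -/
structure WType (α : Ty) where
  type : IType α
  weight : Interval

/-- Subtyping of weightless types. -/
inductive IType.Sub : {α : Ty} → IType α → IType α → Prop
  | base {I J : Interval} (h : I.Sub J) : IType.Sub (IType.base I) (IType.base J)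
  | arr {α β : Ty} {σ₁ σ₂ : IType α} {τ₁ τ₂ : IType β} {w₁ w₂ : Interval}
      (hσ : IType.Sub σ₂ σ₁) (hτ : IType.Sub τ₁ τ₂) (hw : w₁.Sub w₂) :
      IType.Sub (IType.arr σ₁ τ₁ w₁) (IType.arr σ₂ τ₂ w₂)

/-- Subtyping of weighted types. -/
def WType.Sub {α : Ty} (A B : WType α) : Prop := A.type.Sub B.type ∧ A.weight.Sub B.weight

/-- Interval typing contexts. -/
inductive ICtx : List Ty → Type
  | nil : ICtx []
  | cons {Γ : List Ty} {α : Ty} (σ : IType α) (Θ : ICtx Γ) : ICtx (α :: Γ)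

/-- The type that a context assigns to a variable. -/
def ICtx.lookup : {Γ : List Ty} → {α : Ty} → ICtx Γ → Var Γ α → IType α
  | _, _, ICtx.cons σ _, Var.zero => σ
  | _, _, ICtx.cons _ Θ, Var.succ x => Θ.lookup x

/-- Derivations of interval typing judgments `Θ ⊢ M : ⟨σ | w⟩` for interval-free symbolic terms. A
sample variable ranges over `[0, 1]`. -/
inductive Deriv {S : Signature} :
    {Γ : List Ty} → {α : Ty} → ICtx Γ → Tm S ℝ Γ α → WType α → Type
  | var {Γ : List Ty} {α : Ty} {Θ : ICtx Γ} (x : Var Γ α) :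
      Deriv Θ (Tm.var x) ⟨Θ.lookup x, Interval.one⟩
  | sub {Γ : List Ty} {α : Ty} {Θ : ICtx Γ} {M : Tm S ℝ Γ α} {A B : WType α}
      (D : Deriv Θ M A) (h : A.Sub B) : Deriv Θ M B
  | lam {Γ : List Ty} {α β : Ty} {Θ : ICtx Γ} {M : Tm S ℝ (α :: Γ) β} {σ : IType α} {A : WType β}
      (D : Deriv (ICtx.cons σ Θ) M A) :
      Deriv Θ (Tm.lam M) ⟨IType.arr σ A.type A.weight, Interval.one⟩
  | fix {Γ : List Ty} {α β : Ty} {Θ : ICtx Γ} {M : Tm S ℝ (α :: Ty.arr α β :: Γ) β}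
      {σ : IType α} {A : WType β}
      (D : Deriv (ICtx.cons σ (ICtx.cons (IType.arr σ A.type A.weight) Θ)) M A) :
      Deriv Θ (Tm.fix M) ⟨IType.arr σ A.type A.weight, Interval.one⟩
  | app {Γ : List Ty} {α β : Ty} {Θ : ICtx Γ} {M : Tm S ℝ Γ (Ty.arr α β)} {N : Tm S ℝ Γ α}
      {σ : IType α} {τ : IType β} {u v w : Interval}
      (D : Deriv Θ M ⟨IType.arr σ τ w, u⟩) (E : Deriv Θ N ⟨σ, v⟩) :
      Deriv Θ (Tm.app M N) ⟨τ, (u.mul v).mul w⟩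
  | lit {Γ : List Ty} {Θ : ICtx Γ} (r : ℝ) :
      Deriv Θ (Tm.lit r) ⟨IType.base (Interval.point r), Interval.one⟩
  | svar {Γ : List Ty} {Θ : ICtx Γ} (i : ℕ) :
      Deriv Θ (Tm.svar i) ⟨IType.base Interval.unit, Interval.one⟩
  | sample {Γ : List Ty} {Θ : ICtx Γ} :
      Deriv Θ Tm.sample ⟨IType.base Interval.unit, Interval.one⟩
  | ite {Γ : List Ty} {α : Ty} {Θ : ICtx Γ} {M : Tm S ℝ Γ Ty.real} {N P : Tm S ℝ Γ α}
      {I : Interval} {σ : IType α} {u v : Interval}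
      (D : Deriv Θ M ⟨IType.base I, u⟩) (E : Deriv Θ N ⟨σ, v⟩) (F : Deriv Θ P ⟨σ, v⟩) :
      Deriv Θ (Tm.ite M N P) ⟨σ, u.mul v⟩
  | score {Γ : List Ty} {Θ : ICtx Γ} {M : Tm S ℝ Γ Ty.real} {I u : Interval}
      (D : Deriv Θ M ⟨IType.base I, u⟩) (h : 0 ≤ I.hi) :
      Deriv Θ (Tm.score M) ⟨IType.base (I.meetNonneg h), u.mul (I.meetNonneg h)⟩
  | prim {Γ : List Ty} {Θ : ICtx Γ} (f : S.Op) {M : Fin (S.arity f) → Tm S ℝ Γ Ty.real}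
      {I u : Fin (S.arity f) → Interval}
      (D : ∀ i, Deriv Θ (M i) ⟨IType.base (I i), u i⟩) :
      Deriv Θ (Tm.prim f M)
        ⟨IType.base (Interval.lift (S.fn f) I), Interval.lift (fun x => ∏ i, x i) u⟩

/-! ### Approximation of fixpoints -/

/-- The symbolic interval term that summarises a value of a given interval type: the interval `I`
itself for `I`, and `λ_. (score(w); summary of τ)` for `σ → ⟨τ | w⟩`, where `M; N` abbreviates
`(λ_. N) M`. -/
def IType.summary {S : Signature} : {Γ : List Ty} → {α : Ty} → IType α → Tm S Interval Γ α
  | _, _, IType.base I => Tm.lit I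
  | _, _, IType.arr _ τ w => Tm.lam (Tm.app (Tm.lam τ.summary) (Tm.score (Tm.lit w)))

/-- The term with every fixpoint replaced by the summary of the type that the derivation gives
to it. -/
def Deriv.approx {S : Signature} :
    {Γ : List Ty} → {α : Ty} → {Θ : ICtx Γ} → {M : Tm S ℝ Γ α} → {A : WType α} →
      Deriv Θ M A → Tm S Interval Γ α
  | _, _, _, _, _, Deriv.var x => Tm.var x
  | _, _, _, _, _, Deriv.sub D _ => D.approx
  | _, _, _, _, _, Deriv.lam D => Tm.lam D.approx
  | _, _, _, _, _, Deriv.fix (σ := σ) (A := A) _ => (IType.arr σ A.type A.weight).summary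
  | _, _, _, _, _, Deriv.app D E => Tm.app D.approx E.approx
  | _, _, _, _, _, Deriv.lit r => Tm.lit (Interval.point r)
  | _, _, _, _, _, Deriv.svar i => Tm.svar i
  | _, _, _, _, _, Deriv.sample => Tm.sample
  | _, _, _, _, _, Deriv.ite D E F => Tm.ite D.approx E.approx F.approx
  | _, _, _, _, _, Deriv.score D _ => Tm.score D.approx
  | _, _, _, _, _, Deriv.prim f D => Tm.prim f (fun i => (D i).approx)

/-- The symbolic interval configuration `approxFix(ψ)` obtained from a typing derivation for the
term of `ψ`; constraints and scores are kept, with each literal `r` read as `[r, r]`. -/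
def approxFix {S : Signature} (ψ : Config S ℝ) {A : WType Ty.real}
    (D : Deriv ICtx.nil ψ.term A) : Config S Interval where
  n := ψ.n
  constraints := ψ.constraints.map fun C => ⟨C.val.mapLit Interval.point, C.cmp, C.bound⟩
  scores := ψ.scores.map fun W => W.mapLit Interval.point
  term := D.approx

end SPCF

end

noncomputable section

namespace SPCF

/-! ### Universal measurability of analytic sets -/

section Analytic

open Filter Topology

/-- The sequences whose first `k` terms are bounded by those of `b`. -/
def boundedPrefix (b : ℕ → ℕ) (k : ℕ) : Set (ℕ → ℕ) := {x | ∀ i < k, x i ≤ b i}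

theorem iInter_closure_image_boundedPrefix_subset {X : Type*} [TopologicalSpace X]
    [FirstCountableTopology X] [T2Space X] {f : (ℕ → ℕ) → X} (hf : Continuous f) (b : ℕ → ℕ) :
    ⋂ k, closure (f '' boundedPrefix b k) ⊆ f '' {x | ∀ i, x i ≤ b i} := by
  intro y hy
  obtain ⟨U, hU⟩ := (𝓝 y).exists_antitone_basis
  have h1 : ∀ k, ∃ x ∈ boundedPrefix b k, f x ∈ U k := by
    intro k
    have := mem_closure_iff_nhds.1 (Set.mem_iInter.1 hy k) (U k) (hU.1.mem_of_mem trivial)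
    obtain ⟨_, h1, x, hx, rfl⟩ := this
    exact ⟨x, hx, h1⟩
  choose x hx hxU using h1
  have hlim : Tendsto (fun k => f (x k)) atTop (𝓝 y) := hU.tendsto hxU
  let c : ℕ → ℕ := fun i => b i + ∑ k ∈ Finset.range (i + 1), x k i
  have hc : ∀ k i, x k i ≤ c i := by
    intro k i
    by_cases h : i < k
    · exact (hx k i h).trans (Nat.le_add_right _ _)
    · have : x k i ≤ ∑ k ∈ Finset.range (i + 1), x k i :=
        Finset.single_le_sum (f := fun k => x k i) (fun _ _ => Nat.zero_le _)
          (Finset.mem_range.2 (by omega))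
      exact this.trans (Nat.le_add_left _ _)
  have hK : IsCompact (Set.pi Set.univ fun i => Set.Iic (c i)) :=
    isCompact_univ_pi fun i => (Set.finite_Iic (c i)).isCompact
  obtain ⟨z, -, φ, hφ, hz⟩ := hK.tendsto_subseq (x := x) (fun k => by
    intro i _
    exact hc k i)
  refine ⟨z, ?_, ?_⟩
  · intro i
    have h2 : Tendsto (fun k => x (φ k) i) atTop (𝓝 (z i)) := ((continuous_apply i).tendsto z).comp hz
    refine le_of_tendsto h2 ?_
    filter_upwards [eventually_gt_atTop i] with k hk
    exact hx (φ k) i (hk.trans_le (hφ.id_le k))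
  · have h3 : Tendsto (fun k => f (x (φ k))) atTop (𝓝 (f z)) := (hf.tendsto z).comp hz
    exact tendsto_nhds_unique h3 (hlim.comp hφ.tendsto_atTop)

/-- Analytic sets are inner regular with respect to closed sets. -/
theorem exists_isClosed_subset_of_analyticSet {X : Type*} [TopologicalSpace X]
    [FirstCountableTopology X] [T2Space X] [MeasurableSpace X] [OpensMeasurableSpace X]
    (μ : Measure X) [IsFiniteMeasure μ] {A : Set X} (hA : AnalyticSet A) {r : ℝ≥0∞}
    (hr : r < μ A) : ∃ K ⊆ A, IsClosed K ∧ r ≤ μ K := by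
  rw [AnalyticSet] at hA
  obtain rfl | ⟨f, hf, rfl⟩ := hA
  · simp at hr
  have step : ∀ (k : ℕ) (b : ℕ → ℕ), r < μ (f '' boundedPrefix b k) →
      ∃ m, r < μ (f '' boundedPrefix (Function.update b k m) (k + 1)) := by
    intro k b h
    have hU : f '' boundedPrefix b k
        = ⋃ m, f '' boundedPrefix (Function.update b k m) (k + 1) := by
      rw [← Set.image_iUnion]
      congr 1
      ext x
      simp only [boundedPrefix, Set.mem_ofPred_eq, Set.mem_iUnion]
      constructor
      · intro hx
        refine ⟨x k, fun i hi => ?_⟩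
        rcases Nat.lt_succ_iff_lt_or_eq.1 hi with h | rfl
        · rw [Function.update_of_ne h.ne]; exact hx i h
        · simp
      · rintro ⟨m, hx⟩ i hi
        have := hx i (by omega)
        rwa [Function.update_of_ne hi.ne] at this
    have hm : Monotone fun m => f '' boundedPrefix (Function.update b k m) (k + 1) := by
      intro m n hmn
      refine Set.image_mono fun x hx i hi => (hx i hi).trans ?_
      rcases eq_or_ne i k with rfl | h
      · simpa using hmn
      · simp [Function.update_of_ne h]
    rw [hU, hm.measure_iUnion, lt_iSup_iff] at h
    exact h
  choose! m hm using step
  let B : ℕ → (ℕ → ℕ) := fun k => Nat.rec (fun _ => 0) (fun k b => Function.update b k (m k b)) k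
  have hB : ∀ k, B (k + 1) = Function.update (B k) k (m k (B k)) := fun k => rfl
  have hBr : ∀ k, r < μ (f '' boundedPrefix (B k) k) := by
    intro k
    induction k with
    | zero =>
      have : boundedPrefix (B 0) 0 = Set.univ := by ext; simp [boundedPrefix]
      rwa [this, Set.image_univ]
    | succ k ih => rw [hB]; exact hm k _ ih
  let b : ℕ → ℕ := fun i => B (i + 1) i
  have hBb : ∀ k i, i < k → B k i = b i := by
    intro k
    induction k with
    | zero => intro i hi; omega
    | succ k ih =>
      intro i hi
      rcases Nat.lt_succ_iff_lt_or_eq.1 hi with h | rfl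
      · rw [hB, Function.update_of_ne h.ne]; exact ih i h
      · rfl
  have hb : ∀ k, boundedPrefix (B k) k = boundedPrefix b k := by
    intro k
    ext x
    exact forall₂_congr fun i hi => by rw [hBb k i hi]
  refine ⟨⋂ k, closure (f '' boundedPrefix b k), ?_, isClosed_iInter fun _ => isClosed_closure, ?_⟩
  · exact (iInter_closure_image_boundedPrefix_subset hf b).trans (Set.image_subset_range _ _)
  · have ha : Antitone fun k => closure (f '' boundedPrefix b k) := by
      intro k l hkl
      exact closure_mono (Set.image_mono fun x hx i hi => hx i (hi.trans_le hkl))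
    rw [ha.measure_iInter (fun k => isClosed_closure.measurableSet.nullMeasurableSet)
      ⟨0, measure_ne_top _ _⟩]
    exact le_iInf fun k => ((hb k ▸ hBr k).le).trans (measure_mono subset_closure)

theorem nullMeasurableSet_of_analyticSet {X : Type*} [TopologicalSpace X]
    [FirstCountableTopology X] [T2Space X] [MeasurableSpace X] [OpensMeasurableSpace X]
    (μ : Measure X) [IsFiniteMeasure μ] {A : Set X} (hA : AnalyticSet A) :
    NullMeasurableSet A μ := by
  rcases eq_or_ne (μ A) 0 with h0 | h0
  · exact NullMeasurableSet.of_null h0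
  obtain ⟨u, -, hu, hlim⟩ := exists_seq_strictMono_tendsto' (pos_iff_ne_zero.2 h0)
  choose K hKA hKc hKr using fun n => exists_isClosed_subset_of_analyticSet μ hA (hu n).2
  have hS : MeasurableSet (⋃ n, K n) := MeasurableSet.iUnion fun n => (hKc n).measurableSet
  have hle : μ A ≤ μ (⋃ n, K n) :=
    le_of_tendsto' hlim fun n => (hKr n).trans (measure_mono (Set.subset_iUnion K n))
  have hsub : (⋃ n, K n) ⊆ A := Set.iUnion_subset hKA
  exact hS.nullMeasurableSet.congr
    (ae_eq_of_subset_of_measure_ge hsub hle hS.nullMeasurableSet (measure_ne_top _ _))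

end Analytic

/-! ### Universally measurable functions -/

/-- Universally measurable functions with values in `[0, ∞]`. -/
def UMeas {X : Type*} [MeasurableSpace X] (f : X → ℝ≥0∞) : Prop :=
  ∀ μ : Measure X, IsFiniteMeasure μ → AEMeasurable f μ

namespace UMeas

variable {X Y : Type*} [MeasurableSpace X] [MeasurableSpace Y]

theorem of_measurable {f : X → ℝ≥0∞} (hf : Measurable f) : UMeas f := fun _ _ => hf.aemeasurable

theorem const (c : ℝ≥0∞) : UMeas (fun _ : X => c) := of_measurable measurable_const

theorem add {f g : X → ℝ≥0∞} (hf : UMeas f) (hg : UMeas g) : UMeas fun x => f x + g x :=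
  fun μ h => (hf μ h).add (hg μ h)

theorem mul {f g : X → ℝ≥0∞} (hf : UMeas f) (hg : UMeas g) : UMeas fun x => f x * g x :=
  fun μ h => (hf μ h).mul (hg μ h)

theorem comp_measurable {g : Y → ℝ≥0∞} (hg : UMeas g) {f : X → Y} (hf : Measurable f) :
    UMeas fun x => g (f x) :=
  fun μ _ => (hg (μ.map f) inferInstance).comp_measurable hf

theorem measurable_comp {g : ℝ≥0∞ → ℝ≥0∞} (hg : Measurable g) {f : X → ℝ≥0∞} (hf : UMeas f) :
    UMeas fun x => g (f x) :=
  fun μ h => hg.comp_aemeasurable (hf μ h)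

theorem iSup {f : ℕ → X → ℝ≥0∞} (hf : ∀ n, UMeas (f n)) : UMeas fun x => ⨆ n, f n x :=
  fun μ h => AEMeasurable.iSup fun n => hf n μ h

theorem list_prod {ι : Type*} (l : List ι) {f : ι → X → ℝ≥0∞} (hf : ∀ i ∈ l, UMeas (f i)) :
    UMeas fun x => (l.map fun i => f i x).prod := by
  induction l with
  | nil => simpa using const 1
  | cons i l ih =>
    simp only [List.map_cons, List.prod_cons]
    exact (hf i (by simp)).mul (ih fun j hj => hf j (by simp [hj]))

theorem lintegral_right {f : X × Y → ℝ≥0∞} (hf : UMeas f) (ν : Measure Y) [IsFiniteMeasure ν] :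
    UMeas fun x => ∫⁻ y, f (x, y) ∂ν :=
  fun μ _ => (hf (μ.prod ν) inferInstance).lintegral_prod_right'

theorem of_nullMeasurable {f : X → ℝ≥0∞}
    (hf : ∀ μ : Measure X, IsFiniteMeasure μ → ∀ c, NullMeasurableSet {x | c < f x} μ) :
    UMeas f := by
  intro μ hμ
  have : NullMeasurable f μ := measurable_of_Ioi (δ := NullMeasurableSpace X μ) fun c => hf μ hμ c
  exact this.aemeasurable

theorem iverson {p : X → Prop}
    (hp : ∀ μ : Measure X, IsFiniteMeasure μ → NullMeasurableSet {x | p x} μ) :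
    UMeas fun x => iverson (p x) := by
  refine of_nullMeasurable fun μ hμ c => ?_
  by_cases hc : c < 1
  · convert hp μ hμ using 1
    ext x
    by_cases h : p x <;> simp [SPCF.iverson, h, hc]
  · convert (MeasurableSet.empty (α := X)).nullMeasurableSet using 1
    ext x
    by_cases h : p x <;> simp [SPCF.iverson, h, not_lt.1 hc]

end UMeas

/-- Prepending a term to a sequence of reals. -/
def consSeq (x : ℝ) (s : ℕ → ℝ) : ℕ → ℝ
  | 0 => x
  | i + 1 => s i

theorem measurable_consSeq : Measurable fun p : (ℕ → ℝ) × ℝ => consSeq p.2 p.1 := by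
  refine measurable_pi_iff.2 fun i => ?_
  cases i with
  | zero => exact measurable_snd
  | succ i => exact (measurable_pi_apply i).comp measurable_fst

/-- The uniform distribution on `[0, 1]`. -/
def unif : Measure ℝ := volume.restrict (Set.Icc 0 1)

instance : IsProbabilityMeasure unif := ⟨by simp [unif]⟩

end SPCF

namespace SPCF

/-! ### Actions of closed terms -/

/-- The next action of a term: none, a silent step, a sampling step, a conditional on a value, or
the scoring of a value. -/
inductive Act (S : Signature) (L : Type) (Γ : List Ty) (τ : Ty) : Type
  | ret : Act S L Γ τ
  | tau (M : Tm S L Γ τ) : Act S L Γ τ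
  | smp (K : Tm S L Γ Ty.real → Tm S L Γ τ) : Act S L Γ τ
  | br (V : Tm S L Γ Ty.real) (M N : Tm S L Γ τ) : Act S L Γ τ
  | sc (V : Tm S L Γ Ty.real) (M : Tm S L Γ τ) : Act S L Γ τ

namespace Act

variable {S : Signature} {L L' : Type} {Γ : List Ty} {τ ρ : Ty}

/-- The action of a term in an evaluation context. -/
def map (E : Tm S L Γ τ → Tm S L Γ ρ) : Act S L Γ τ → Act S L Γ ρ
  | ret => ret
  | tau M => tau (E M)
  | smp K => smp fun t => E (K t)
  | br V M N => br V (E M) (E N)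
  | sc V M => sc V (E M)

/-- The action `a`, or `b` if there is none. -/
def orElse (a : Act S L Γ τ) (b : Act S L Γ τ) : Act S L Γ τ :=
  match a with
  | ret => b
  | a => a

/-- Two actions correspond to each other under translations of terms. -/
inductive Rel (f₀ : Tm S L Γ Ty.real → Tm S L' Γ Ty.real) (f : Tm S L Γ τ → Tm S L' Γ τ) :
    Act S L Γ τ → Act S L' Γ τ → Prop
  | ret : Rel f₀ f ret ret
  | tau (M : Tm S L Γ τ) : Rel f₀ f (tau M) (tau (f M))
  | smp (K : Tm S L Γ Ty.real → Tm S L Γ τ) (K' : Tm S L' Γ Ty.real → Tm S L' Γ τ)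
      (h : ∀ t, K' (f₀ t) = f (K t)) : Rel f₀ f (smp K) (smp K')
  | br (V : Tm S L Γ Ty.real) (M N : Tm S L Γ τ) : Rel f₀ f (br V M N) (br (f₀ V) (f M) (f N))
  | sc (V : Tm S L Γ Ty.real) (M : Tm S L Γ τ) : Rel f₀ f (sc V M) (sc (f₀ V) (f M))

theorem Rel.map {f₀ : Tm S L Γ Ty.real → Tm S L' Γ Ty.real} {f : Tm S L Γ τ → Tm S L' Γ τ}
    {g : Tm S L Γ ρ → Tm S L' Γ ρ} {E : Tm S L Γ τ → Tm S L Γ ρ} {E' : Tm S L' Γ τ → Tm S L' Γ ρ}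
    (hE : ∀ M, E' (f M) = g (E M)) {a : Act S L Γ τ} {a' : Act S L' Γ τ} (h : Rel f₀ f a a') :
    Rel f₀ g (a.map E) (a'.map E') := by
  cases h with
  | ret => exact .ret
  | tau M => simpa only [Act.map, hE] using Rel.tau (f₀ := f₀) (f := g) (E M)
  | smp K K' h => exact .smp _ _ fun t => by rw [h, hE]
  | br V M N => simpa only [Act.map, hE] using Rel.br (f₀ := f₀) (f := g) V (E M) (E N)
  | sc V M => simpa only [Act.map, hE] using Rel.sc (f₀ := f₀) (f := g) V (E M)

theorem Rel.orElse {f₀ : Tm S L Γ Ty.real → Tm S L' Γ Ty.real} {f : Tm S L Γ τ → Tm S L' Γ τ}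
    {a b : Act S L Γ τ} {a' b' : Act S L' Γ τ} (h : Rel f₀ f a a') (h' : Rel f₀ f b b') :
    Rel f₀ f (a.orElse b) (a'.orElse b') := by
  cases h with
  | ret => exact h'
  | tau M => exact .tau M
  | smp K K' h => exact .smp K K' h
  | br V M N => exact .br V M N
  | sc V M => exact .sc V M

theorem Rel.ret_iff {f₀ : Tm S L Γ Ty.real → Tm S L' Γ Ty.real} {f : Tm S L Γ τ → Tm S L' Γ τ}
    {a : Act S L Γ τ} {a' : Act S L' Γ τ} (h : Rel f₀ f a a') : a = Act.ret ↔ a' = Act.ret := by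
  cases h <;> simp

theorem orElse_ne {a b : Act S L Γ τ} (h : a ≠ ret) : a.orElse b = a := by
  cases a <;> simp_all [orElse]

@[simp] theorem ret_orElse {b : Act S L Γ τ} : (ret : Act S L Γ τ).orElse b = b := rfl

theorem map_eq_ret {E : Tm S L Γ τ → Tm S L Γ ρ} {a : Act S L Γ τ} : a.map E = ret ↔ a = ret := by
  cases a <;> simp [map]

@[simp] theorem orElse_eq_ret {a b : Act S L Γ τ} : a.orElse b = ret ↔ a = ret ∧ b = ret := by
  cases a <;> simp [orElse]

end Act

namespace Tm

variable {S : Signature} {L L' : Type}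

/-- The action of the application of a value to a value. -/
def betaAct : {Γ : List Ty} → {α τ : Ty} → Tm S L Γ (Ty.arr α τ) → Tm S L Γ α → Act S L Γ τ
  | _, _, _, lam M, V => .tau (M.inst V)
  | _, _, _, fix M, V => .tau (M.inst₂ V (fix M))
  | _, _, _, _, _ => .ret

open Classical in
/-- The next action of a term. -/
def next : {Γ : List Ty} → {τ : Ty} → Tm S L Γ τ → Act S L Γ τ
  | _, _, app M N =>
    ((next M).map fun M' => app M' N).orElse
      (((next N).map fun N' => app M N').orElse (betaAct M N))
  | _, _, ite M N P => ((next M).map fun M' => ite M' N P).orElse (.br M N P)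
  | _, _, prim f M =>
    if h : ∃ i, next (M i) ≠ .ret ∧ ∀ j < i, next (M j) = .ret then
      (next (M h.choose)).map fun M' => prim f (Function.update M h.choose M')
    else .ret
  | _, _, sample => .smp fun t => t
  | _, _, score M => ((next M).map fun M' => score M').orElse (.sc M M)
  | _, _, _ => .ret

/-- A term without a next action. -/
def IsRet {Γ : List Ty} {τ : Ty} (M : Tm S L Γ τ) : Prop := next M = .ret

theorem next_prim {Γ : List Ty} (f : S.Op) (M : Fin (S.arity f) → Tm S L Γ Ty.real)
    (i : Fin (S.arity f)) (hj : ∀ j < i, (M j).IsRet) (hi : ¬ (M i).IsRet) :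
    next (prim f M) = (next (M i)).map fun M' => prim f (Function.update M i M') := by
  have h : ∃ i, next (M i) ≠ .ret ∧ ∀ j < i, next (M j) = .ret := ⟨i, hi, hj⟩
  have hc : h.choose = i := by
    rcases lt_trichotomy h.choose i with h' | h' | h'
    · exact absurd (hj _ h') h.choose_spec.1
    · exact h'
    · exact absurd (h.choose_spec.2 _ h') hi
  rw [next, dif_pos h, hc]

theorem next_prim_ret {Γ : List Ty} (f : S.Op) (M : Fin (S.arity f) → Tm S L Γ Ty.real)
    (h : ∀ j, (M j).IsRet) : (prim f M).IsRet := by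
  rw [IsRet, next, dif_neg]
  rintro ⟨i, hi, -⟩
  exact hi (h i)

theorem exists_first {Γ : List Ty} {k : ℕ} (M : Fin k → Tm S L Γ Ty.real) :
    (∀ j, (M j).IsRet) ∨ ∃ i, ¬ (M i).IsRet ∧ ∀ j < i, (M j).IsRet := by
  by_cases h : ∀ j, (M j).IsRet
  · exact .inl h
  · right
    have h' : ({i | ¬ (M i).IsRet} : Set (Fin k)).Nonempty := not_forall.1 h
    obtain ⟨i, hi, hmin⟩ := (Set.toFinite _).exists_minimal h'
    exact ⟨i, hi, fun j hj => by_contra fun hn => absurd (hmin hn hj.le) (not_le.2 hj)⟩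

theorem isRet_prim_iff {Γ : List Ty} {f : S.Op} {M : Fin (S.arity f) → Tm S L Γ Ty.real} :
    (prim f M).IsRet ↔ ∀ j, (M j).IsRet := by
  refine ⟨fun h => ?_, next_prim_ret f M⟩
  rcases exists_first M with h' | ⟨i, hi, hj⟩
  · exact h'
  · rw [IsRet, next_prim f M i hj hi, Act.map_eq_ret] at h
    exact absurd h hi

theorem IsValue.isRet {Γ : List Ty} {τ : Ty} {M : Tm S L Γ τ} (h : M.IsValue) : M.IsRet := by
  induction h with
  | prim f M h ih => exact next_prim_ret f M ih
  | _ => rfl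

theorem isValue_of_isRet_aux {Γ : List Ty} {τ : Ty} (M : Tm S L Γ τ) (hΓ : Γ = [])
    (h : M.IsRet) : M.IsValue := by
  induction M with
  | var x => exact .var x
  | lit l => exact .lit l
  | svar i => exact .svar i
  | lam M _ => exact .lam M
  | fix M _ => exact .fix M
  | app M N ihM ihN =>
    subst hΓ
    simp only [IsRet, next, Act.orElse_eq_ret, Act.map_eq_ret] at h
    cases ihM rfl h.1 with
    | var x => cases x
    | lam M => simp [betaAct] at h
    | fix M => simp [betaAct] at h
  | ite M N P _ _ _ => simp [IsRet, next] at h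
  | prim f M ih => exact .prim f M fun i => ih i hΓ (isRet_prim_iff.1 h i)
  | sample => simp [IsRet, next] at h
  | score M _ => simp [IsRet, next] at h

theorem isRet_iff_isValue {τ : Ty} {M : Tm S L [] τ} : M.IsRet ↔ M.IsValue :=
  ⟨isValue_of_isRet_aux M rfl, IsValue.isRet⟩

end Tm

/-! ### Evaluation frames -/

section Frame

variable {S : Signature} {L : Type}

/-- One layer of an evaluation context. -/
inductive Frame {S : Signature} {L : Type} :
    {τ ρ : Ty} → (Tm S L [] τ → Tm S L [] ρ) → Prop
  | appLeft {τ ρ : Ty} (N : Tm S L [] τ) :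
      Frame (fun M : Tm S L [] (Ty.arr τ ρ) => Tm.app M N)
  | appRight {τ ρ : Ty} (V : Tm S L [] (Ty.arr τ ρ)) (hV : V.IsRet) :
      Frame (fun N => Tm.app V N)
  | ite {τ : Ty} (N P : Tm S L [] τ) : Frame (fun M => Tm.ite M N P)
  | prim (f : S.Op) (M : Fin (S.arity f) → Tm S L [] Ty.real) (i : Fin (S.arity f))
      (hM : ∀ j < i, (M j).IsRet) : Frame (fun M' => Tm.prim f (Function.update M i M'))
  | score : Frame (fun M => Tm.score M)

theorem Frame.next_eq {τ ρ : Ty} {E : Tm S L [] τ → Tm S L [] ρ} (hE : Frame E) {M : Tm S L [] τ}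
    (hM : ¬ M.IsRet) : (E M).next = M.next.map E := by
  have hm : ∀ {ρ : Ty} {E : Tm S L [] τ → Tm S L [] ρ}, M.next.map E ≠ .ret :=
    fun h => hM (Act.map_eq_ret.1 h)
  cases hE with
  | appLeft N => rw [Tm.next, Act.orElse_ne hm]
  | appRight V hV =>
    have : Tm.next V = .ret := hV
    rw [Tm.next, this, Act.map, Act.ret_orElse, Act.orElse_ne hm]
  | ite N P => rw [Tm.next, Act.orElse_ne hm]
  | prim f M₀ i h =>
    rw [Tm.next_prim f _ i]
    · simp
    · intro j hj
      rw [Function.update_of_ne hj.ne]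
      exact h j hj
    · simpa using hM
  | score => rw [Tm.next, Act.orElse_ne hm]

end Frame

/-! ### Symbolic execution in terms of actions -/

section Succ

variable {S : Signature} {L : Type}

/-- The successors of a term with a given action. -/
def Act.Succ {τ : Ty} (a : Act S L [] τ) (st : State S L) (M' : Tm S L [] τ) (st' : State S L) :
    Prop :=
  match a with
  | .ret => False
  | .tau M => M' = M ∧ st' = st
  | .smp K => M' = K (Tm.svar st.n) ∧ st' = ⟨st.n + 1, st.constraints, st.scores⟩
  | .br V M N => (M' = M ∧ st' = ⟨st.n, ⟨V, Cmp.le, 0⟩ :: st.constraints, st.scores⟩) ∨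
      (M' = N ∧ st' = ⟨st.n, ⟨V, Cmp.gt, 0⟩ :: st.constraints, st.scores⟩)
  | .sc V M => M' = M ∧ st' = ⟨st.n, ⟨V, Cmp.ge, 0⟩ :: st.constraints, V :: st.scores⟩

theorem Act.Succ.map {τ ρ : Ty} {a : Act S L [] τ} {st st' : State S L} {M' : Tm S L [] τ}
    (h : a.Succ st M' st') (E : Tm S L [] τ → Tm S L [] ρ) : (a.map E).Succ st (E M') st' := by
  cases a with
  | ret => exact h
  | tau M => exact ⟨congrArg E h.1, h.2⟩
  | smp K => exact ⟨congrArg E h.1, h.2⟩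
  | br V M N => exact h.imp (fun h => ⟨congrArg E h.1, h.2⟩) (fun h => ⟨congrArg E h.1, h.2⟩)
  | sc V M => exact ⟨congrArg E h.1, h.2⟩

theorem Act.Succ.of_map {τ ρ : Ty} {a : Act S L [] τ} {st st' : State S L} {M' : Tm S L [] ρ}
    {E : Tm S L [] τ → Tm S L [] ρ} (h : (a.map E).Succ st M' st') :
    ∃ M, M' = E M ∧ a.Succ st M st' := by
  cases a with
  | ret => exact h.elim
  | tau M => exact ⟨M, h.1, rfl, h.2⟩
  | smp K => exact ⟨_, h.1, rfl, h.2⟩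
  | br V M N =>
    rcases h with h | h
    · exact ⟨M, h.1, .inl ⟨rfl, h.2⟩⟩
    · exact ⟨N, h.1, .inr ⟨rfl, h.2⟩⟩
  | sc V M => exact ⟨M, h.1, rfl, h.2⟩

theorem Act.Succ.ne_ret {τ : Ty} {a : Act S L [] τ} {st st' : State S L} {M' : Tm S L [] τ}
    (h : a.Succ st M' st') : a ≠ .ret := by
  rintro rfl
  exact h

theorem Frame.succ {τ ρ : Ty} {E : Tm S L [] τ → Tm S L [] ρ} (hE : Frame E) {M M' : Tm S L [] τ}
    {st st' : State S L} (h : M.next.Succ st M' st') : (E M).next.Succ st (E M') st' := by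
  rw [hE.next_eq h.ne_ret]
  exact h.map E

theorem Step.succ {τ : Ty} {M M' : Tm S L [] τ} {st st' : State S L} (h : Step M st M' st') :
    M.next.Succ st M' st' := by
  induction h with
  | beta M V st hV =>
    have : Tm.next V = .ret := hV.isRet
    simp [Tm.next, this, Act.map, Tm.betaAct, Act.Succ]
  | unfold M V st hV =>
    have : Tm.next V = .ret := hV.isRet
    simp [Tm.next, this, Act.map, Tm.betaAct, Act.Succ]
  | sample n Δ Ξ => exact ⟨rfl, rfl⟩
  | iteLe V N P n Δ Ξ hV =>
    have : Tm.next V = .ret := hV.isRet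
    simp [Tm.next, this, Act.map, Act.Succ]
  | iteGt V N P n Δ Ξ hV =>
    have : Tm.next V = .ret := hV.isRet
    simp [Tm.next, this, Act.map, Act.Succ]
  | score V n Δ Ξ hV =>
    have : Tm.next V = .ret := hV.isRet
    simp [Tm.next, this, Act.map, Act.Succ]
  | ctxAppLeft M M' N st st' h ih => exact (Frame.appLeft N).succ ih
  | ctxAppRight V N N' st st' hV h ih => exact (Frame.appRight V hV.isRet).succ ih
  | ctxIte M M' N P st st' h ih => exact (Frame.ite N P).succ ih
  | ctxPrim f M i M' st st' hM h ih =>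
    have := (Frame.prim f M i fun j hj => (hM j hj).isRet).succ ih
    simpa using this
  | ctxScore M M' st st' h ih => exact Frame.score.succ ih

theorem Act.Succ.step_aux {Γ : List Ty} {τ : Ty} (M : Tm S L Γ τ) (hΓ : Γ = []) :
    ∀ {M' : Tm S L Γ τ} {st st' : State S L},
      Act.Succ (hΓ ▸ M.next) st (hΓ ▸ M') st' → Step (hΓ ▸ M) st (hΓ ▸ M') st' := by
  induction M with
  | var x => subst hΓ; cases x
  | lit l => subst hΓ; intro _ _ _ h; exact h.elim
  | svar i => subst hΓ; intro _ _ _ h; exact h.elim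
  | lam M _ => subst hΓ; intro _ _ _ h; exact h.elim
  | fix M _ => subst hΓ; intro _ _ _ h; exact h.elim
  | app M N ihM ihN =>
    subst hΓ
    intro M' st st' h
    replace ihM := @ihM rfl
    replace ihN := @ihN rfl
    simp only at ihM ihN h ⊢
    by_cases hM : M.IsRet
    · by_cases hN : N.IsRet
      · have hN' := Tm.isRet_iff_isValue.1 hN
        have hM' := Tm.isRet_iff_isValue.1 hM
        rw [Tm.IsRet] at hM hN
        simp only [Tm.next, hM, hN, Act.map, Act.ret_orElse] at h
        cases hM' with
        | var x => cases x
        | lam M => obtain ⟨rfl, rfl⟩ := h; exact .beta _ _ _ hN'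
        | fix M => obtain ⟨rfl, rfl⟩ := h; exact .unfold _ _ _ hN'
      · rw [(Frame.appRight M hM).next_eq hN] at h
        obtain ⟨N', rfl, h'⟩ := h.of_map
        exact .ctxAppRight _ _ _ _ _ (Tm.isRet_iff_isValue.1 hM) (ihN h')
    · rw [(Frame.appLeft N).next_eq hM] at h
      obtain ⟨N', rfl, h'⟩ := h.of_map
      exact .ctxAppLeft _ _ _ _ _ (ihM h')
  | ite M N P ih _ _ =>
    subst hΓ
    intro M' st st' h
    replace ih := @ih rfl
    simp only at ih h ⊢
    by_cases hM : M.IsRet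
    · have hM' := Tm.isRet_iff_isValue.1 hM
      rw [Tm.IsRet] at hM
      simp only [Tm.next, hM, Act.map, Act.ret_orElse] at h
      rcases h with ⟨rfl, rfl⟩ | ⟨rfl, rfl⟩
      · exact .iteLe _ _ _ _ _ _ hM'
      · exact .iteGt _ _ _ _ _ _ hM'
    · rw [(Frame.ite N P).next_eq hM] at h
      obtain ⟨N', rfl, h'⟩ := h.of_map
      exact .ctxIte _ _ _ _ _ _ (ih h')
  | prim f M ih =>
    subst hΓ
    intro M' st st' h
    replace ih := fun i => @ih i rfl
    simp only at ih h ⊢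
    rcases Tm.exists_first M with hM | ⟨i, hi, hj⟩
    · exact absurd (Tm.next_prim_ret f M hM) h.ne_ret
    · rw [Tm.next_prim f M i hj hi] at h
      obtain ⟨N', rfl, h'⟩ := h.of_map
      exact .ctxPrim _ _ _ _ _ _ (fun j h => Tm.isRet_iff_isValue.1 (hj j h)) (ih i h')
  | sample => subst hΓ; intro _ _ _ h; obtain ⟨rfl, rfl⟩ := h; exact .sample _ _ _
  | score M ih =>
    subst hΓ
    intro M' st st' h
    replace ih := @ih rfl
    simp only at ih h ⊢
    by_cases hM : M.IsRet
    · have hM' := Tm.isRet_iff_isValue.1 hM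
      rw [Tm.IsRet] at hM
      simp only [Tm.next, hM, Act.map, Act.ret_orElse] at h
      obtain ⟨rfl, rfl⟩ := h
      exact .score _ _ _ _ hM'
    · rw [Frame.score.next_eq hM] at h
      obtain ⟨N', rfl, h'⟩ := h.of_map
      exact .ctxScore _ _ _ _ (ih h')

theorem step_iff_succ {τ : Ty} {M M' : Tm S L [] τ} {st st' : State S L} :
    Step M st M' st' ↔ M.next.Succ st M' st' :=
  ⟨Step.succ, fun h => Act.Succ.step_aux M rfl h⟩

end Succ

end SPCF

namespace SPCF

namespace Tm

variable {S : Signature} {L L' L'' : Type}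

/-! ### Substitution lemmas -/

theorem ren_ren {Γ Δ Ω : List Ty} {τ : Ty} (M : Tm S L Γ τ) (r : ∀ τ, Var Γ τ → Var Δ τ)
    (r' : ∀ τ, Var Δ τ → Var Ω τ) : ren r' (ren r M) = ren (fun τ x => r' τ (r τ x)) M := by
  have hl : ∀ {Γ Δ Ω : List Ty} (r : ∀ τ, Var Γ τ → Var Δ τ) (r' : ∀ τ, Var Δ τ → Var Ω τ) (ρ : Ty),
      (fun τ x => liftRen r' ρ τ (liftRen r ρ τ x)) = liftRen (fun τ x => r' τ (r τ x)) ρ := by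
    intros
    funext τ x
    cases x <;> rfl
  induction M generalizing Δ Ω with
  | prim f M ih => simp only [ren]; congr 1; funext i; exact ih i _ _
  | lam M ih => simp only [ren]; rw [ih, hl]
  | fix M ih => simp only [ren]; rw [ih, hl, hl]
  | app M N ihM ihN => simp only [ren]; rw [ihM, ihN]
  | ite M N P ihM ihN ihP => simp only [ren]; rw [ihM, ihN, ihP]
  | score M ih => simp only [ren]; rw [ih]
  | _ => rfl

theorem subst_ren {Γ Δ Ω : List Ty} {τ : Ty} (M : Tm S L Γ τ) (r : ∀ τ, Var Γ τ → Var Δ τ)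
    (s : ∀ τ, Var Δ τ → Tm S L Ω τ) : subst s (ren r M) = subst (fun τ x => s τ (r τ x)) M := by
  have hl : ∀ {Γ Δ Ω : List Ty} (r : ∀ τ, Var Γ τ → Var Δ τ) (s : ∀ τ, Var Δ τ → Tm S L Ω τ)
      (ρ : Ty), (fun τ x => liftSubst s ρ τ (liftRen r ρ τ x))
        = liftSubst (fun τ x => s τ (r τ x)) ρ := by
    intros
    funext τ x
    cases x <;> rfl
  induction M generalizing Δ Ω with
  | prim f M ih => simp only [ren, subst]; congr 1; funext i; exact ih i _ _
  | lam M ih => simp only [ren, subst]; rw [ih, hl]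
  | fix M ih => simp only [ren, subst]; rw [ih, hl, hl]
  | app M N ihM ihN => simp only [ren, subst]; rw [ihM, ihN]
  | ite M N P ihM ihN ihP => simp only [ren, subst]; rw [ihM, ihN, ihP]
  | score M ih => simp only [ren, subst]; rw [ih]
  | _ => rfl

theorem ren_subst {Γ Δ Ω : List Ty} {τ : Ty} (M : Tm S L Γ τ) (s : ∀ τ, Var Γ τ → Tm S L Δ τ)
    (r : ∀ τ, Var Δ τ → Var Ω τ) : ren r (subst s M) = subst (fun τ x => ren r (s τ x)) M := by
  have hl : ∀ {Γ Δ Ω : List Ty} (s : ∀ τ, Var Γ τ → Tm S L Δ τ) (r : ∀ τ, Var Δ τ → Var Ω τ)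
      (ρ : Ty), (fun τ x => ren (liftRen r ρ) (liftSubst s ρ τ x))
        = liftSubst (fun τ x => ren r (s τ x)) ρ := by
    intros
    funext τ x
    cases x with
    | zero => rfl
    | succ x => simp only [liftSubst, ren_ren]; rfl
  induction M generalizing Δ Ω with
  | prim f M ih => simp only [ren, subst]; congr 1; funext i; exact ih i _ _
  | lam M ih => simp only [ren, subst]; rw [ih, hl]
  | fix M ih => simp only [ren, subst]; rw [ih, hl, hl]
  | app M N ihM ihN => simp only [ren, subst]; rw [ihM, ihN]
  | ite M N P ihM ihN ihP => simp only [ren, subst]; rw [ihM, ihN, ihP]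
  | score M ih => simp only [ren, subst]; rw [ih]
  | _ => rfl

theorem subst_subst {Γ Δ Ω : List Ty} {τ : Ty} (M : Tm S L Γ τ) (s : ∀ τ, Var Γ τ → Tm S L Δ τ)
    (s' : ∀ τ, Var Δ τ → Tm S L Ω τ) :
    subst s' (subst s M) = subst (fun τ x => subst s' (s τ x)) M := by
  have hl : ∀ {Γ Δ Ω : List Ty} (s : ∀ τ, Var Γ τ → Tm S L Δ τ) (s' : ∀ τ, Var Δ τ → Tm S L Ω τ)
      (ρ : Ty), (fun τ x => subst (liftSubst s' ρ) (liftSubst s ρ τ x))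
        = liftSubst (fun τ x => subst s' (s τ x)) ρ := by
    intros
    funext τ x
    cases x with
    | zero => rfl
    | succ x => simp only [liftSubst, subst_ren, ren_subst]
  induction M generalizing Δ Ω with
  | prim f M ih => simp only [subst]; congr 1; funext i; exact ih i _ _
  | lam M ih => simp only [subst]; rw [ih, hl]
  | fix M ih => simp only [subst]; rw [ih, hl, hl]
  | app M N ihM ihN => simp only [subst]; rw [ihM, ihN]
  | ite M N P ihM ihN ihP => simp only [subst]; rw [ihM, ihN, ihP]
  | score M ih => simp only [subst]; rw [ih]
  | _ => rfl

theorem subst_var {Γ : List Ty} {τ : Ty} (M : Tm S L Γ τ) : subst (fun _ => var) M = M := by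
  have hl : ∀ {Γ : List Ty} (ρ : Ty),
      liftSubst (fun _ => (var : Var Γ _ → Tm S L Γ _)) ρ = fun _ => var := by
    intros
    funext τ x
    cases x <;> rfl
  induction M with
  | prim f M ih => simp only [subst]; congr 1; funext i; exact ih i
  | lam M ih => simp only [subst]; rw [hl, ih]
  | fix M ih => simp only [subst]; rw [hl, hl, ih]
  | app M N ihM ihN => simp only [subst]; rw [ihM, ihN]
  | ite M N P ihM ihN ihP => simp only [subst]; rw [ihM, ihN, ihP]
  | score M ih => simp only [subst]; rw [ih]
  | _ => rfl

theorem inst_subst_liftSubst {Γ : List Ty} {τ ρ : Ty} (M : Tm S L (τ :: Γ) ρ)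
    (s : ∀ τ, Var Γ τ → Tm S L [] τ) (V : Tm S L [] τ) :
    (subst (liftSubst s τ) M).inst V = subst (extend s V) M := by
  rw [inst, subst_subst]
  congr 1
  funext τ x
  cases x with
  | zero => rfl
  | succ x => simp only [liftSubst, subst_ren, extend, subst_var]

theorem inst₂_subst_liftSubst {Γ : List Ty} {τ τ' ρ : Ty} (M : Tm S L (τ :: τ' :: Γ) ρ)
    (s : ∀ τ, Var Γ τ → Tm S L [] τ) (V : Tm S L [] τ) (W : Tm S L [] τ') :
    (subst (liftSubst (liftSubst s τ') τ) M).inst₂ V W = subst (extend (extend s W) V) M := by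
  rw [inst₂, subst_subst]
  congr 1
  funext τ x
  cases x with
  | zero => rfl
  | succ x =>
    cases x with
    | zero => rfl
    | succ x => simp only [liftSubst, subst_ren, extend, subst_var]

theorem subst_summary {α : Ty} (σ : IType α) {Γ Δ : List Ty}
    (s : ∀ τ, Var Γ τ → Tm S Interval Δ τ) :
    subst s (σ.summary : Tm S Interval Γ α) = σ.summary := by
  induction σ generalizing Γ Δ with
  | base I => rfl
  | arr σ τ w _ ih => simp only [IType.summary, subst, ih]

/-! ### Translation of sample variables and literals -/

/-- The literal or the sample variable given by an element of `L ⊕ ℕ`. -/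
def atom {Γ : List Ty} : L ⊕ ℕ → Tm S L Γ Ty.real
  | .inl l => lit l
  | .inr i => svar i

/-- Simultaneous translation of the sample variables and the literals of a term. -/
def tr (g : ℕ → L' ⊕ ℕ) (h : L → L') : {Γ : List Ty} → {τ : Ty} → Tm S L Γ τ → Tm S L' Γ τ
  | _, _, var x => var x
  | _, _, lit l => lit (h l)
  | _, _, svar i => atom (g i)
  | _, _, lam M => lam (tr g h M)
  | _, _, fix M => fix (tr g h M)
  | _, _, app M N => app (tr g h M) (tr g h N)
  | _, _, ite M N P => ite (tr g h M) (tr g h N) (tr g h P)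
  | _, _, prim f M => prim f (fun i => tr g h (M i))
  | _, _, sample => sample
  | _, _, score M => score (tr g h M)

theorem ren_atom {Γ Δ : List Ty} (r : ∀ τ, Var Γ τ → Var Δ τ) (a : L ⊕ ℕ) :
    ren r (atom a : Tm S L Γ Ty.real) = atom a := by
  cases a <;> rfl

theorem subst_atom {Γ Δ : List Ty} (s : ∀ τ, Var Γ τ → Tm S L Δ τ) (a : L ⊕ ℕ) :
    subst s (atom a : Tm S L Γ Ty.real) = atom a := by
  cases a <;> rfl

theorem isRet_atom {Γ : List Ty} (a : L ⊕ ℕ) : (atom a : Tm S L Γ Ty.real).IsRet := by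
  cases a <;> rfl

theorem tr_ren (g : ℕ → L' ⊕ ℕ) (h : L → L') {Γ Δ : List Ty} {τ : Ty} (M : Tm S L Γ τ)
    (r : ∀ τ, Var Γ τ → Var Δ τ) : tr g h (ren r M) = ren r (tr g h M) := by
  induction M generalizing Δ with
  | svar i => simp only [ren, tr, ren_atom]
  | prim f M ih => simp only [ren, tr]; congr 1; funext i; exact ih i _
  | lam M ih => simp only [ren, tr]; rw [ih]
  | fix M ih => simp only [ren, tr]; rw [ih]
  | app M N ihM ihN => simp only [ren, tr]; rw [ihM, ihN]
  | ite M N P ihM ihN ihP => simp only [ren, tr]; rw [ihM, ihN, ihP]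
  | score M ih => simp only [ren, tr]; rw [ih]
  | _ => rfl

theorem tr_subst (g : ℕ → L' ⊕ ℕ) (h : L → L') {Γ Δ : List Ty} {τ : Ty} (M : Tm S L Γ τ)
    (s : ∀ τ, Var Γ τ → Tm S L Δ τ) :
    tr g h (subst s M) = subst (fun τ x => tr g h (s τ x)) (tr g h M) := by
  have hl : ∀ {Γ Δ : List Ty} (s : ∀ τ, Var Γ τ → Tm S L Δ τ) (ρ : Ty),
      (fun τ x => tr g h (liftSubst s ρ τ x)) = liftSubst (fun τ x => tr g h (s τ x)) ρ := by
    intros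
    funext τ x
    cases x with
    | zero => rfl
    | succ x => simp only [liftSubst, tr_ren]
  induction M generalizing Δ with
  | svar i => simp only [subst, tr, subst_atom]
  | prim f M ih => simp only [subst, tr]; congr 1; funext i; exact ih i _
  | lam M ih => simp only [subst, tr]; rw [ih, hl]
  | fix M ih => simp only [subst, tr]; rw [ih, hl, hl]
  | app M N ihM ihN => simp only [subst, tr]; rw [ihM, ihN]
  | ite M N P ihM ihN ihP => simp only [subst, tr]; rw [ihM, ihN, ihP]
  | score M ih => simp only [subst, tr]; rw [ih]
  | _ => rfl

theorem tr_inst (g : ℕ → L' ⊕ ℕ) (h : L → L') {Γ : List Ty} {τ ρ : Ty} (M : Tm S L (τ :: Γ) ρ)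
    (V : Tm S L Γ τ) : tr g h (M.inst V) = (tr g h M).inst (tr g h V) := by
  rw [inst, inst, tr_subst]
  congr 1
  funext τ x
  cases x <;> rfl

theorem tr_inst₂ (g : ℕ → L' ⊕ ℕ) (h : L → L') {Γ : List Ty} {τ τ' ρ : Ty}
    (M : Tm S L (τ :: τ' :: Γ) ρ) (V : Tm S L Γ τ) (W : Tm S L Γ τ') :
    tr g h (M.inst₂ V W) = (tr g h M).inst₂ (tr g h V) (tr g h W) := by
  rw [inst₂, inst₂, tr_subst]
  congr 1
  funext τ x
  cases x with
  | zero => rfl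
  | succ x => cases x <;> rfl

theorem tr_tr (g : ℕ → L' ⊕ ℕ) (h : L → L') (g' : ℕ → L'' ⊕ ℕ) (h' : L' → L'') {Γ : List Ty}
    {τ : Ty} (M : Tm S L Γ τ) :
    tr g' h' (tr g h M) = tr (fun i => Sum.elim (fun l => .inl (h' l)) g' (g i)) (h' ∘ h) M := by
  induction M with
  | svar i =>
    simp only [tr]
    cases g i <;> rfl
  | prim f M ih => simp only [tr]; congr 1; funext i; exact ih i
  | _ => simp_all [tr]

theorem tr_inr_id {Γ : List Ty} {τ : Ty} (M : Tm S L Γ τ) : tr .inr id M = M := by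
  induction M with
  | prim f M ih => simp only [tr]; congr 1; funext i; exact ih i
  | _ => simp_all [tr, atom]

theorem tr_congr (h : L → L') {n : ℕ} {g g' : ℕ → L' ⊕ ℕ} (hg : ∀ i < n, g i = g' i)
    {Γ : List Ty} {τ : Ty} (M : Tm S L Γ τ) (hM : M.SvarsBelow n) : tr g h M = tr g' h M := by
  induction M with
  | svar i => simp only [tr, hg i hM]
  | prim f M ih => simp only [tr]; congr 1; funext i; exact ih i (hM i)
  | _ => simp_all [tr, SvarsBelow]

theorem tr_betaAct (g : ℕ → L' ⊕ ℕ) (h : L → L') {Γ : List Ty} {α τ : Ty}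
    (M : Tm S L Γ (Ty.arr α τ)) (V : Tm S L Γ α) :
    Act.Rel (tr g h) (tr g h) (betaAct M V) (betaAct (tr g h M) (tr g h V)) := by
  cases M with
  | lam M => simp only [betaAct, tr]; rw [← tr_inst]; exact .tau _
  | fix M =>
    simp only [betaAct, tr]
    rw [show fix (tr g h M) = tr g h (fix M) from rfl, ← tr_inst₂]
    exact .tau _
  | _ => exact .ret

theorem tr_update (g : ℕ → L' ⊕ ℕ) (h : L → L') {Γ : List Ty} {k : ℕ}
    (M : Fin k → Tm S L Γ Ty.real) (i : Fin k) (N : Tm S L Γ Ty.real) :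
    (fun j => tr g h (Function.update M i N j))
      = Function.update (fun j => tr g h (M j)) i (tr g h N) := by
  funext j
  rcases eq_or_ne j i with rfl | hj
  · simp
  · simp [Function.update_of_ne hj]

theorem next_tr (g : ℕ → L' ⊕ ℕ) (h : L → L') {Γ : List Ty} {τ : Ty} (M : Tm S L Γ τ) :
    Act.Rel (tr g h) (tr g h) (next M) (next (tr g h M)) := by
  induction M with
  | svar i =>
    rw [tr, show next (atom (g i)) = .ret from isRet_atom (g i)]
    exact .ret
  | app M N ihM ihN =>
    rw [tr, next, next]
    exact Act.Rel.orElse (Act.Rel.map (fun _ => by rw [tr]) ihM)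
      (Act.Rel.orElse (Act.Rel.map (fun _ => by rw [tr]) ihN) (tr_betaAct g h M N))
  | ite M N P ih _ _ =>
    rw [tr, next, next]
    exact Act.Rel.orElse (Act.Rel.map (fun _ => by rw [tr]) ih) (.br _ _ _)
  | prim f M ih =>
    rcases exists_first M with hM | ⟨i, hi, hj⟩
    · have h1 : next (prim f M) = .ret := next_prim_ret f M hM
      have h2 : next (tr g h (prim f M)) = .ret := by
        rw [tr]
        exact next_prim_ret f _ fun j => (ih j).ret_iff.1 (hM j)
      rw [h1, h2]
      exact .ret
    · rw [next_prim f M i hj hi, tr, next_prim f _ i (fun j hj' => (ih j).ret_iff.1 (hj j hj'))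
        (fun hn => hi ((ih i).ret_iff.2 hn))]
      exact (ih i).map fun N => by rw [tr, tr_update]
  | sample => exact .smp _ _ fun t => rfl
  | score M ih =>
    rw [tr, next, next]
    exact Act.Rel.orElse (Act.Rel.map (fun _ => by rw [tr]) ih) (.sc _ _)
  | _ => exact .ret

/-- Replacement of all sample variables by literals. -/
def close (g : ℕ → L) {Γ : List Ty} {τ : Ty} (M : Tm S L Γ τ) : Tm S L Γ τ :=
  tr (fun i => .inl (g i)) id M

/-- Replacement of the literals `inl i` by the terms of a sequence. -/
def fill (g : ℕ → L) {Γ : List Ty} {τ : Ty} (M : Tm S (ℕ ⊕ L) Γ τ) : Tm S L Γ τ :=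
  tr .inr (Sum.elim g id) M

/-- The term whose instances are those obtained by replacing sample variables by literals. -/
def tag {Γ : List Ty} {τ : Ty} (M : Tm S L Γ τ) : Tm S (ℕ ⊕ L) Γ τ :=
  tr (fun i => .inl (.inl i)) .inr M

theorem fill_tag (g : ℕ → L) {Γ : List Ty} {τ : Ty} (M : Tm S L Γ τ) :
    fill g (tag M) = close g M := tr_tr _ _ _ _ M

/-- A term as a constant family of terms. -/
def constFam {Γ : List Ty} {τ : Ty} (M : Tm S L Γ τ) : Tm S (ℕ ⊕ L) Γ τ := tr .inr .inr M

theorem fill_constFam (g : ℕ → L) {Γ : List Ty} {τ : Ty} (M : Tm S L Γ τ) :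
    fill g (constFam M) = M := (tr_tr _ _ _ _ M).trans (tr_inr_id M)

/-- Shift of the parameters of a family of terms. -/
def shiftFam {Γ : List Ty} {τ : Ty} (M : Tm S (ℕ ⊕ L) Γ τ) : Tm S (ℕ ⊕ L) Γ τ :=
  tr .inr (Sum.map Nat.succ id) M

theorem fill_shiftFam (g : ℕ → L) {Γ : List Ty} {τ : Ty} (M : Tm S (ℕ ⊕ L) Γ τ) :
    fill g (shiftFam M) = fill (fun i => g (i + 1)) M := by
  refine (tr_tr _ _ _ _ M).trans ?_
  rw [fill]
  congr 1
  funext l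
  cases l <;> rfl

/-! ### Sample variables of reducts -/

theorem SvarsBelow.mono {m n : ℕ} (hmn : m ≤ n) {Γ : List Ty} {τ : Ty} {M : Tm S L Γ τ}
    (hM : M.SvarsBelow m) : M.SvarsBelow n := by
  induction M with
  | svar i => exact lt_of_lt_of_le hM hmn
  | prim f M ih => exact fun i => ih i (hM i)
  | _ => simp_all [SvarsBelow]

theorem svarsBelow_ren {n : ℕ} {Γ Δ : List Ty} {τ : Ty} {M : Tm S L Γ τ}
    (r : ∀ τ, Var Γ τ → Var Δ τ) (hM : M.SvarsBelow n) : (ren r M).SvarsBelow n := by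
  induction M generalizing Δ with
  | prim f M ih => exact fun i => ih i _ (hM i)
  | _ => simp_all [SvarsBelow, ren]

theorem svarsBelow_subst {n : ℕ} {Γ Δ : List Ty} {τ : Ty} {M : Tm S L Γ τ}
    {s : ∀ τ, Var Γ τ → Tm S L Δ τ} (hs : ∀ τ x, (s τ x).SvarsBelow n) (hM : M.SvarsBelow n) :
    (subst s M).SvarsBelow n := by
  have hl : ∀ {Γ Δ : List Ty} {s : ∀ τ, Var Γ τ → Tm S L Δ τ} (ρ : Ty),
      (∀ τ x, (s τ x).SvarsBelow n) → ∀ τ x, (liftSubst s ρ τ x).SvarsBelow n := by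
    intro Γ Δ s ρ hs τ x
    cases x with
    | zero => trivial
    | succ x => exact svarsBelow_ren _ (hs _ x)
  induction M generalizing Δ with
  | var x => exact hs _ x
  | prim f M ih => exact fun i => ih i hs (hM i)
  | lam M ih => exact ih (hl _ hs) hM
  | fix M ih => exact ih (hl _ (hl _ hs)) hM
  | app M N ihM ihN => exact ⟨ihM hs hM.1, ihN hs hM.2⟩
  | ite M N P ihM ihN ihP => exact ⟨ihM hs hM.1, ihN hs hM.2.1, ihP hs hM.2.2⟩
  | score M ih => exact ih hs hM
  | svar i => exact hM
  | lit l => trivial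
  | sample => trivial

theorem svarsBelow_extend {n : ℕ} {Γ Δ : List Ty} {ρ : Ty} {s : ∀ τ, Var Γ τ → Tm S L Δ τ}
    {V : Tm S L Δ ρ} (hs : ∀ τ x, (s τ x).SvarsBelow n) (hV : V.SvarsBelow n) :
    ∀ τ x, (extend s V τ x).SvarsBelow n := by
  intro τ x
  cases x with
  | zero => exact hV
  | succ x => exact hs _ x

/-- All sample variables that occur in the results of an action are among the first `n` ones, or
the first `m ≥ n` ones if those of the sampled term are. -/
def _root_.SPCF.Act.Below (n : ℕ) {Γ : List Ty} {τ : Ty} : Act S L Γ τ → Prop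
  | .ret => True
  | .tau M => M.SvarsBelow n
  | .smp K => ∀ m ≥ n, ∀ t : Tm S L Γ Ty.real, t.SvarsBelow m → (K t).SvarsBelow m
  | .br V M N => V.SvarsBelow n ∧ M.SvarsBelow n ∧ N.SvarsBelow n
  | .sc V M => V.SvarsBelow n ∧ M.SvarsBelow n

theorem _root_.SPCF.Act.Below.map {n : ℕ} {Γ : List Ty} {τ ρ : Ty} {a : Act S L Γ τ}
    {E : Tm S L Γ τ → Tm S L Γ ρ}
    (hE : ∀ m ≥ n, ∀ t : Tm S L Γ τ, t.SvarsBelow m → (E t).SvarsBelow m) (ha : a.Below n) :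
    (a.map E).Below n := by
  cases a with
  | ret => trivial
  | tau M => exact hE n le_rfl _ ha
  | smp K => exact fun m hm t ht => hE m hm _ (ha m hm t ht)
  | br V M N => exact ⟨ha.1, hE n le_rfl _ ha.2.1, hE n le_rfl _ ha.2.2⟩
  | sc V M => exact ⟨ha.1, hE n le_rfl _ ha.2⟩

theorem _root_.SPCF.Act.Below.orElse {n : ℕ} {Γ : List Ty} {τ : Ty} {a b : Act S L Γ τ}
    (ha : a.Below n) (hb : b.Below n) : (a.orElse b).Below n := by
  cases a with
  | ret => exact hb
  | _ => exact ha

theorem SvarsBelow.next {n : ℕ} {Γ : List Ty} {τ : Ty} {M : Tm S L Γ τ} (hM : M.SvarsBelow n) :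
    M.next.Below n := by
  induction M with
  | app M N ihM ihN =>
    refine Act.Below.orElse ((ihM hM.1).map fun m hm t ht => ⟨ht, hM.2.mono hm⟩)
      (Act.Below.orElse ((ihN hM.2).map fun m hm t ht => ⟨hM.1.mono hm, ht⟩) ?_)
    have hv : ∀ {Γ : List Ty} (τ : Ty) (x : Var Γ τ), (var x : Tm S L Γ τ).SvarsBelow n :=
      fun _ _ => trivial
    cases M with
    | lam M => exact svarsBelow_subst (svarsBelow_extend hv hM.2) hM.1
    | fix M => exact svarsBelow_subst (svarsBelow_extend (svarsBelow_extend hv hM.1) hM.2) hM.1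
    | _ => trivial
  | ite M N P ih _ _ =>
    exact Act.Below.orElse
      ((ih hM.1).map fun m hm t ht => ⟨ht, hM.2.1.mono hm, hM.2.2.mono hm⟩) hM
  | prim f M ih =>
    rcases exists_first M with h | ⟨i, hi, hj⟩
    · have h1 : Tm.next (prim f M) = .ret := next_prim_ret f M h
      rw [h1]
      trivial
    · rw [next_prim f M i hj hi]
      refine (ih i (hM i)).map fun m hm t ht j => ?_
      rcases eq_or_ne j i with rfl | hj
      · simpa using ht
      · simpa [Function.update_of_ne hj] using (hM j).mono hm
  | sample => exact fun m hm t ht => ht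
  | score M ih => exact Act.Below.orElse ((ih hM).map fun m hm t ht => ht) ⟨hM, hM⟩
  | _ => trivial

end Tm

end SPCF

namespace SPCF

/-! ### Interpretations of symbolic execution -/

/-- An interpretation of constraints and scores of closed terms by weights, depending measurably
on the literals that replace samples. -/
structure Interp (S : Signature) (L : Type) where
  num : ℝ → L
  holds : Tm S L [] Ty.real → Cmp → ℝ → ℝ≥0∞
  sc : Tm S L [] Ty.real → ℝ≥0∞
  holds_meas : ∀ c r (M : Tm S (ℕ ⊕ L) [] Ty.real),
    UMeas fun s : ℕ → ℝ => holds (M.fill fun i => num (s i)) c r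
  sc_meas : ∀ M : Tm S (ℕ ⊕ L) [] Ty.real, UMeas fun s : ℕ → ℝ => sc (M.fill fun i => num (s i))

namespace Interp

variable {S : Signature} {L : Type} (I : Interp S L) {τ ρ : Ty}

/-- Functions of terms that are universally measurable in the literals. -/
def MeasFun (k : Tm S L [] τ → ℝ≥0∞) : Prop :=
  ∀ M : Tm S (ℕ ⊕ L) [] τ, UMeas fun s : ℕ → ℝ => k (M.fill fun i => I.num (s i))

/-- The expectation of `r` after an action, or `d` if there is none. -/
def exec (a : Act S L [] τ) (d : ℝ≥0∞) (r : Tm S L [] τ → ℝ≥0∞) : ℝ≥0∞ :=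
  match a with
  | .ret => d
  | .tau M => r M
  | .smp K => ∫⁻ x, r (K (Tm.lit (I.num x))) ∂unif
  | .br V M N => I.holds V Cmp.le 0 * r M + I.holds V Cmp.gt 0 * r N
  | .sc V M => I.holds V Cmp.ge 0 * I.sc V * r M

/-- The weighted expectation of `k` over the results of the executions of a closed term with fewer
than `N` steps. -/
def run : ℕ → Tm S L [] τ → (Tm S L [] τ → ℝ≥0∞) → ℝ≥0∞
  | 0, _, _ => 0
  | N + 1, M, k => I.exec M.next (k M) fun M' => run N M' k

/-- The weighted expectation of `k` over the results of a closed term. -/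
def wp (M : Tm S L [] τ) (k : Tm S L [] τ → ℝ≥0∞) : ℝ≥0∞ := ⨆ N, I.run N M k

theorem exec_mono (a : Act S L [] τ) {d d' : ℝ≥0∞} (hd : d ≤ d') {r r' : Tm S L [] τ → ℝ≥0∞}
    (hr : ∀ M, r M ≤ r' M) : I.exec a d r ≤ I.exec a d' r' := by
  cases a with
  | ret => exact hd
  | tau M => exact hr M
  | smp K => exact lintegral_mono fun x => hr _
  | br V M N => exact add_le_add (mul_le_mul_right (hr M) _) (mul_le_mul_right (hr N) _)
  | sc V M => exact mul_le_mul_right (hr M) _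

theorem exec_map (a : Act S L [] τ) (ha : a ≠ .ret) (E : Tm S L [] τ → Tm S L [] ρ)
    (d d' : ℝ≥0∞) (r : Tm S L [] ρ → ℝ≥0∞) :
    I.exec (a.map E) d r = I.exec a d' fun M => r (E M) := by
  cases a with
  | ret => exact absurd rfl ha
  | _ => rfl

theorem run_mono {N N' : ℕ} (hN : N ≤ N') (M : Tm S L [] τ) {k k' : Tm S L [] τ → ℝ≥0∞}
    (hk : ∀ M, k M ≤ k' M) : I.run N M k ≤ I.run N' M k' := by
  induction N generalizing N' M with
  | zero => exact zero_le
  | succ N ih =>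
    obtain ⟨N', rfl⟩ : ∃ n, N' = n + 1 := ⟨N' - 1, by omega⟩
    exact I.exec_mono _ (hk M) fun M' => ih (by omega) M'

theorem wp_mono (M : Tm S L [] τ) {k k' : Tm S L [] τ → ℝ≥0∞} (hk : ∀ M, k M ≤ k' M) :
    I.wp M k ≤ I.wp M k' := iSup_mono fun _ => I.run_mono le_rfl M hk

variable {I}

theorem exists_smp_family {M : Tm S (ℕ ⊕ L) [] τ}
    {K₀ : Tm S (ℕ ⊕ L) [] Ty.real → Tm S (ℕ ⊕ L) [] τ} (h : M.next = .smp K₀) :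
    ∃ N : Tm S (ℕ ⊕ L) [] τ, ∀ s : ℕ → ℝ, ∃ K, (M.fill fun i => I.num (s i)).next = .smp K ∧
      ∀ x, K (Tm.lit (I.num x)) = N.fill fun i => I.num (consSeq x s i) := by
  have h1 := Tm.next_tr .inr (Sum.map Nat.succ id) M
  rw [h] at h1
  generalize h2 : Tm.next (Tm.tr .inr (Sum.map Nat.succ id) M) = a at h1
  cases h1 with
  | smp _ K₁ _ =>
    refine ⟨K₁ (Tm.lit (.inl 0)), fun s => ?_⟩
    have h3 : ∀ g : ℕ → L, ∃ K, (M.fill fun i => g (i + 1)).next = .smp K ∧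
        K (Tm.lit (g 0)) = (K₁ (Tm.lit (.inl 0))).fill g := by
      intro g
      have h4 := Tm.next_tr .inr (Sum.elim g id) (Tm.shiftFam M)
      rw [Tm.shiftFam, h2] at h4
      have h5 := Tm.fill_shiftFam g M
      rw [Tm.fill, Tm.shiftFam] at h5
      rw [h5] at h4
      generalize h6 : Tm.next (M.fill fun i => g (i + 1)) = a at h4
      cases h4 with
      | smp _ K hK => exact ⟨K, rfl, hK (Tm.lit (.inl 0))⟩
    obtain ⟨K, hK, -⟩ := h3 fun i => I.num (consSeq 0 s i)
    refine ⟨K, hK, fun x => ?_⟩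
    obtain ⟨K', hK', hx⟩ := h3 fun i => I.num (consSeq x s i)
    have : K = K' := by
      have := hK.symm.trans hK'
      injection this
    rw [this]
    exact hx

theorem MeasFun.smp {k : Tm S L [] τ → ℝ≥0∞} (hk : I.MeasFun k) {M : Tm S L [] τ}
    {K : Tm S L [] Ty.real → Tm S L [] τ} (h : M.next = .smp K) :
    AEMeasurable (fun x => k (K (Tm.lit (I.num x)))) unif := by
  have h1 := Tm.next_tr (L' := ℕ ⊕ L) .inr .inr M
  rw [h] at h1
  generalize h2 : Tm.next (Tm.tr (L' := ℕ ⊕ L) .inr .inr M) = a at h1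
  cases h1 with
  | smp _ K₀ _ =>
    obtain ⟨N, hN⟩ := exists_smp_family (I := I) h2
    obtain ⟨K', hK', hx⟩ := hN 0
    rw [← Tm.constFam, Tm.fill_constFam, h] at hK'
    injection hK' with hK'
    subst hK'
    simp only [hx]
    exact ((hk N).comp_measurable (measurable_consSeq.comp measurable_prodMk_left)) unif inferInstance

theorem MeasFun.exec {d r : Tm S L [] τ → ℝ≥0∞} (hd : I.MeasFun d) (hr : I.MeasFun r) :
    I.MeasFun fun M => I.exec M.next (d M) r := by
  intro M
  have h1 := fun s : ℕ → ℝ => Tm.next_tr .inr (Sum.elim (fun i => I.num (s i)) id) M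
  generalize h2 : M.next = a at h1
  cases a with
  | ret =>
    have h3 : ∀ s : ℕ → ℝ, (M.fill fun i => I.num (s i)).next = .ret := by
      intro s
      exact (h1 s).ret_iff.1 rfl
    simp only [h3, Interp.exec]
    exact hd M
  | tau M' =>
    have h3 : ∀ s : ℕ → ℝ, (M.fill fun i => I.num (s i)).next
        = .tau (M'.fill fun i => I.num (s i)) := by
      intro s
      have := h1 s
      generalize h4 : Tm.next (Tm.tr .inr (Sum.elim (fun i => I.num (s i)) id) M) = a at this
      cases this
      exact h4
    simp only [h3, Interp.exec]
    exact hr M'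
  | smp K =>
    obtain ⟨N, hN⟩ := exists_smp_family (I := I) h2
    have h3 : ∀ s : ℕ → ℝ, I.exec (M.fill fun i => I.num (s i)).next
        (d (M.fill fun i => I.num (s i))) r
        = ∫⁻ x, r (N.fill fun i => I.num (consSeq x s i)) ∂unif := by
      intro s
      obtain ⟨K, hK, hx⟩ := hN s
      simp only [hK, Interp.exec, hx]
    simp only [h3]
    exact ((hr N).comp_measurable measurable_consSeq).lintegral_right unif
  | br V M' N' =>
    have h3 : ∀ s : ℕ → ℝ, (M.fill fun i => I.num (s i)).next
        = .br (V.fill fun i => I.num (s i)) (M'.fill fun i => I.num (s i))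
          (N'.fill fun i => I.num (s i)) := by
      intro s
      have := h1 s
      generalize h4 : Tm.next (Tm.tr .inr (Sum.elim (fun i => I.num (s i)) id) M) = a at this
      cases this
      exact h4
    simp only [h3, Interp.exec]
    exact ((I.holds_meas _ _ V).mul (hr M')).add ((I.holds_meas _ _ V).mul (hr N'))
  | sc V M' =>
    have h3 : ∀ s : ℕ → ℝ, (M.fill fun i => I.num (s i)).next
        = .sc (V.fill fun i => I.num (s i)) (M'.fill fun i => I.num (s i)) := by
      intro s
      have := h1 s
      generalize h4 : Tm.next (Tm.tr .inr (Sum.elim (fun i => I.num (s i)) id) M) = a at this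
      cases this
      exact h4
    simp only [h3, Interp.exec]
    exact ((I.holds_meas _ _ V).mul (I.sc_meas V)).mul (hr M')

theorem MeasFun.run {k : Tm S L [] τ → ℝ≥0∞} (hk : I.MeasFun k) (N : ℕ) :
    I.MeasFun fun M => I.run N M k := by
  induction N with
  | zero => exact fun M => UMeas.const 0
  | succ N ih => exact MeasFun.exec hk ih

theorem MeasFun.wp {k : Tm S L [] τ → ℝ≥0∞} (hk : I.MeasFun k) :
    I.MeasFun fun M => I.wp M k := fun M => UMeas.iSup fun N => hk.run N M

theorem MeasFun.const (c : ℝ≥0∞) : I.MeasFun fun _ : Tm S L [] τ => c := fun _ => UMeas.const c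

theorem MeasFun.mul {k k' : Tm S L [] τ → ℝ≥0∞} (hk : I.MeasFun k) (hk' : I.MeasFun k') :
    I.MeasFun fun M => k M * k' M := fun M => (hk M).mul (hk' M)

theorem exists_frame_family {E : Tm S L [] τ → Tm S L [] ρ} (hE : Frame E) :
    ∃ E' : Tm S (ℕ ⊕ L) [] τ → Tm S (ℕ ⊕ L) [] ρ, ∀ (g : ℕ → L) M,
      (E' M).fill g = E (M.fill g) := by
  have hc : ∀ (g : ℕ → L) {Γ : List Ty} {τ : Ty} (N : Tm S L Γ τ),
      Tm.tr .inr (Sum.elim g id) N.constFam = N := fun g _ _ N => Tm.fill_constFam g N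
  cases hE with
  | appLeft N => exact ⟨fun M => .app M N.constFam, fun g M => by simp only [Tm.fill, Tm.tr, hc]⟩
  | appRight V hV =>
    exact ⟨fun M => .app V.constFam M, fun g M => by simp only [Tm.fill, Tm.tr, hc]⟩
  | ite N P =>
    exact ⟨fun M => .ite M N.constFam P.constFam, fun g M => by simp only [Tm.fill, Tm.tr, hc]⟩
  | prim f M₀ i h =>
    refine ⟨fun M => .prim f (Function.update (fun j => (M₀ j).constFam) i M), fun g M => ?_⟩
    simp only [Tm.fill, Tm.tr, Tm.tr_update, hc]
  | score => exact ⟨fun M => .score M, fun g M => rfl⟩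

theorem MeasFun.frame {k : Tm S L [] ρ → ℝ≥0∞} (hk : I.MeasFun k) {E : Tm S L [] τ → Tm S L [] ρ}
    (hE : Frame E) : I.MeasFun fun M => k (E M) := by
  obtain ⟨E', hE'⟩ := exists_frame_family hE
  intro M
  simp only [← hE']
  exact hk (E' M)

theorem exec_iSup {M : Tm S L [] τ} {d : ℕ → ℝ≥0∞} {r : ℕ → Tm S L [] τ → ℝ≥0∞}
    (hr : ∀ n, I.MeasFun (r n)) (hm : Monotone r) :
    I.exec M.next (⨆ n, d n) (fun M' => ⨆ n, r n M') = ⨆ n, I.exec M.next (d n) (r n) := by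
  have hm' : ∀ M, Monotone fun n => r n M := fun M m n h => hm h M
  generalize h : M.next = a
  cases a with
  | ret => rfl
  | tau M' => rfl
  | smp K =>
    exact lintegral_iSup' (fun n => (hr n).smp h) (.of_forall fun x => hm' _)
  | br V M' N' =>
    simp only [exec, ENNReal.mul_iSup]
    rw [ENNReal.iSup_add_iSup_of_monotone]
    · exact fun m n hmn => mul_le_mul_right (hm' _ hmn) _
    · exact fun m n hmn => mul_le_mul_right (hm' _ hmn) _
  | sc V M' => simp only [exec, ENNReal.mul_iSup]

theorem wp_eq {k : Tm S L [] τ → ℝ≥0∞} (hk : I.MeasFun k) (M : Tm S L [] τ) :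
    I.wp M k = I.exec M.next (k M) fun M' => I.wp M' k := by
  have h1 : Monotone fun N M => I.run N M k := fun m n h M => I.run_mono h M fun _ => le_rfl
  have h2 := exec_iSup (M := M) (d := fun _ => k M) (fun N => hk.run N) h1
  rw [iSup_const] at h2
  refine Eq.trans ?_ h2.symm
  exact ((Monotone.iSup_nat_add (f := fun N => I.run N M k) (fun m n h => h1 h M) 1)).symm

theorem wp_of_isRet {k : Tm S L [] τ → ℝ≥0∞} {M : Tm S L [] τ} (hM : M.IsRet) :
    I.wp M k = k M := by
  have h : ∀ N, I.run (N + 1) M k = k M := by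
    intro N
    rw [Tm.IsRet] at hM
    simp only [run, exec, hM]
  refine le_antisymm (iSup_le fun N => ?_) ((h 0).symm.le.trans (le_iSup (fun N => I.run N M k) 1))
  cases N with
  | zero => exact zero_le
  | succ N => exact (h N).le

theorem run_iSup {k : ℕ → Tm S L [] τ → ℝ≥0∞} (hk : ∀ n, I.MeasFun (k n)) (hm : Monotone k)
    (N : ℕ) (M : Tm S L [] τ) : I.run N M (fun M => ⨆ n, k n M) = ⨆ n, I.run N M (k n) := by
  induction N generalizing M with
  | zero => simp [run]
  | succ N ih =>
    simp only [run, ih]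
    exact exec_iSup (fun n => (hk n).run N) fun m n h M => I.run_mono le_rfl M (hm h)

theorem wp_bind {k : Tm S L [] ρ → ℝ≥0∞} (hk : I.MeasFun k) {E : Tm S L [] τ → Tm S L [] ρ}
    (hE : Frame E) (M : Tm S L [] τ) : I.wp (E M) k = I.wp M fun V => I.wp (E V) k := by
  apply le_antisymm
  · refine iSup_le fun N => ?_
    suffices h : I.run N (E M) k ≤ I.run N M fun V => I.wp (E V) k from
      h.trans (le_iSup (fun N => I.run N M fun V => I.wp (E V) k) N)
    induction N generalizing M with
    | zero => exact zero_le
    | succ N ih =>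
      by_cases hM : M.IsRet
      · have : I.run (N + 1) M (fun V => I.wp (E V) k) = I.wp (E M) k := by
          rw [Tm.IsRet] at hM
          simp only [run, exec, hM]
        rw [this]
        exact le_iSup (fun N => I.run N (E M) k) (N + 1)
      · rw [run, hE.next_eq hM, I.exec_map _ hM _ _ (I.wp (E M) k), run]
        exact I.exec_mono _ le_rfl ih
  · have h1 : ∀ N K M, I.run N M (fun V => I.run K (E V) k) ≤ I.run (N + K) (E M) k := by
      intro N K
      induction N with
      | zero => exact fun M => zero_le
      | succ N ih =>
        intro M
        by_cases hM : M.IsRet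
        · have : I.run (N + 1) M (fun V => I.run K (E V) k) = I.run K (E M) k := by
            rw [Tm.IsRet] at hM
            simp only [run, exec, hM]
          rw [this]
          exact I.run_mono (by omega) _ fun _ => le_rfl
        · rw [show N + 1 + K = (N + K) + 1 by omega, run, run, hE.next_eq hM,
            I.exec_map _ hM _ _ (I.run K (E M) k)]
          exact I.exec_mono _ le_rfl ih
    refine iSup_le fun N => ?_
    have h2 := run_iSup (k := fun K V => I.run K (E V) k) (fun K => (hk.run K).frame hE)
      (fun m n h V => I.run_mono h _ fun _ => le_rfl) N M
    simp only [wp] at h2 ⊢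
    rw [h2]
    exact iSup_le fun K => (h1 N K M).trans (le_iSup (fun N => I.run N (E M) k) (N + K))

theorem run_add {k k' : Tm S L [] τ → ℝ≥0∞} (hk : I.MeasFun k) (N : ℕ) (M : Tm S L [] τ) :
    I.run N M (fun V => k V + k' V) = I.run N M k + I.run N M k' := by
  induction N generalizing M with
  | zero => simp [run]
  | succ N ih =>
    simp only [run, ih]
    generalize h : M.next = a
    cases a with
    | ret => rfl
    | tau M' => rfl
    | smp K => exact lintegral_add_left' ((hk.run N).smp h) _
    | br V M' N' => simp only [exec]; ring
    | sc V M' => simp only [exec]; ring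

theorem wp_add {k k' : Tm S L [] τ → ℝ≥0∞} (hk : I.MeasFun k) (M : Tm S L [] τ) :
    I.wp M (fun V => k V + k' V) = I.wp M k + I.wp M k' := by
  simp only [wp, run_add hk]
  rw [ENNReal.iSup_add_iSup_of_monotone]
  · exact fun m n h => I.run_mono h _ fun _ => le_rfl
  · exact fun m n h => I.run_mono h _ fun _ => le_rfl

theorem run_const_mul {k : Tm S L [] τ → ℝ≥0∞} (hk : I.MeasFun k) (c : ℝ≥0∞) (N : ℕ)
    (M : Tm S L [] τ) : I.run N M (fun V => c * k V) = c * I.run N M k := by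
  induction N generalizing M with
  | zero => simp [run]
  | succ N ih =>
    simp only [run, ih]
    generalize h : M.next = a
    cases a with
    | ret => rfl
    | tau M' => rfl
    | smp K => exact lintegral_const_mul'' _ ((hk.run N).smp h)
    | br V M' N' => simp only [exec]; ring
    | sc V M' => simp only [exec]; ring

theorem wp_const_mul {k : Tm S L [] τ → ℝ≥0∞} (hk : I.MeasFun k) (c : ℝ≥0∞) (M : Tm S L [] τ) :
    I.wp M (fun V => c * k V) = c * I.wp M k := by
  simp only [wp, run_const_mul hk, ENNReal.mul_iSup]

end Interp

end SPCF

namespace SPCF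

/-! ### Integration over cubes -/

theorem volume_restrict_cube (n : ℕ) :
    (volume : Measure (Fin n → ℝ)).restrict (cube n) = Measure.pi fun _ => unif := by
  have : cube n = Set.univ.pi fun _ : Fin n => Set.Icc (0 : ℝ) 1 := by
    ext s
    simp only [cube, Set.mem_ofPred_eq, Set.mem_univ_pi, Set.mem_Icc]
  rw [this, volume_pi, Measure.restrict_pi_pi]
  rfl

instance (n : ℕ) : IsProbabilityMeasure ((volume : Measure (Fin n → ℝ)).restrict (cube n)) := by
  rw [volume_restrict_cube]
  infer_instance

theorem measurableSet_cube (n : ℕ) : MeasurableSet (cube n) := by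
  have : cube n = Set.univ.pi fun _ : Fin n => Set.Icc (0 : ℝ) 1 := by
    ext s
    simp only [cube, Set.mem_ofPred_eq, Set.mem_univ_pi, Set.mem_Icc]
  rw [this]
  exact MeasurableSet.univ_pi fun _ => measurableSet_Icc

theorem measurable_assign {n : ℕ} : Measurable (assign : (Fin n → ℝ) → ℕ → ℝ) := by
  refine measurable_pi_iff.2 fun i => ?_
  by_cases h : i < n
  · simpa [assign, h] using measurable_pi_apply (⟨i, h⟩ : Fin n)
  · simp [assign, h]

theorem assign_mem {n : ℕ} {s : Fin n → ℝ} (hs : s ∈ cube n) (i : ℕ) :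
    0 ≤ assign s i ∧ assign s i ≤ 1 := by
  by_cases h : i < n
  · simpa [assign, h] using hs ⟨i, h⟩
  · simp [assign, h]

theorem assign_insertNth_last {n : ℕ} (x : ℝ) (s : Fin n → ℝ) :
    assign ((Fin.last n).insertNth (α := fun _ => ℝ) x s) = Function.update (assign s) n x := by
  funext i
  rcases lt_trichotomy i n with h | rfl | h
  · have h1 : (⟨i, h.trans (Nat.lt_succ_self n)⟩ : Fin (n + 1))
        = (Fin.last n).succAbove ⟨i, h⟩ := by
      simp
    rw [Function.update_of_ne h.ne, assign, dif_pos (h.trans (Nat.lt_succ_self n)), h1,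
      Fin.insertNth_apply_succAbove, assign, dif_pos h]
  · have h1 : (⟨i, Nat.lt_succ_self i⟩ : Fin (i + 1)) = Fin.last i := rfl
    rw [Function.update_self, assign, dif_pos (Nat.lt_succ_self i), h1, Fin.insertNth_apply_same]
  · rw [Function.update_of_ne h.ne', assign, dif_neg (by omega), assign, dif_neg (by omega)]

theorem measurable_update_pair (n : ℕ) :
    Measurable fun p : ℝ × (ℕ → ℝ) => Function.update p.2 n p.1 := by
  refine measurable_pi_iff.2 fun i => ?_
  rcases eq_or_ne i n with rfl | h
  · simpa using measurable_fst
  · simp only [Function.update_of_ne h]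
    exact (measurable_pi_apply i).comp measurable_snd

theorem lintegral_cube_succ (n : ℕ) {f : (ℕ → ℝ) → ℝ≥0∞} (hf : UMeas f) :
    ∫⁻ s in cube (n + 1), f (assign s)
      = ∫⁻ s in cube n, ∫⁻ x, f (Function.update (assign s) n x) ∂unif := by
  have h1 := (measurePreserving_piFinSuccAbove (fun _ : Fin (n + 1) => unif) (Fin.last n)).symm
  have h2 := h1.lintegral_comp_emb (MeasurableEquiv.measurableEmbedding _) fun s => f (assign s)
  rw [volume_restrict_cube, volume_restrict_cube, ← h2, lintegral_prod_symm]
  · refine lintegral_congr fun s => lintegral_congr fun x => ?_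
    rw [← assign_insertNth_last]
    rfl
  · have h3 : UMeas fun p : ℝ × (Fin n → ℝ) => f (Function.update (assign p.2) n p.1) :=
      hf.comp_measurable ((measurable_update_pair n).comp
        (measurable_fst.prodMk (measurable_assign.comp measurable_snd)))
    convert h3 _ inferInstance using 2 with p
    · rw [← assign_insertNth_last]
      rfl
    · infer_instance

/-! ### Symbolic paths and expectations -/

section Paths

variable {S : Signature} {L : Type}

theorem red_iff {c c' : Config S L} :
    c.Red c' ↔ c.term.next.Succ c.toState c'.term c'.toState := step_iff_succ

/-- Only the first `n` sample variables occur in a configuration. -/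
structure Config.Below (c : Config S L) : Prop where
  term_below : c.term.SvarsBelow c.n
  constraint_below : ∀ C ∈ c.constraints, C.val.SvarsBelow c.n
  score_below : ∀ W ∈ c.scores, W.SvarsBelow c.n

/-- The paths that are reached in fewer than `N` steps. -/
def pathsIn : ℕ → Config S L → Set (Config S L)
  | 0, _ => ∅
  | N + 1, c => {Ψ | (c.term.IsValue ∧ Ψ = c) ∨ ∃ c', c.Red c' ∧ Ψ ∈ pathsIn N c'}

theorem pathsIn_mono {M N : ℕ} (h : M ≤ N) (c : Config S L) : pathsIn M c ⊆ pathsIn N c := by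
  induction M generalizing N c with
  | zero => exact Set.empty_subset _
  | succ M ih =>
    obtain ⟨N, rfl⟩ : ∃ n, N = n + 1 := ⟨N - 1, by omega⟩
    rintro Ψ (h1 | ⟨c', h1, h2⟩)
    · exact .inl h1
    · exact .inr ⟨c', h1, ih (by omega) c' h2⟩

theorem symPaths_eq_iUnion (c : Config S L) : symPaths c = ⋃ N, pathsIn N c := by
  ext Ψ
  rw [Set.mem_iUnion]
  constructor
  · rintro ⟨h, hv⟩
    induction h using Relation.ReflTransGen.head_induction_on with
    | refl => exact ⟨1, .inl ⟨hv, rfl⟩⟩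
    | head h1 _ ih =>
      obtain ⟨N, hN⟩ := ih
      exact ⟨N + 1, .inr ⟨_, h1, hN⟩⟩
  · rintro ⟨N, hN⟩
    induction N generalizing c with
    | zero => exact hN.elim
    | succ N ih =>
      rcases hN with ⟨hv, rfl⟩ | ⟨c', h1, h2⟩
      · exact ⟨.refl, hv⟩
      · exact ⟨.head h1 (ih c' h2).1, (ih c' h2).2⟩

theorem suffix_of_red {c c' : Config S L} (h : c.Red c') : c.constraints <:+ c'.constraints := by
  rw [red_iff] at h
  generalize c.term.next = a at h
  cases a with
  | ret => exact h.elim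
  | tau M => rw [h.2]
  | smp K => rw [h.2]
  | br V M N =>
    rcases h with h | h
    · rw [h.2]; exact List.suffix_cons _ _
    · rw [h.2]; exact List.suffix_cons _ _
  | sc V M => rw [h.2]; exact List.suffix_cons _ _

theorem suffix_of_mem_pathsIn {N : ℕ} {c Ψ : Config S L} (h : Ψ ∈ pathsIn N c) :
    c.constraints <:+ Ψ.constraints := by
  induction N generalizing c with
  | zero => exact h.elim
  | succ N ih =>
    rcases h with ⟨_, rfl⟩ | ⟨c', h1, h2⟩
    · exact List.suffix_rfl
    · exact (suffix_of_red h1).trans (ih h2)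

theorem Config.Below.red {c c' : Config S L} (hc : c.Below) (h : c.Red c') : c'.Below := by
  rw [red_iff] at h
  have h1 := hc.term_below.next
  generalize c.term.next = a at h h1
  obtain ⟨⟨n, Δ, Ξ⟩, M'⟩ := c'
  obtain ⟨⟨n₀, Δ₀, Ξ₀⟩, M₀⟩ := c
  obtain ⟨hM, hΔ, hΞ⟩ := hc
  simp only [Act.Succ] at h h1 hM hΔ hΞ
  cases a with
  | ret => exact h.elim
  | tau M =>
    obtain ⟨rfl, h⟩ := h
    obtain ⟨rfl, rfl, rfl⟩ := State.mk.inj h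
    exact ⟨h1, hΔ, hΞ⟩
  | smp K =>
    obtain ⟨rfl, h⟩ := h
    obtain ⟨rfl, rfl, rfl⟩ := State.mk.inj h
    exact ⟨h1 _ (Nat.le_succ _) _ (Nat.lt_succ_self _), fun C hC => (hΔ C hC).mono (Nat.le_succ _),
      fun W hW => (hΞ W hW).mono (Nat.le_succ _)⟩
  | br V M N =>
    rcases h with ⟨rfl, h⟩ | ⟨rfl, h⟩
    · obtain ⟨rfl, rfl, rfl⟩ := State.mk.inj h
      exact ⟨h1.2.1, List.forall_mem_cons.2 ⟨h1.1, hΔ⟩, hΞ⟩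
    · obtain ⟨rfl, rfl, rfl⟩ := State.mk.inj h
      exact ⟨h1.2.2, List.forall_mem_cons.2 ⟨h1.1, hΔ⟩, hΞ⟩
  | sc V M =>
    obtain ⟨rfl, h⟩ := h
    obtain ⟨rfl, rfl, rfl⟩ := State.mk.inj h
    exact ⟨h1.2, List.forall_mem_cons.2 ⟨h1.1, hΔ⟩, List.forall_mem_cons.2 ⟨h1.1, hΞ⟩⟩

namespace Interp

variable (I : Interp S L)

/-- Replacement of the sample variables by a sequence of reals. -/
def inject {τ : Ty} (M : Tm S L [] τ) (s : ℕ → ℝ) : Tm S L [] τ := M.close fun i => I.num (s i)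

/-- The product of the weights of the constraints and of the scores of a state. -/
def weight (st : State S L) (s : ℕ → ℝ) : ℝ≥0∞ :=
  (st.constraints.map fun C => I.holds (I.inject C.val s) C.cmp C.bound).prod
    * (st.scores.map fun W => I.sc (I.inject W s)).prod

/-- The integral of `F`, weighted by the constraints and scores, over the traces of a path. -/
def pathMass (F : Tm S L [] Ty.real → ℝ≥0∞) (Ψ : Config S L) : ℝ≥0∞ :=
  ∫⁻ s in cube Ψ.n, I.weight Ψ.toState (assign s) * F (I.inject Ψ.term (assign s))

variable {I}

theorem MeasFun.inject {τ : Ty} {k : Tm S L [] τ → ℝ≥0∞} (hk : I.MeasFun k) (M : Tm S L [] τ) :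
    UMeas fun s : ℕ → ℝ => k (I.inject M s) := by
  simpa only [Interp.inject, Tm.fill_tag] using hk M.tag

theorem inject_congr {τ : Ty} {M : Tm S L [] τ} {n : ℕ} (hM : M.SvarsBelow n) {s s' : ℕ → ℝ}
    (h : ∀ i < n, s i = s' i) : I.inject M s = I.inject M s' :=
  Tm.tr_congr _ (fun i hi => congrArg (fun x => Sum.inl (I.num x)) (h i hi)) M hM

theorem inject_update {τ : Ty} {M : Tm S L [] τ} {n : ℕ} (hM : M.SvarsBelow n) (s : ℕ → ℝ)
    (x : ℝ) : I.inject M (Function.update s n x) = I.inject M s :=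
  inject_congr hM fun _ hi => Function.update_of_ne hi.ne _ _

theorem measFun_holds (c : Cmp) (r : ℝ) : I.MeasFun fun V => I.holds V c r := I.holds_meas c r

theorem measFun_sc : I.MeasFun I.sc := I.sc_meas

theorem weight_meas (st : State S L) : UMeas (I.weight st) :=
  (UMeas.list_prod _ fun C _ =>
    (measFun_holds C.cmp C.bound).inject C.val).mul
    (UMeas.list_prod _ fun W _ => measFun_sc.inject W)

theorem weight_update {c : Config S L} (hc : c.Below) (s : ℕ → ℝ) (x : ℝ) :
    I.weight c.toState (Function.update s c.n x) = I.weight c.toState s := by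
  unfold weight
  congr 2
  · refine List.map_congr_left fun C hC => ?_
    rw [inject_update (hc.constraint_below C hC)]
  · refine List.map_congr_left fun W hW => ?_
    rw [inject_update (hc.score_below W hW)]

theorem tsum_pathsIn {F : Tm S L [] Ty.real → ℝ≥0∞} (hF : I.MeasFun F) (N : ℕ) {c : Config S L}
    (hc : c.Below) : ∑' Ψ : pathsIn N c, I.pathMass F Ψ.1
      = ∫⁻ s in cube c.n, I.weight c.toState (assign s)
          * I.run N (I.inject c.term (assign s)) F := by
  induction N generalizing c with
  | zero => simp [pathsIn, run]
  | succ N ih =>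
    have hrun := fun (c : Config S L) (s : Fin c.n → ℝ) =>
      Tm.next_tr (fun i => .inl (I.num (assign s i))) id c.term
    have hmeas : ∀ (c : Config S L), AEMeasurable (fun s : Fin c.n → ℝ =>
        I.weight c.toState (assign s) * I.run N (I.inject c.term (assign s)) F)
        (volume.restrict (cube c.n)) := fun c =>
      ((weight_meas c.toState).mul ((hF.run N).inject c.term)).comp_measurable measurable_assign _
        inferInstance
    obtain ⟨⟨n, Δ, Ξ⟩, M⟩ := c
    generalize h : M.next = a
    cases a with
    | ret =>
      have hv : M.IsValue := Tm.isRet_iff_isValue.1 h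
      have h1 : pathsIn (N + 1) ⟨⟨n, Δ, Ξ⟩, M⟩ = {⟨⟨n, Δ, Ξ⟩, M⟩} := by
        ext Ψ
        constructor
        · rintro (⟨-, rfl⟩ | ⟨c', h1, -⟩)
          · rfl
          · rw [red_iff, h] at h1
            exact h1.elim
        · rintro rfl
          exact .inl ⟨hv, rfl⟩
      rw [tsum_congr_set_coe _ h1, tsum_singleton, pathMass]
      refine lintegral_congr fun s => ?_
      have h2 := hrun ⟨⟨n, Δ, Ξ⟩, M⟩ s
      rw [h] at h2
      rw [run, inject, Tm.close, h2.ret_iff.1 rfl, exec]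
    | tau M' =>
      have hr : Config.Red ⟨⟨n, Δ, Ξ⟩, M⟩ ⟨⟨n, Δ, Ξ⟩, M'⟩ := by
        rw [red_iff, h]
        exact ⟨rfl, rfl⟩
      have h1 : pathsIn (N + 1) ⟨⟨n, Δ, Ξ⟩, M⟩ = pathsIn N ⟨⟨n, Δ, Ξ⟩, M'⟩ := by
        ext Ψ
        constructor
        · rintro (⟨hv, -⟩ | ⟨⟨_, _⟩, h1, h2⟩)
          · cases h.symm.trans hv.isRet
          · rw [red_iff, h] at h1
            obtain ⟨rfl, rfl⟩ := h1
            exact h2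
        · exact fun h1 => .inr ⟨_, hr, h1⟩
      rw [tsum_congr_set_coe _ h1, ih (hc.red hr)]
      refine lintegral_congr fun s => ?_
      have h2 := hrun ⟨⟨n, Δ, Ξ⟩, M⟩ s
      rw [h] at h2
      simp only [run, inject, Tm.close, weight] at h2 ⊢
      generalize Tm.next (Tm.tr _ _ M) = a at h2
      cases h2
      rfl
    | smp K =>
      have hr : Config.Red ⟨⟨n, Δ, Ξ⟩, M⟩ ⟨⟨n + 1, Δ, Ξ⟩, K (Tm.svar n)⟩ := by
        rw [red_iff, h]
        exact ⟨rfl, rfl⟩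
      have h1 : pathsIn (N + 1) ⟨⟨n, Δ, Ξ⟩, M⟩ = pathsIn N ⟨⟨n + 1, Δ, Ξ⟩, K (Tm.svar n)⟩ := by
        ext Ψ
        constructor
        · rintro (⟨hv, -⟩ | ⟨⟨_, _⟩, h1, h2⟩)
          · cases h.symm.trans hv.isRet
          · rw [red_iff, h] at h1
            obtain ⟨rfl, rfl⟩ := h1
            exact h2
        · exact fun h1 => .inr ⟨_, hr, h1⟩
      rw [tsum_congr_set_coe _ h1, ih (hc.red hr)]
      have h3 := lintegral_cube_succ n
        ((weight_meas (I := I) ⟨n + 1, Δ, Ξ⟩).mul ((hF.run N).inject (K (Tm.svar n))))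
      refine h3.trans ?_
      refine lintegral_congr fun s => ?_
      have h4 : ∀ x, I.weight ⟨n + 1, Δ, Ξ⟩ (Function.update (assign s) n x)
          = I.weight ⟨n, Δ, Ξ⟩ (assign s) := fun x => weight_update hc (assign s) x
      simp only [h4]
      obtain ⟨K', hK', hx⟩ : ∃ K', (I.inject M (assign s)).next = .smp K' ∧
          ∀ x, K' (Tm.lit (I.num x)) = I.inject (K (Tm.svar n)) (Function.update (assign s) n x) := by
        have h5 : ∀ x, ∃ K', (I.inject M (assign s)).next = .smp K' ∧
            K' (Tm.lit (I.num x))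
              = I.inject (K (Tm.svar n)) (Function.update (assign s) n x) := by
          intro x
          have h2 := Tm.next_tr (fun i => .inl (I.num (Function.update (assign s) n x i))) id M
          have h6 := inject_update (I := I) hc.term_below (assign s) x
          simp only at h6
          rw [← h6, inject, Tm.close]
          rw [h] at h2
          generalize Tm.next (Tm.tr _ _ M) = a at h2
          cases h2 with
          | smp _ K' hK =>
            refine ⟨K', rfl, ?_⟩
            have := hK (Tm.svar n)
            rw [Tm.tr, Tm.atom] at this
            simpa only [Function.update_self, inject, Tm.close] using this
        obtain ⟨K', hK', -⟩ := h5 0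
        refine ⟨K', hK', fun x => ?_⟩
        obtain ⟨K'', hK'', hx⟩ := h5 x
        have := hK'.symm.trans hK''
        injection this with this
        rw [this, hx]
      rw [run, hK', exec]
      simp only [hx]
      rw [lintegral_const_mul'']
      exact (((hF.run N).inject (K (Tm.svar n))).comp_measurable
        ((measurable_update_pair n).comp (measurable_id.prodMk measurable_const)) : UMeas _) unif
        inferInstance
    | br V M₁ M₂ =>
      have hr₁ : Config.Red ⟨⟨n, Δ, Ξ⟩, M⟩ ⟨⟨n, ⟨V, Cmp.le, 0⟩ :: Δ, Ξ⟩, M₁⟩ := by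
        rw [red_iff, h]
        exact .inl ⟨rfl, rfl⟩
      have hr₂ : Config.Red ⟨⟨n, Δ, Ξ⟩, M⟩ ⟨⟨n, ⟨V, Cmp.gt, 0⟩ :: Δ, Ξ⟩, M₂⟩ := by
        rw [red_iff, h]
        exact .inr ⟨rfl, rfl⟩
      have h1 : pathsIn (N + 1) ⟨⟨n, Δ, Ξ⟩, M⟩ = pathsIn N ⟨⟨n, ⟨V, Cmp.le, 0⟩ :: Δ, Ξ⟩, M₁⟩
          ∪ pathsIn N ⟨⟨n, ⟨V, Cmp.gt, 0⟩ :: Δ, Ξ⟩, M₂⟩ := by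
        ext Ψ
        constructor
        · rintro (⟨hv, -⟩ | ⟨⟨_, _⟩, h1, h2⟩)
          · cases h.symm.trans hv.isRet
          · rw [red_iff, h] at h1
            rcases h1 with ⟨rfl, rfl⟩ | ⟨rfl, rfl⟩
            · exact .inl h2
            · exact .inr h2
        · rintro (h1 | h1)
          · exact .inr ⟨_, hr₁, h1⟩
          · exact .inr ⟨_, hr₂, h1⟩
      have hd : Disjoint (pathsIn N ⟨⟨n, ⟨V, Cmp.le, 0⟩ :: Δ, Ξ⟩, M₁⟩)
          (pathsIn N ⟨⟨n, ⟨V, Cmp.gt, 0⟩ :: Δ, Ξ⟩, M₂⟩) := by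
        rw [Set.disjoint_left]
        intro Ψ h1 h2
        have h3 := List.suffix_of_suffix_length_le (suffix_of_mem_pathsIn h1)
          (suffix_of_mem_pathsIn h2) (by simp)
        have h4 := h3.eq_of_length (by simp)
        simp at h4
      rw [tsum_congr_set_coe _ h1,
        ENNReal.summable.tsum_union_disjoint (f := I.pathMass F) hd ENNReal.summable,
        ih (hc.red hr₁), ih (hc.red hr₂), ← lintegral_add_left' (hmeas _)]
      refine lintegral_congr fun s => ?_
      have h2 := hrun ⟨⟨n, Δ, Ξ⟩, M⟩ s
      rw [h] at h2
      simp only [run, inject, Tm.close, weight, List.map_cons, List.prod_cons] at h2 ⊢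
      generalize Tm.next (Tm.tr _ _ M) = a at h2
      cases h2
      simp only [exec]
      ring
    | sc V M' =>
      have hr : Config.Red ⟨⟨n, Δ, Ξ⟩, M⟩ ⟨⟨n, ⟨V, Cmp.ge, 0⟩ :: Δ, V :: Ξ⟩, M'⟩ := by
        rw [red_iff, h]
        exact ⟨rfl, rfl⟩
      have h1 : pathsIn (N + 1) ⟨⟨n, Δ, Ξ⟩, M⟩
          = pathsIn N ⟨⟨n, ⟨V, Cmp.ge, 0⟩ :: Δ, V :: Ξ⟩, M'⟩ := by
        ext Ψ
        constructor
        · rintro (⟨hv, -⟩ | ⟨⟨_, _⟩, h1, h2⟩)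
          · cases h.symm.trans hv.isRet
          · rw [red_iff, h] at h1
            obtain ⟨rfl, rfl⟩ := h1
            exact h2
        · exact fun h1 => .inr ⟨_, hr, h1⟩
      rw [tsum_congr_set_coe _ h1, ih (hc.red hr)]
      refine lintegral_congr fun s => ?_
      have h2 := hrun ⟨⟨n, Δ, Ξ⟩, M⟩ s
      rw [h] at h2
      simp only [run, inject, Tm.close, weight, List.map_cons, List.prod_cons] at h2 ⊢
      generalize Tm.next (Tm.tr _ _ M) = a at h2
      cases h2
      simp only [exec]
      ring

/-- The total mass of the symbolic paths is the expectation over the initial traces. -/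
theorem tsum_symPaths {F : Tm S L [] Ty.real → ℝ≥0∞} (hF : I.MeasFun F) {c : Config S L}
    (hc : c.Below) : ∑' Ψ : symPaths c, I.pathMass F Ψ.1
      = ∫⁻ s in cube c.n, I.weight c.toState (assign s)
          * I.wp (I.inject c.term (assign s)) F := by
  have hm : Monotone fun N => pathsIn N c := fun m n h => pathsIn_mono h c
  have h1 : ∀ Ψ, (symPaths c).indicator (I.pathMass F) Ψ
      = ⨆ N, (pathsIn N c).indicator (I.pathMass F) Ψ := by
    intro Ψ
    rw [symPaths_eq_iUnion]
    exact Set.indicator_iUnion_apply rfl _ _ _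
  have h2 : ∑' Ψ : symPaths c, I.pathMass F Ψ.1
      = ⨆ N, ∑' Ψ : pathsIn N c, I.pathMass F Ψ.1 := by
    simp only [tsum_subtype _ (I.pathMass F), h1, ENNReal.tsum_eq_iSup_sum]
    rw [iSup_comm]
    refine iSup_congr fun s => ENNReal.finsetSum_iSup_of_monotone fun Ψ m n h => ?_
    exact Set.indicator_le_indicator_of_subset (hm h) (fun _ => zero_le) Ψ
  rw [h2]
  simp only [tsum_pathsIn hF _ hc, wp, ENNReal.mul_iSup]
  refine (lintegral_iSup' (fun N => ?_) (.of_forall fun s m n h => ?_)).symm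
  · exact ((weight_meas c.toState).mul ((hF.run N).inject c.term)).comp_measurable
      measurable_assign _ inferInstance
  · exact mul_le_mul_right (I.run_mono h _ fun _ => le_rfl) _

end Interp

end Paths

end SPCF

namespace SPCF

/-! ### The interpretations by reals and by intervals -/

namespace Tm

variable {S : Signature}

/-- The value of a term without sample variables. -/
def val {Γ : List Ty} {τ : Ty} (M : Tm S ℝ Γ τ) : ℝ := M.eval fun _ => 0

/-- The set of the values of an interval term without sample variables. -/
def vals {Γ : List Ty} {τ : Ty} (M : Tm S Interval Γ τ) : Set ℝ := M.evalSet fun _ => 0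

theorem val_close (s : ℕ → ℝ) {Γ : List Ty} {τ : Ty} (M : Tm S ℝ Γ τ) :
    (M.close s).val = M.eval s := by
  induction M with
  | prim f M ih => exact congrArg (S.fn f) (funext ih)
  | _ => rfl

theorem toSet_point (r : ℝ) : (Interval.point r).toSet = {r} := by
  ext x
  simp only [Interval.toSet, Interval.point, Set.mem_ofPred_eq, EReal.coe_le_coe_iff,
    Set.mem_singleton_iff]
  exact ⟨fun h => le_antisymm h.2 h.1, fun h => ⟨h.ge, h.le⟩⟩

theorem vals_close (s : ℕ → ℝ) {Γ : List Ty} {τ : Ty} (M : Tm S Interval Γ τ) :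
    (M.close fun i => Interval.point (s i)).vals = M.evalSet s := by
  induction M with
  | svar i => exact toSet_point (s i)
  | prim f M ih =>
    refine congrArg (Set.image (S.fn f)) (Set.ext fun x => forall_congr' fun i => ?_)
    exact Set.ext_iff.1 (ih i) (x i)
  | _ => rfl

theorem measurable_val_fill {Γ : List Ty} {τ : Ty} (M : Tm S (ℕ ⊕ ℝ) Γ τ) :
    Measurable fun s : ℕ → ℝ => (M.fill fun i => s i).val := by
  induction M with
  | lit l =>
    cases l with
    | inl i => exact measurable_pi_apply i
    | inr r => exact measurable_const
  | prim f M ih => exact (S.measurable_fn f).comp (measurable_pi_iff.2 ih)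
  | _ => exact measurable_const

theorem measurableSet_toSet (I : Interval) : MeasurableSet I.toSet :=
  (measurableSet_le measurable_const measurable_coe_real_ereal).inter
    (measurableSet_le measurable_coe_real_ereal measurable_const)

theorem analyticSet_vals_fill {Γ : List Ty} {τ : Ty} (M : Tm S (ℕ ⊕ Interval) Γ τ) :
    AnalyticSet {p : (ℕ → ℝ) × ℝ | p.2 ∈ (M.fill fun i => Interval.point (p.1 i)).vals} := by
  induction M with
  | lit l =>
    cases l with
    | inl i =>
      convert (measurableSet_eq_fun (measurable_snd (α := ℕ → ℝ) (β := ℝ))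
        ((measurable_pi_apply i).comp measurable_fst)).analyticSet using 1
      ext p
      exact Set.ext_iff.1 (toSet_point (p.1 i)) p.2
    | inr I => exact (measurable_snd (measurableSet_toSet I)).analyticSet
  | svar i => exact (measurable_snd (measurableSet_singleton (0 : ℝ))).analyticSet
  | prim f M ih =>
    let T : Option (Fin (S.arity f)) → Set (((ℕ → ℝ) × ℝ) × (Fin (S.arity f) → ℝ)) := fun o =>
      match o with
      | none => {q | S.fn f q.2 = q.1.2}
      | some i => (fun q => (q.1.1, q.2 i)) ⁻¹'
          {p : (ℕ → ℝ) × ℝ | p.2 ∈ ((M i).fill fun i => Interval.point (p.1 i)).vals}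
    have hT : AnalyticSet (⋂ o, T o) := by
      refine AnalyticSet.iInter fun o => ?_
      cases o with
      | none =>
        exact (measurableSet_eq_fun ((S.measurable_fn f).comp measurable_snd)
          (measurable_snd.comp measurable_fst)).analyticSet
      | some i => exact (ih i).preimage (by fun_prop)
    convert hT.image_of_continuous continuous_fst using 1
    ext p
    constructor
    · rintro ⟨x, hx, h⟩
      refine ⟨(p, x), Set.mem_iInter.2 fun o => ?_, rfl⟩
      cases o with
      | none => exact h
      | some i => exact hx i
    · rintro ⟨⟨p, x⟩, h, rfl⟩
      rw [Set.mem_iInter] at h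
      exact ⟨x, fun i => h (some i), h none⟩
  | _ => exact MeasurableSet.empty.analyticSet

theorem analyticSet_exists_vals {Γ : List Ty} {τ : Ty} (M : Tm S (ℕ ⊕ Interval) Γ τ) {U : Set ℝ}
    (hU : MeasurableSet U) :
    AnalyticSet {s : ℕ → ℝ | ∃ t ∈ (M.fill fun i => Interval.point (s i)).vals, t ∈ U} := by
  let T : Bool → Set ((ℕ → ℝ) × ℝ) := fun b => if b then Prod.snd ⁻¹' U else
    {p | p.2 ∈ (M.fill fun i => Interval.point (p.1 i)).vals}
  have hT : AnalyticSet (⋂ b, T b) := by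
    refine AnalyticSet.iInter fun b => ?_
    cases b with
    | true => exact (measurable_snd hU).analyticSet
    | false => exact analyticSet_vals_fill M
  convert hT.image_of_continuous continuous_fst using 1
  ext s
  constructor
  · rintro ⟨t, h, ht⟩
    refine ⟨(s, t), Set.mem_iInter.2 fun b => ?_, rfl⟩
    cases b with
    | true => exact ht
    | false => exact h
  · rintro ⟨⟨s, t⟩, h, rfl⟩
    rw [Set.mem_iInter] at h
    exact ⟨t, h false, h true⟩

theorem nullMeasurableSet_exists_vals {Γ : List Ty} {τ : Ty} (M : Tm S (ℕ ⊕ Interval) Γ τ)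
    {U : Set ℝ} (hU : MeasurableSet U) (μ : Measure (ℕ → ℝ)) [IsFiniteMeasure μ] :
    NullMeasurableSet {s | ∃ t ∈ (M.fill fun i => Interval.point (s i)).vals, t ∈ U} μ :=
  nullMeasurableSet_of_analyticSet μ (analyticSet_exists_vals M hU)

theorem nullMeasurableSet_forall_vals {Γ : List Ty} {τ : Ty} (M : Tm S (ℕ ⊕ Interval) Γ τ)
    {U : Set ℝ} (hU : MeasurableSet U) (μ : Measure (ℕ → ℝ)) [IsFiniteMeasure μ] :
    NullMeasurableSet {s | ∀ t ∈ (M.fill fun i => Interval.point (s i)).vals, t ∈ U} μ := by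
  convert (nullMeasurableSet_exists_vals M hU.compl μ).compl using 1
  ext s
  simp

theorem _root_.SPCF.Cmp.measurableSet_holds (c : Cmp) (r : ℝ) : MeasurableSet {t | c.Holds t r} := by
  cases c with
  | le => exact measurableSet_Iic
  | lt => exact measurableSet_Iio
  | ge => exact measurableSet_Ici
  | gt => exact measurableSet_Ioi

end Tm

variable (S : Signature)

/-- The weights of the denotation of interval-free paths. -/
def conc : Interp S ℝ where
  num := id
  holds V c r := iverson (c.Holds V.val r)
  sc V := ENNReal.ofReal V.val
  holds_meas c r M := UMeas.iverson fun _ _ =>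
    ((Tm.measurable_val_fill M) (c.measurableSet_holds r)).nullMeasurableSet
  sc_meas M := UMeas.of_measurable (Tm.measurable_val_fill M).ennreal_ofReal

/-- The weights of the probability of satisfying the constraints of a path. -/
def probTerm : Interp S ℝ where
  num := id
  holds V c r := iverson (c.Holds V.val r)
  sc _ := 1
  holds_meas := (conc S).holds_meas
  sc_meas _ := UMeas.const 1

/-- The weights of the lower bound of interval paths. -/
def lower : Interp S Interval where
  num := Interval.point
  holds V c r := iverson (∀ t ∈ V.vals, c.Holds t r)
  sc V := ⨅ t ∈ V.vals, ENNReal.ofReal t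
  holds_meas c r M := UMeas.iverson fun μ _ =>
    Tm.nullMeasurableSet_forall_vals M (c.measurableSet_holds r) μ
  sc_meas M := UMeas.of_nullMeasurable fun μ _ a => by
    have h : ∀ b : ℝ≥0∞, NullMeasurableSet {s : ℕ → ℝ |
        ∀ t ∈ (M.fill fun i => Interval.point (s i)).vals, t ∈ {t | b ≤ ENNReal.ofReal t}} μ :=
      fun b => Tm.nullMeasurableSet_forall_vals M
        (measurableSet_le measurable_const ENNReal.measurable_ofReal) μ
    by_cases ha : a = ⊤
    · convert (MeasurableSet.empty (α := ℕ → ℝ)).nullMeasurableSet using 1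
      ext s
      simp [ha]
    obtain ⟨u, hu, hau, hlim⟩ := exists_seq_strictAnti_tendsto' (lt_top_iff_ne_top.2 ha)
    convert NullMeasurableSet.iUnion fun n => h (u n) using 1
    ext s
    simp only [Set.mem_ofPred_eq, Set.mem_iUnion]
    constructor
    · intro hs
      obtain ⟨n, hn⟩ := (hlim.eventually (gt_mem_nhds hs)).exists
      exact ⟨n, fun t ht => hn.le.trans (iInf₂_le t ht)⟩
    · rintro ⟨n, hn⟩
      exact (hau n).1.trans_le (le_iInf₂ hn)

/-- The weights of the upper bound of interval paths. -/
def upper : Interp S Interval where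
  num := Interval.point
  holds V c r := iverson (∃ t ∈ V.vals, c.Holds t r)
  sc V := ⨆ t ∈ V.vals, ENNReal.ofReal t
  holds_meas c r M := UMeas.iverson fun μ _ =>
    Tm.nullMeasurableSet_exists_vals M (c.measurableSet_holds r) μ
  sc_meas M := UMeas.of_nullMeasurable fun μ _ a => by
    convert Tm.nullMeasurableSet_exists_vals M (U := {t | a < ENNReal.ofReal t})
      (measurableSet_lt measurable_const ENNReal.measurable_ofReal) μ using 1
    ext s
    simp only [Set.mem_ofPred_eq, lt_iSup_iff, exists_prop]

end SPCF

namespace SPCF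

/-! ### Interval arithmetic -/

namespace Interval

theorem Sub.toSet_subset {I J : Interval} (h : I.Sub J) : I.toSet ⊆ J.toSet :=
  fun _ hx => ⟨h.1.trans hx.1, hx.2.trans h.2⟩

theorem mem_lift {k : ℕ} {f : (Fin k → ℝ) → ℝ} {I : Fin k → Interval} {x : Fin k → ℝ}
    (hx : ∀ i, x i ∈ (I i).toSet) : f x ∈ (lift f I).toSet :=
  ⟨sInf_le ⟨f x, ⟨x, hx, rfl⟩, rfl⟩, le_sSup ⟨f x, ⟨x, hx, rfl⟩, rfl⟩⟩

theorem mem_mul {I J : Interval} {x y : ℝ} (hx : x ∈ I.toSet) (hy : y ∈ J.toSet) :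
    x * y ∈ (I.mul J).toSet :=
  mem_lift (f := fun x : Fin 2 → ℝ => x 0 * x 1) (I := ![I, J]) (x := ![x, y]) fun i => by
    fin_cases i
    · exact hx
    · exact hy

theorem one_mem_one : (1 : ℝ) ∈ one.toSet := by
  rw [one, Tm.toSet_point]
  rfl

theorem mem_unit {x : ℝ} (hx : 0 ≤ x ∧ x ≤ 1) : x ∈ unit.toSet :=
  ⟨EReal.coe_nonneg.2 hx.1, by
    have := EReal.coe_le_coe_iff.2 hx.2
    simpa [unit] using this⟩

theorem mem_meetNonneg {I : Interval} (h : 0 ≤ I.hi) {x : ℝ} (hx : x ∈ I.toSet) (h0 : 0 ≤ x) :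
    x ∈ (I.meetNonneg h).toSet :=
  ⟨max_le hx.1 (EReal.coe_nonneg.2 h0), hx.2⟩

end Interval

/-! ### Soundness of the interval type system -/

variable {S : Signature}

/-- All executions of at most `N` steps end in a value `V` with `Q i r V`, where `i` is the number
of the remaining steps and `r` the product of the scores. -/
def Safe {τ : Ty} : ℕ → Tm S ℝ [] τ → (ℕ → ℝ → Tm S ℝ [] τ → Prop) → Prop
  | 0, M, Q => M.IsRet → Q 0 1 M
  | N + 1, M, Q =>
    match M.next with
    | .ret => Q (N + 1) 1 M
    | .tau M' => Safe N M' Q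
    | .smp K => ∀ x : ℝ, 0 ≤ x ∧ x ≤ 1 → Safe N (K (Tm.lit x)) Q
    | .br V M₁ M₂ => (V.val ≤ 0 → Safe N M₁ Q) ∧ (0 < V.val → Safe N M₂ Q)
    | .sc V M' => 0 ≤ V.val → Safe N M' fun i r R => Q i (V.val * r) R

section Safe

variable {τ ρ : Ty}

theorem safe_of_isRet {N : ℕ} {M : Tm S ℝ [] τ} {Q : ℕ → ℝ → Tm S ℝ [] τ → Prop} (hM : M.IsRet)
    (h : Q N 1 M) : Safe N M Q := by
  cases N with
  | zero => exact fun _ => h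
  | succ N =>
    rw [Tm.IsRet] at hM
    simpa only [Safe, hM] using h

theorem Safe.of_isRet {N : ℕ} {M : Tm S ℝ [] τ} {Q : ℕ → ℝ → Tm S ℝ [] τ → Prop} (hM : M.IsRet)
    (h : Safe N M Q) : Q N 1 M := by
  cases N with
  | zero => exact h hM
  | succ N =>
    rw [Tm.IsRet] at hM
    simpa only [Safe, hM] using h

theorem Safe.mono {N : ℕ} {M : Tm S ℝ [] τ} {Q Q' : ℕ → ℝ → Tm S ℝ [] τ → Prop}
    (h : Safe N M Q) (hQ : ∀ i ≤ N, ∀ r V, V.IsRet → Q i r V → Q' i r V) : Safe N M Q' := by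
  induction N generalizing M Q Q' with
  | zero => exact fun hM => hQ 0 le_rfl _ _ hM (h hM)
  | succ N ih =>
    have hQ' : ∀ i ≤ N, ∀ r V, V.IsRet → Q i r V → Q' i r V :=
      fun i hi => hQ i (hi.trans (Nat.le_succ N))
    simp only [Safe] at h ⊢
    generalize ha : M.next = a at h ⊢
    cases a with
    | ret => exact hQ _ le_rfl _ _ ha h
    | tau M' => exact ih h hQ'
    | smp K => exact fun x hx => ih (h x hx) hQ'
    | br V M₁ M₂ => exact ⟨fun hV => ih (h.1 hV) hQ', fun hV => ih (h.2 hV) hQ'⟩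
    | sc V M' => exact fun hV => ih (h hV) fun i hi r R hR => hQ' i hi _ R hR

theorem Safe.bind {N : ℕ} {E : Tm S ℝ [] τ → Tm S ℝ [] ρ} (hE : Frame E) {M : Tm S ℝ [] τ}
    {Q : ℕ → ℝ → Tm S ℝ [] ρ → Prop}
    (h : Safe N M fun j r V => Safe j (E V) fun i r' R => Q i (r * r') R) : Safe N (E M) Q := by
  by_cases hM : M.IsRet
  · simpa only [one_mul] using h.of_isRet hM
  induction N generalizing M Q with
  | zero => exact fun hEM => absurd (Act.map_eq_ret.1 ((hE.next_eq hM).symm.trans hEM)) hM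
  | succ N ih =>
    have ih' : ∀ {M : Tm S ℝ [] τ} {Q : ℕ → ℝ → Tm S ℝ [] ρ → Prop},
        (Safe N M fun j r V => Safe j (E V) fun i r' R => Q i (r * r') R) → Safe N (E M) Q := by
      intro M Q h
      by_cases hM : M.IsRet
      · simpa only [one_mul] using h.of_isRet hM
      · exact ih h hM
    simp only [Safe, hE.next_eq hM] at h ⊢
    generalize ha : M.next = a at h
    cases a with
    | ret => exact absurd ha hM
    | tau M' => exact ih' h
    | smp K => exact fun x hx => ih' (h x hx)
    | br V M₁ M₂ => exact ⟨fun hV => ih' (h.1 hV), fun hV => ih' (h.2 hV)⟩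
    | sc V M' => exact fun hV => ih' (by simpa only [mul_assoc] using h hV)

end Safe

/-- The step-indexed semantics of weightless interval types. -/
def ValSafe : {α : Ty} → IType α → ℕ → Tm S ℝ [] α → Prop
  | _, .base I, _, V => V.IsRet ∧ V.val ∈ I.toSet
  | _, .arr σ τ w, N, V => V.IsRet ∧ ∀ j ≤ N, ∀ W, ValSafe σ j W →
      Safe j (Tm.app V W) fun i r R => r ∈ w.toSet ∧ ValSafe τ i R

theorem ValSafe.isRet {α : Ty} {σ : IType α} {N : ℕ} {V : Tm S ℝ [] α} (h : ValSafe σ N V) :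
    V.IsRet := by
  cases σ with
  | base I => exact h.1
  | arr σ τ w => exact h.1

theorem ValSafe.of_le {α : Ty} {σ : IType α} {M N : ℕ} (hMN : M ≤ N) {V : Tm S ℝ [] α}
    (h : ValSafe σ N V) : ValSafe σ M V := by
  cases σ with
  | base I => exact h
  | arr σ τ w => exact ⟨h.1, fun j hj => h.2 j (hj.trans hMN)⟩

theorem ValSafe.sub {α : Ty} {σ τ : IType α} (hs : σ.Sub τ) {N : ℕ} {V : Tm S ℝ [] α}
    (h : ValSafe σ N V) : ValSafe τ N V := by
  induction hs generalizing N with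
  | base hI => exact ⟨h.1, hI.toSet_subset h.2⟩
  | arr _ _ hw ihσ ihτ =>
    exact ⟨h.1, fun j hj W hW => (h.2 j hj W (ihσ hW)).mono
      fun i _ r R _ hR => ⟨hw.toSet_subset hR.1, ihτ hR.2⟩⟩

theorem safe_app {α β : Ty} {N : ℕ} {M : Tm S ℝ [] (Ty.arr α β)} {P : Tm S ℝ [] α}
    {σ : IType α} {τ : IType β} {u v w : Interval}
    (hM : Safe N M fun i r R => r ∈ u.toSet ∧ ValSafe (.arr σ τ w) i R)
    (hP : ∀ j ≤ N, Safe j P fun i r R => r ∈ v.toSet ∧ ValSafe σ i R) :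
    Safe N (Tm.app M P) fun i r R => r ∈ ((u.mul v).mul w).toSet ∧ ValSafe τ i R := by
  refine Safe.bind (Frame.appLeft P) (hM.mono fun j hj r V hV h => ?_)
  refine Safe.bind (Frame.appRight V hV) ((hP j hj).mono fun j' hj' r' W hW h' => ?_)
  refine (h.2.2 j' hj' W h'.2).mono fun i hi r'' R hR h'' => ⟨?_, h''.2⟩
  rw [← mul_assoc]
  exact Interval.mem_mul (Interval.mem_mul h.1 h'.1) h''.1

theorem safe_prim {f : S.Op} {I u : Fin (S.arity f) → Interval} (k : ℕ) (hk : k ≤ S.arity f) :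
    ∀ (N : ℕ) (M : Fin (S.arity f) → Tm S ℝ [] Ty.real),
      (∀ i, S.arity f - k ≤ i.1 → ∀ j ≤ N, Safe j (M i) fun n r R =>
        r ∈ (u i).toSet ∧ ValSafe (.base (I i)) n R) →
      (∀ i, i.1 < S.arity f - k → (M i).IsRet ∧ (M i).val ∈ (I i).toSet) →
      Safe N (Tm.prim f M) fun n r R =>
        (∃ ρ : Fin (S.arity f) → ℝ, (∀ i, i.1 < S.arity f - k → ρ i = 1) ∧
          (∀ i, S.arity f - k ≤ i.1 → ρ i ∈ (u i).toSet) ∧ r = ∏ i, ρ i) ∧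
        ValSafe (.base (Interval.lift (S.fn f) I)) n R := by
  induction k with
  | zero =>
    intro N M _ h
    have hr : (Tm.prim f M).IsRet := Tm.next_prim_ret f M fun i => (h i (by omega)).1
    exact safe_of_isRet hr ⟨⟨fun _ => 1, fun _ _ => rfl, fun i hi => absurd i.2 (by omega),
      by simp⟩, hr, Interval.mem_lift fun i => (h i (by omega)).2⟩
  | succ k ih =>
    intro N M hM hV
    let i₀ : Fin (S.arity f) := ⟨S.arity f - (k + 1), by omega⟩
    have hE := Frame.prim (L := ℝ) f M i₀ fun j hj => (hV j hj).1
    have h1 := Safe.bind (N := N) (M := M i₀) (Q := fun n r R =>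
        (∃ ρ : Fin (S.arity f) → ℝ, (∀ i, i.1 < S.arity f - (k + 1) → ρ i = 1) ∧
          (∀ i, S.arity f - (k + 1) ≤ i.1 → ρ i ∈ (u i).toSet) ∧ r = ∏ i, ρ i) ∧
        ValSafe (.base (Interval.lift (S.fn f) I)) n R) hE
    rw [Function.update_eq_self] at h1
    refine h1 ((hM i₀ le_rfl N le_rfl).mono fun j hj r V hVr h => ?_)
    refine (ih (by omega) j (Function.update M i₀ V) ?_ ?_).mono ?_
    · intro i hi j' hj'
      have : i ≠ i₀ := by
        rintro rfl
        simp only [i₀] at hi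
        omega
      rw [Function.update_of_ne this]
      exact hM i (by omega) j' (hj'.trans hj)
    · intro i hi
      rcases eq_or_ne i i₀ with rfl | hne
      · rw [Function.update_self]
        exact h.2
      · rw [Function.update_of_ne hne]
        refine hV i ?_
        have : i.1 ≠ S.arity f - (k + 1) := fun h => hne (Fin.ext h)
        omega
    · rintro n - r' R - ⟨⟨ρ, hρ1, hρ2, rfl⟩, hR⟩
      refine ⟨⟨Function.update ρ i₀ r, fun i hi => ?_, fun i hi => ?_, ?_⟩, hR⟩
      · have : i ≠ i₀ := by
          rintro rfl
          simp only [i₀] at hi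
          omega
        rw [Function.update_of_ne this]
        exact hρ1 i (by omega)
      · rcases eq_or_ne i i₀ with rfl | hne
        · rw [Function.update_self]
          exact h.1
        · rw [Function.update_of_ne hne]
          refine hρ2 i ?_
          have : i.1 ≠ S.arity f - (k + 1) := fun h => hne (Fin.ext h)
          omega
      · rw [Finset.prod_update_of_mem (Finset.mem_univ _)]
        congr 1
        rw [← Finset.mul_prod_erase Finset.univ ρ (Finset.mem_univ i₀),
          hρ1 i₀ (by simp only [i₀]; omega), one_mul, Finset.sdiff_singleton_eq_erase]

theorem valSafe_extend {Γ : List Ty} {α : Ty} {Θ : ICtx Γ} {σ : IType α} {N : ℕ}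
    {θ : ∀ τ, Var Γ τ → Tm S ℝ [] τ} {V : Tm S ℝ [] α}
    (hθ : ∀ τ x, ValSafe (Θ.lookup x) N (θ τ x)) (hV : ValSafe σ N V) :
    ∀ τ x, ValSafe ((ICtx.cons σ Θ).lookup x) N (Tm.extend θ V τ x) := by
  intro τ x
  cases x with
  | zero => exact hV
  | succ x => exact hθ _ x

/-- Well-typed terms are safe. -/
theorem safe_of_deriv {s : ℕ → ℝ} (hs : ∀ i, 0 ≤ s i ∧ s i ≤ 1) {Γ : List Ty} {α : Ty}
    {Θ : ICtx Γ} {M : Tm S ℝ Γ α} {A : WType α} (D : Deriv Θ M A) :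
    ∀ (N : ℕ) (θ : ∀ τ, Var Γ τ → Tm S ℝ [] τ), (∀ τ x, ValSafe (Θ.lookup x) N (θ τ x)) →
      Safe N (Tm.subst θ (M.close s)) fun i r R => r ∈ A.weight.toSet ∧ ValSafe A.type i R := by
  induction D with
  | var x =>
    intro N θ hθ
    exact safe_of_isRet (hθ _ x).isRet ⟨Interval.one_mem_one, hθ _ x⟩
  | sub D h ih =>
    intro N θ hθ
    exact (ih N θ hθ).mono fun i _ r R _ hR => ⟨h.2.toSet_subset hR.1, hR.2.sub h.1⟩
  | @lam Γ α β Θ M σ A D ih =>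
    intro N θ hθ
    refine safe_of_isRet rfl ⟨Interval.one_mem_one, rfl, fun j hj W hW => ?_⟩
    cases j with
    | zero =>
      intro h
      have h1 : Tm.next W = .ret := hW.isRet
      simp [Tm.close, Tm.tr, Tm.subst, Tm.IsRet, Tm.next, h1, Act.map, Tm.betaAct] at h
    | succ j =>
      have h1 : Tm.next W = .ret := hW.isRet
      have h2 := ih j (Tm.extend θ W) (valSafe_extend
        (fun τ x => (hθ τ x).of_le (by omega)) (hW.of_le (Nat.le_succ j)))
      rw [← Tm.inst_subst_liftSubst] at h2
      simpa only [Tm.close, Tm.tr, Tm.subst, Safe, Tm.next, h1, Act.map, Tm.betaAct,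
        Act.ret_orElse] using h2
  | @fix Γ α β Θ M σ A D ih =>
    intro N θ hθ
    refine safe_of_isRet rfl ⟨Interval.one_mem_one, ?_⟩
    induction N with
    | zero =>
      refine ⟨rfl, fun j hj W hW => ?_⟩
      obtain rfl : j = 0 := by omega
      intro h
      have h1 : Tm.next W = .ret := hW.isRet
      simp [Tm.close, Tm.tr, Tm.subst, Tm.IsRet, Tm.next, h1, Act.map, Tm.betaAct] at h
    | succ N ihN =>
      refine ⟨rfl, fun j hj W hW => ?_⟩
      have hθ' : ∀ τ x, ValSafe (Θ.lookup x) N (θ τ x) := fun τ x => (hθ τ x).of_le (Nat.le_succ N)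
      have h0 := ihN hθ'
      cases j with
      | zero => exact (h0.2 0 (Nat.zero_le _) W hW)
      | succ j =>
        have h1 : Tm.next W = .ret := hW.isRet
        have h2 := ih j (Tm.extend (Tm.extend θ (Tm.subst θ (Tm.close s (Tm.fix M)))) W)
          (valSafe_extend (valSafe_extend (fun τ x => (hθ' τ x).of_le (by omega))
            (h0.of_le (by omega))) (hW.of_le (Nat.le_succ j)))
        rw [← Tm.inst₂_subst_liftSubst] at h2
        simpa only [Tm.close, Tm.tr, Tm.subst, Safe, Tm.next, h1, Act.map, Tm.betaAct,
          Act.ret_orElse] using h2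
  | app D E ihD ihE =>
    intro N θ hθ
    exact safe_app (ihD N θ hθ) fun j hj => ihE j θ fun τ x => (hθ τ x).of_le hj
  | lit r =>
    intro N θ hθ
    refine safe_of_isRet rfl ⟨Interval.one_mem_one, rfl, ?_⟩
    rw [Tm.toSet_point]
    rfl
  | svar i =>
    intro N θ hθ
    exact safe_of_isRet rfl ⟨Interval.one_mem_one, rfl, Interval.mem_unit (hs i)⟩
  | sample =>
    intro N θ hθ
    cases N with
    | zero => exact fun h => nomatch (show Act.smp _ = Act.ret from h)
    | succ N =>
      exact fun x hx => safe_of_isRet rfl ⟨Interval.one_mem_one, rfl, Interval.mem_unit hx⟩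
  | @ite Γ α Θ M P₁ P₂ I σ u v D E F ihD ihE ihF =>
    intro N θ hθ
    refine Safe.bind (Frame.ite _ _) ((ihD N θ hθ).mono fun j hj r V hV h => ?_)
    cases j with
    | zero =>
      intro h'
      have h1 : Tm.next V = .ret := hV
      simp [Tm.IsRet, Tm.next, h1, Act.map] at h'
    | succ j =>
      have h1 : Tm.next V = .ret := hV
      have hθ' : ∀ τ x, ValSafe (Θ.lookup x) j (θ τ x) := fun τ x => (hθ τ x).of_le (by omega)
      simp only [Safe, Tm.next, h1, Act.map, Act.ret_orElse]
      exact ⟨fun _ => (ihE j θ hθ').mono fun i _ r' R _ hR => ⟨Interval.mem_mul h.1 hR.1, hR.2⟩,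
        fun _ => (ihF j θ hθ').mono fun i _ r' R _ hR => ⟨Interval.mem_mul h.1 hR.1, hR.2⟩⟩
  | score D h0 ih =>
    intro N θ hθ
    refine Safe.bind Frame.score ((ih N θ hθ).mono fun j hj r V hV h => ?_)
    cases j with
    | zero =>
      intro h'
      have h1 : Tm.next V = .ret := hV
      simp [Tm.IsRet, Tm.next, h1, Act.map] at h'
    | succ j =>
      have h1 : Tm.next V = .ret := hV
      simp only [Safe, Tm.next, h1, Act.map, Act.ret_orElse]
      intro hV0
      have h2 := Interval.mem_meetNonneg h0 h.2.2 hV0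
      refine safe_of_isRet hV ⟨?_, hV, h2⟩
      rw [mul_one]
      exact Interval.mem_mul h.1 h2
  | prim f D ih =>
    intro N θ hθ
    refine (safe_prim (S.arity f) le_rfl N _
      (fun i _ j hj => ih i j θ fun τ x => (hθ τ x).of_le hj) (fun i hi => absurd hi (by omega))).mono ?_
    rintro i - r R - ⟨⟨ρ, -, hρ, rfl⟩, hR⟩
    exact ⟨Interval.mem_lift (f := fun x => ∏ i, x i) fun i => hρ i (by omega), hR⟩

end SPCF

namespace SPCF

variable {S : Signature}

/-! ### Estimates for safe terms -/

theorem iverson_of {p : Prop} (h : p) : iverson p = 1 := if_pos h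

theorem iverson_of_not {p : Prop} (h : ¬ p) : iverson p = 0 := if_neg h

theorem iverson_le_one (p : Prop) : iverson p ≤ 1 := by
  by_cases h : p
  · exact (iverson_of h).le
  · exact (iverson_of_not h).le.trans zero_le

theorem iverson_mono {p q : Prop} (h : p → q) : iverson p ≤ iverson q := by
  by_cases hp : p
  · rw [iverson_of hp, iverson_of (h hp)]
  · exact (iverson_of_not hp).le.trans zero_le

theorem ae_unif : ∀ᵐ x ∂unif, 0 ≤ x ∧ x ≤ 1 := ae_restrict_mem measurableSet_Icc

section Safe

variable {τ : Ty}

theorem Safe.shift {N i : ℕ} {M : Tm S ℝ [] τ} {Q : ℕ → ℝ → Tm S ℝ [] τ → Prop}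
    (h : Safe (N + i) M Q) : Safe N M fun j r V => Q (j + i) r V := by
  induction N generalizing M Q with
  | zero => exact fun hM => by simpa only [Nat.zero_add] using h.of_isRet hM
  | succ N ih =>
    rw [show N + 1 + i = (N + i) + 1 by omega] at h
    simp only [Safe] at h ⊢
    generalize M.next = a at h ⊢
    cases a with
    | ret => simpa only [show N + 1 + i = (N + i) + 1 by omega] using h
    | tau M' => exact ih h
    | smp K => exact fun x hx => ih (h x hx)
    | br V M₁ M₂ => exact ⟨fun hV => ih (h.1 hV), fun hV => ih (h.2 hV)⟩
    | sc V M' => exact fun hV => ih (h hV)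

theorem Safe.forall {ι : Type} {N : ℕ} {M : Tm S ℝ [] τ} {Q : ι → ℕ → ℝ → Tm S ℝ [] τ → Prop}
    (h : ∀ i, Safe N M (Q i)) : Safe N M fun j r V => ∀ i, Q i j r V := by
  induction N generalizing M Q with
  | zero => exact fun hM i => h i hM
  | succ N ih =>
    simp only [Safe] at h ⊢
    generalize M.next = a at h ⊢
    cases a with
    | ret => exact h
    | tau M' => exact ih h
    | smp K => exact fun x hx => ih fun i => h i x hx
    | br V M₁ M₂ => exact ⟨fun hV => ih fun i => (h i).1 hV, fun hV => ih fun i => (h i).2 hV⟩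
    | sc V M' => exact fun hV => ih fun i => h i hV

theorem safe_forall_valSafe {M : Tm S ℝ [] τ} {σ : IType τ} {w : Interval}
    (h : ∀ N, Safe N M fun i r R => r ∈ w.toSet ∧ ValSafe σ i R) (N : ℕ) :
    Safe N M fun _ r R => r ∈ w.toSet ∧ ∀ i, ValSafe σ i R :=
  (Safe.forall fun i => (h (N + i)).shift).mono fun j _ _ _ _ hR =>
    ⟨(hR 0).1, fun i => (hR i).2.of_le (Nat.le_add_left i j)⟩

theorem run_le_of_safe {k : Tm S ℝ [] τ → ℝ≥0∞} {C : ℝ≥0∞} (N : ℕ) {M : Tm S ℝ [] τ} {a : ℝ≥0∞}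
    (ha : a ≠ ⊤) (h : Safe N M fun _ r V => a * ENNReal.ofReal r * k V ≤ C) :
    a * (conc S).run N M k ≤ C := by
  induction N generalizing M a with
  | zero => simp [Interp.run]
  | succ N ih =>
    simp only [Safe, Interp.run] at h ⊢
    generalize hM : M.next = b at h ⊢
    cases b with
    | ret => simpa [Interp.exec] using h
    | tau M' => exact ih ha h
    | smp K =>
      simp only [Interp.exec]
      rw [← lintegral_const_mul' _ _ ha]
      refine (lintegral_mono_ae (g := fun _ => C) ?_).trans (by simp)
      filter_upwards [ae_unif] with x hx
      exact ih ha (h x hx)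
    | br V M₁ M₂ =>
      simp only [Interp.exec, conc, Cmp.Holds]
      rcases le_or_gt V.val 0 with hV | hV
      · rw [iverson_of hV, iverson_of_not (not_lt.2 hV), one_mul, zero_mul, add_zero]
        exact ih ha (h.1 hV)
      · rw [iverson_of_not (not_le.2 hV), iverson_of hV, one_mul, zero_mul, zero_add]
        exact ih ha (h.2 hV)
    | sc V M' =>
      simp only [Interp.exec, conc, Cmp.Holds]
      by_cases hV : 0 ≤ V.val
      · rw [iverson_of hV, one_mul, ← mul_assoc]
        refine ih (ENNReal.mul_ne_top ha ENNReal.ofReal_ne_top) ?_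
        simpa only [ENNReal.ofReal_mul hV, mul_assoc] using h hV
      · rw [iverson_of_not hV, zero_mul, zero_mul, mul_zero]
        exact zero_le

theorem le_run_of_safe {k : Tm S ℝ [] τ → ℝ≥0∞} {C : ℝ≥0∞} (N : ℕ)
    {M : Tm S ℝ [] τ} {a : ℝ≥0∞} (ha : a ≠ ⊤)
    (h : Safe N M fun _ r V => C ≤ a * ENNReal.ofReal r * k V) :
    C * (probTerm S).run N M (fun _ => 1) ≤ a * (conc S).run N M k := by
  induction N generalizing M a with
  | zero => simp [Interp.run]
  | succ N ih =>
    simp only [Safe, Interp.run] at h ⊢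
    generalize hM : M.next = b at h ⊢
    cases b with
    | ret => simpa [Interp.exec] using h
    | tau M' => exact ih ha h
    | smp K =>
      simp only [Interp.exec]
      rw [← lintegral_const_mul' _ _ ha, ← lintegral_const_mul'']
      · refine lintegral_mono_ae ?_
        filter_upwards [ae_unif] with x hx
        exact ih ha (h x hx)
      · exact ((Interp.MeasFun.const (I := probTerm S) 1).run N).smp hM
    | br V M₁ M₂ =>
      simp only [Interp.exec, conc, probTerm, Cmp.Holds]
      rcases le_or_gt V.val 0 with hV | hV
      · rw [iverson_of hV, iverson_of_not (not_lt.2 hV)]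
        simp only [one_mul, zero_mul, add_zero]
        exact ih ha (h.1 hV)
      · rw [iverson_of_not (not_le.2 hV), iverson_of hV]
        simp only [one_mul, zero_mul, zero_add]
        exact ih ha (h.2 hV)
    | sc V M' =>
      simp only [Interp.exec, conc, probTerm, Cmp.Holds]
      by_cases hV : 0 ≤ V.val
      · rw [iverson_of hV, one_mul, one_mul, one_mul, ← mul_assoc]
        refine ih (ENNReal.mul_ne_top ha ENNReal.ofReal_ne_top) ?_
        simpa only [ENNReal.ofReal_mul hV, mul_assoc] using h hV
      · rw [iverson_of_not hV]
        simp

theorem term_run_le_one {k : Tm S ℝ [] τ → ℝ≥0∞} (hk : ∀ V, k V ≤ 1) (N : ℕ) (M : Tm S ℝ [] τ) :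
    (probTerm S).run N M k ≤ 1 := by
  induction N generalizing M with
  | zero => simp [Interp.run]
  | succ N ih =>
    simp only [Interp.run]
    cases M.next with
    | ret => exact hk M
    | tau M' => exact ih M'
    | smp K => exact (lintegral_mono fun x => ih _).trans (by simp)
    | br V M₁ M₂ =>
      simp only [Interp.exec, probTerm, Cmp.Holds]
      rcases le_or_gt V.val 0 with hV | hV
      · rw [iverson_of hV, iverson_of_not (not_lt.2 hV), one_mul, zero_mul, add_zero]
        exact ih M₁
      · rw [iverson_of_not (not_le.2 hV), iverson_of hV, one_mul, zero_mul, zero_add]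
        exact ih M₂
    | sc V M' =>
      simp only [Interp.exec, probTerm]
      exact mul_le_one' (mul_le_one' (iverson_le_one _) le_rfl) (ih M')

theorem term_wp_le_one {k : Tm S ℝ [] τ → ℝ≥0∞} (hk : ∀ V, k V ≤ 1) (M : Tm S ℝ [] τ) :
    (probTerm S).wp M k ≤ 1 := iSup_le fun N => term_run_le_one hk N M

theorem conc_run_le_top_mul {k : Tm S ℝ [] τ → ℝ≥0∞} (hk : (probTerm S).MeasFun k) (N : ℕ)
    (M : Tm S ℝ [] τ) : (conc S).run N M k ≤ ⊤ * (probTerm S).run N M k := by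
  have hle : ∀ a : ℝ≥0∞, a ≤ ⊤ * a := fun a => by
    simpa only [one_mul] using mul_le_mul_left (le_top : (1 : ℝ≥0∞) ≤ ⊤) a
  induction N generalizing M with
  | zero => simp [Interp.run]
  | succ N ih =>
    simp only [Interp.run]
    generalize hM : M.next = a
    cases a with
    | ret => exact hle _
    | tau M' => exact ih M'
    | smp K =>
      simp only [Interp.exec]
      rw [← lintegral_const_mul'' _ ((hk.run N).smp hM)]
      exact lintegral_mono fun x => ih _
    | br V M₁ M₂ =>
      simp only [Interp.exec]
      rw [mul_add, mul_left_comm, mul_left_comm ⊤ ((probTerm S).holds V Cmp.gt 0)]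
      exact add_le_add (mul_le_mul_right (ih M₁) _) (mul_le_mul_right (ih M₂) _)
    | sc V M' =>
      simp only [Interp.exec, probTerm, mul_one]
      rw [mul_left_comm, mul_assoc]
      refine mul_le_mul_right ?_ _
      calc (conc S).sc V * (conc S).run N M' k ≤ ⊤ * (⊤ * (probTerm S).run N M' k) :=
            mul_le_mul' le_top (ih M')
        _ = ⊤ * (probTerm S).run N M' k := by rw [← mul_assoc, ENNReal.top_mul_top]

theorem conc_wp_eq_zero {k : Tm S ℝ [] τ → ℝ≥0∞} (hk : (probTerm S).MeasFun k) {M : Tm S ℝ [] τ}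
    (h : (probTerm S).wp M k = 0) : (conc S).wp M k = 0 := by
  refine le_antisymm (iSup_le fun N => (conc_run_le_top_mul hk N M).trans ?_) zero_le
  have : (probTerm S).run N M k ≤ 0 := h ▸ le_iSup (fun N => (probTerm S).run N M k) N
  rw [le_antisymm this zero_le, mul_zero]

/-- The failures of a function `kT ≤ 1` of expectation `1` are negligible. -/
theorem conc_wp_add_top_mul {k kT : Tm S ℝ [] τ → ℝ≥0∞} (hk : (conc S).MeasFun k)
    (hkT : (probTerm S).MeasFun kT) (hle : ∀ V, kT V ≤ 1) {M : Tm S ℝ [] τ}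
    (h : (probTerm S).wp M kT = 1) :
    (conc S).wp M (fun V => k V + ⊤ * (1 - kT V)) = (conc S).wp M k := by
  have hm : (probTerm S).MeasFun fun V => 1 - kT V :=
    fun M => (hkT M).measurable_comp (g := fun x => 1 - x) (measurable_const.sub measurable_id)
  have h1 : (probTerm S).wp M (fun V => 1 - kT V) = 0 := by
    have h2 := Interp.wp_add (k' := fun V => 1 - kT V) hkT M
    have h3 : (fun V => kT V + (1 - kT V)) = fun _ => 1 :=
      funext fun V => add_tsub_cancel_of_le (hle V)
    rw [h3, h] at h2
    have h4 : 1 + (probTerm S).wp M (fun V => 1 - kT V) ≤ 1 + 0 := by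
      rw [← h2, add_zero]
      exact term_wp_le_one (fun _ => le_rfl) M
    exact le_antisymm ((ENNReal.add_le_add_iff_left ENNReal.one_ne_top).1 h4) zero_le
  rw [Interp.wp_add hk]
  rw [conc_wp_eq_zero (k := fun V => ⊤ * (1 - kT V)) ((Interp.MeasFun.const ⊤).mul hm), add_zero]
  rw [Interp.wp_const_mul hm, h1, mul_zero]

end Safe

/-! ### The relation between terms and their approximations -/

/-- Related computations: the expectation of the first term is bounded by those of the second one
for all continuations that are bounded on related values, in the case of the lower bound provided
that the computation and the continuation terminate with probability `1`. -/
def CompRel {τ : Ty} (R : Tm S ℝ [] τ → Tm S Interval [] τ → Prop) (M : Tm S ℝ [] τ)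
    (M' : Tm S Interval [] τ) : Prop :=
  (∀ k k', (conc S).MeasFun k → (upper S).MeasFun k' → (∀ V V', R V V' → k V ≤ k' V') →
    (conc S).wp M k ≤ (upper S).wp M' k') ∧
  ∀ k kT k', (conc S).MeasFun k → (probTerm S).MeasFun kT → (lower S).MeasFun k' → (∀ V, kT V ≤ 1) →
    (∀ V V', R V V' → kT V = 1 → k' V' ≤ k V) → (probTerm S).wp M kT = 1 →
    (lower S).wp M' k' ≤ (conc S).wp M k

section CompRel

variable {τ ρ : Ty}

theorem CompRel.mono {R R' : Tm S ℝ [] τ → Tm S Interval [] τ → Prop} {M : Tm S ℝ [] τ}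
    {M' : Tm S Interval [] τ} (h : CompRel R M M') (hR : ∀ V V', R V V' → R' V V') :
    CompRel R' M M' :=
  ⟨fun k k' hk hk' hkk => h.1 k k' hk hk' fun V V' hV => hkk V V' (hR V V' hV),
    fun k kT k' hk hkT hk' h1 hkk => h.2 k kT k' hk hkT hk' h1 fun V V' hV => hkk V V' (hR V V' hV)⟩

theorem compRel_of_isRet {R : Tm S ℝ [] τ → Tm S Interval [] τ → Prop} {V : Tm S ℝ [] τ}
    {V' : Tm S Interval [] τ} (hV : V.IsRet) (hV' : V'.IsRet) (h : R V V') : CompRel R V V' := by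
  constructor
  · intro k k' _ _ hkk
    rw [Interp.wp_of_isRet hV, Interp.wp_of_isRet hV']
    exact hkk V V' h
  · intro k kT k' _ _ _ _ hkk h1
    rw [Interp.wp_of_isRet hV] at h1
    rw [Interp.wp_of_isRet hV, Interp.wp_of_isRet hV']
    exact hkk V V' h h1

theorem CompRel.bind {R : Tm S ℝ [] τ → Tm S Interval [] τ → Prop}
    {Q : Tm S ℝ [] ρ → Tm S Interval [] ρ → Prop} {M : Tm S ℝ [] τ} {M' : Tm S Interval [] τ}
    {E : Tm S ℝ [] τ → Tm S ℝ [] ρ} {E' : Tm S Interval [] τ → Tm S Interval [] ρ} (hE : Frame E)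
    (hE' : Frame E') (h : CompRel R M M') (hR : ∀ V V', R V V' → CompRel Q (E V) (E' V')) :
    CompRel Q (E M) (E' M') := by
  constructor
  · intro k k' hk hk' hkk
    rw [Interp.wp_bind hk hE, Interp.wp_bind hk' hE']
    exact h.1 _ _ (hk.wp.frame hE) (hk'.wp.frame hE') fun V V' hV => (hR V V' hV).1 k k' hk hk' hkk
  · intro k kT k' hk hkT hk' h1 hkk hT
    rw [Interp.wp_bind hkT hE] at hT
    rw [Interp.wp_bind hk hE, Interp.wp_bind hk' hE']
    exact h.2 _ _ _ (hk.wp.frame hE) (hkT.wp.frame hE) (hk'.wp.frame hE')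
      (fun V => term_wp_le_one h1 _) (fun V V' hV => (hR V V' hV).2 k kT k' hk hkT hk' h1 hkk) hT

theorem compRel_of_next_tau {R : Tm S ℝ [] τ → Tm S Interval [] τ → Prop} {M N : Tm S ℝ [] τ}
    {M' N' : Tm S Interval [] τ} (hM : M.next = .tau N) (hM' : M'.next = .tau N')
    (h : CompRel R N N') : CompRel R M M' := by
  constructor
  · intro k k' hk hk' hkk
    rw [Interp.wp_eq hk, Interp.wp_eq hk', hM, hM']
    exact h.1 k k' hk hk' hkk
  · intro k kT k' hk hkT hk' h1 hkk hT
    rw [Interp.wp_eq hkT, hM] at hT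
    rw [Interp.wp_eq hk, Interp.wp_eq hk', hM, hM']
    exact h.2 k kT k' hk hkT hk' h1 hkk hT

theorem compRel_sample {R : Tm S ℝ [] Ty.real → Tm S Interval [] Ty.real → Prop}
    (hR : ∀ x, 0 ≤ x ∧ x ≤ 1 → R (.lit x) (.lit (.point x))) : CompRel R .sample .sample := by
  have h1 : (Tm.sample : Tm S ℝ [] _).next = .smp fun t => t := rfl
  have h2 : (Tm.sample : Tm S Interval [] _).next = .smp fun t => t := rfl
  have h3 : ∀ (x : ℝ), (Tm.lit x : Tm S ℝ [] _).IsRet := fun _ => rfl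
  have h4 : ∀ (x : Interval), (Tm.lit x : Tm S Interval [] _).IsRet := fun _ => rfl
  constructor
  · intro k k' hk hk' hkk
    rw [Interp.wp_eq hk, Interp.wp_eq hk', h1, h2]
    simp only [Interp.exec, Interp.wp_of_isRet (h3 _), Interp.wp_of_isRet (h4 _)]
    refine lintegral_mono_ae ?_
    filter_upwards [ae_unif] with x hx
    exact hkk _ _ (hR x hx)
  · intro k kT k' hk hkT hk' hle hkk hT
    rw [Interp.wp_eq hkT, h1] at hT
    rw [Interp.wp_eq hk, Interp.wp_eq hk', h1, h2]
    simp only [Interp.exec, Interp.wp_of_isRet (h3 _), Interp.wp_of_isRet (h4 _)] at hT ⊢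
    have hm : AEMeasurable (fun x => kT (.lit x)) unif := hkT.smp h1
    replace hT : ∫⁻ x, kT (.lit x) ∂unif = 1 := hT
    have h5 : ∀ᵐ x ∂unif, kT (.lit x) = 1 := by
      have h6 : ∫⁻ x, (1 - kT (.lit x)) ∂unif = 0 := by
        rw [lintegral_sub' hm (by simp [hT]) (.of_forall fun x => hle _), hT]
        simp
      replace h6 := (lintegral_eq_zero_iff' (aemeasurable_const.sub hm)).1 h6
      filter_upwards [h6] with x hx
      exact le_antisymm (hle _) (tsub_eq_zero_iff_le.1 hx)
    refine lintegral_mono_ae ?_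
    filter_upwards [ae_unif, h5] with x hx hx1
    exact hkk _ _ (hR x hx) hx1

theorem compRel_ite {R : Tm S ℝ [] τ → Tm S Interval [] τ → Prop} {V : Tm S ℝ [] Ty.real}
    {V' : Tm S Interval [] Ty.real} (hV : V.IsRet) (hV' : V'.IsRet) (hVV : V.val ∈ V'.vals)
    {N P : Tm S ℝ [] τ} {N' P' : Tm S Interval [] τ} (hN : CompRel R N N') (hP : CompRel R P P') :
    CompRel R (.ite V N P) (.ite V' N' P') := by
  rw [Tm.IsRet] at hV hV'
  have h1 : (Tm.ite V N P).next = .br V N P := by simp [Tm.next, hV, Act.map]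
  have h2 : (Tm.ite V' N' P').next = .br V' N' P' := by simp [Tm.next, hV', Act.map]
  constructor
  · intro k k' hk hk' hkk
    rw [Interp.wp_eq hk, Interp.wp_eq hk', h1, h2]
    exact add_le_add
      (mul_le_mul' (iverson_mono fun h => ⟨_, hVV, h⟩) (hN.1 k k' hk hk' hkk))
      (mul_le_mul' (iverson_mono fun h => ⟨_, hVV, h⟩) (hP.1 k k' hk hk' hkk))
  · intro k kT k' hk hkT hk' hle hkk hT
    rw [Interp.wp_eq hkT, h1] at hT
    rw [Interp.wp_eq hk, Interp.wp_eq hk', h1, h2]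
    simp only [Interp.exec, conc, probTerm, lower, Cmp.Holds] at hT ⊢
    rcases le_or_gt V.val 0 with h | h
    · rw [iverson_of h, iverson_of_not (not_lt.2 h)] at hT ⊢
      rw [iverson_of_not (p := ∀ t ∈ V'.vals, t > 0) fun h' => absurd (h' _ hVV) (not_lt.2 h)]
      simp only [one_mul, zero_mul, add_zero] at hT ⊢
      exact (mul_le_of_le_one_left' (iverson_le_one _)).trans
        (hN.2 k kT k' hk hkT hk' hle hkk hT)
    · rw [iverson_of h, iverson_of_not (not_le.2 h)] at hT ⊢
      rw [iverson_of_not (p := ∀ t ∈ V'.vals, t ≤ 0) fun h' => absurd (h' _ hVV) (not_le.2 h)]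
      simp only [one_mul, zero_mul, zero_add] at hT ⊢
      exact (mul_le_of_le_one_left' (iverson_le_one _)).trans
        (hP.2 k kT k' hk hkT hk' hle hkk hT)

theorem compRel_score {R : Tm S ℝ [] Ty.real → Tm S Interval [] Ty.real → Prop}
    {V : Tm S ℝ [] Ty.real} {V' : Tm S Interval [] Ty.real} (hV : V.IsRet) (hV' : V'.IsRet)
    (hVV : V.val ∈ V'.vals) (hR : 0 ≤ V.val → R V V') : CompRel R (.score V) (.score V') := by
  have h1 : (Tm.score V).next = .sc V V := by
    rw [Tm.IsRet] at hV
    simp [Tm.next, hV, Act.map]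
  have h2 : (Tm.score V').next = .sc V' V' := by
    rw [Tm.IsRet] at hV'
    simp [Tm.next, hV', Act.map]
  constructor
  · intro k k' hk hk' hkk
    rw [Interp.wp_eq hk, Interp.wp_eq hk', h1, h2]
    simp only [Interp.exec, conc, upper, Cmp.Holds, Interp.wp_of_isRet hV, Interp.wp_of_isRet hV']
    by_cases h : 0 ≤ V.val
    · refine mul_le_mul' (mul_le_mul' (iverson_mono fun h => ⟨_, hVV, h⟩) ?_) (hkk _ _ (hR h))
      exact le_iSup₂ (f := fun t _ => ENNReal.ofReal t) V.val hVV
    · rw [iverson_of_not h, zero_mul, zero_mul]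
      exact zero_le
  · intro k kT k' hk hkT hk' hle hkk hT
    rw [Interp.wp_eq hkT, h1] at hT
    rw [Interp.wp_eq hk, Interp.wp_eq hk', h1, h2]
    simp only [Interp.exec, conc, probTerm, lower, Cmp.Holds, Interp.wp_of_isRet hV,
      Interp.wp_of_isRet hV', mul_one] at hT ⊢
    by_cases h : 0 ≤ V.val
    · rw [iverson_of h, one_mul] at hT
      refine mul_le_mul' (mul_le_mul' (iverson_mono fun h => h _ hVV) ?_) (hkk _ _ (hR h) hT)
      exact iInf₂_le (f := fun t _ => ENNReal.ofReal t) V.val hVV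
    · rw [iverson_of_not h, zero_mul] at hT
      exact absurd hT zero_ne_one

end CompRel

/-- The relation between values and their approximations. -/
def ValRel : {α : Ty} → IType α → Tm S ℝ [] α → Tm S Interval [] α → Prop
  | _, .base I, V, V' => V'.IsRet ∧ (∀ N, ValSafe (.base I) N V) ∧ V.val ∈ V'.vals
  | _, .arr σ τ w, V, V' => V'.IsRet ∧ (∀ N, ValSafe (.arr σ τ w) N V) ∧
      ∀ W W', ValRel σ W W' → CompRel (ValRel τ) (.app V W) (.app V' W')

section ValRel

variable {α : Ty}

theorem ValRel.isRet_right {σ : IType α} {V : Tm S ℝ [] α} {V' : Tm S Interval [] α}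
    (h : ValRel σ V V') : V'.IsRet := by
  cases σ with
  | base I => exact h.1
  | arr σ τ w => exact h.1

theorem ValRel.valSafe {σ : IType α} {V : Tm S ℝ [] α} {V' : Tm S Interval [] α}
    (h : ValRel σ V V') (N : ℕ) : ValSafe σ N V := by
  cases σ with
  | base I => exact h.2.1 N
  | arr σ τ w => exact h.2.1 N

theorem ValRel.isRet_left {σ : IType α} {V : Tm S ℝ [] α} {V' : Tm S Interval [] α}
    (h : ValRel σ V V') : V.IsRet := (h.valSafe 0).isRet

theorem ValRel.sub {σ τ : IType α} (hs : σ.Sub τ) {V : Tm S ℝ [] α} {V' : Tm S Interval [] α}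
    (h : ValRel σ V V') : ValRel τ V V' := by
  induction hs with
  | base hI => exact ⟨h.1, fun N => (h.2.1 N).sub (.base hI), h.2.2⟩
  | arr h1 h2 hw ihσ ihτ =>
    exact ⟨h.1, fun N => (h.2.1 N).sub (.arr h1 h2 hw),
      fun W W' hW => (h.2.2 W W' (ihσ hW)).mono fun _ _ hV => ihτ hV⟩

theorem isRet_summary (σ : IType α) {Γ : List Ty} : (σ.summary : Tm S Interval Γ α).IsRet := by
  cases σ <;> rfl

theorem tr_summary (g : ℕ → Interval ⊕ ℕ) (σ : IType α) {Γ : List Ty} :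
    Tm.tr g id (σ.summary : Tm S Interval Γ α) = σ.summary := by
  induction σ generalizing Γ with
  | base I => rfl
  | arr σ τ w _ ih => simp only [IType.summary, Tm.tr, ih, id]

theorem wp_summary_app {β : Ty} (I : Interp S Interval) (σ : IType α) (τ : IType β) (w : Interval)
    {W : Tm S Interval [] α} (hW : W.IsRet) {k : Tm S Interval [] β → ℝ≥0∞} (hk : I.MeasFun k) :
    I.wp (.app (IType.arr σ τ w).summary W) k
      = I.holds (.lit w) Cmp.ge 0 * I.sc (.lit w) * k τ.summary := by
  have h1 : (Tm.app (IType.arr σ τ w).summary W).next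
      = .tau (.app (.lam τ.summary) (.score (.lit w))) := by
    rw [Tm.IsRet] at hW
    simp only [IType.summary, Tm.next, hW, Act.map, Act.ret_orElse, Tm.betaAct, Tm.inst, Tm.subst,
      Tm.subst_summary]
  have h2 : (Tm.app (.lam τ.summary) (.score (.lit w)) : Tm S Interval [] β).next
      = .sc (.lit w) (.app (.lam τ.summary) (.lit w)) := by
    simp only [Tm.next, Act.map, Act.orElse]
  have h3 : (Tm.app (.lam τ.summary) (.lit w) : Tm S Interval [] β).next = .tau τ.summary := by
    simp only [Tm.next, Act.map, Act.ret_orElse, Tm.betaAct, Tm.inst, Tm.subst_summary]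
  rw [Interp.wp_eq hk, h1, Interp.exec, Interp.wp_eq hk, h2, Interp.exec, Interp.wp_eq hk, h3,
    Interp.exec, Interp.wp_of_isRet (isRet_summary τ)]

/-- Safe values are related to the summary of their type. -/
theorem valRel_summary (σ : IType α) {V : Tm S ℝ [] α} (hV : ∀ N, ValSafe σ N V) :
    ValRel σ V σ.summary := by
  induction σ with
  | base I => exact ⟨rfl, hV, (hV 0).2⟩
  | @arr α β σ τ w _ ih =>
    refine ⟨rfl, hV, fun W W' hW => ?_⟩
    have hsafe : ∀ N, Safe N (.app V W) fun _ r R => r ∈ w.toSet ∧ ∀ i, ValSafe τ i R :=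
      safe_forall_valSafe fun N => (hV N).2 N le_rfl W (hW.valSafe N)
    constructor
    · intro k k' hk hk' hkk
      rw [wp_summary_app _ σ τ w hW.isRet_right hk']
      refine iSup_le fun N => ?_
      rw [← one_mul ((conc S).run N _ k)]
      refine run_le_of_safe N ENNReal.one_ne_top ((hsafe N).mono fun i _ r R _ hR => ?_)
      rw [one_mul]
      rcases le_or_gt r 0 with hr | hr
      · rw [ENNReal.ofReal_of_nonpos hr, zero_mul]
        exact zero_le
      · refine mul_le_mul' ?_ (hkk _ _ (ih hR.2))
        simp only [upper, Cmp.Holds]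
        rw [iverson_of ⟨r, hR.1, hr.le⟩, one_mul]
        exact le_iSup₂ (f := fun t _ => ENNReal.ofReal t) r hR.1
    · intro k kT k' hk hkT hk' hle hkk hT
      rw [wp_summary_app _ σ τ w hW.isRet_right hk', ← conc_wp_add_top_mul hk hkT hle hT]
      have h1 : (probTerm S).wp (.app V W) (fun _ => 1) = 1 :=
        le_antisymm (term_wp_le_one (fun _ => le_rfl) _) (hT.symm.le.trans (Interp.wp_mono _ _ hle))
      have h2 : ∀ N, Safe N (.app V W) fun _ r R =>
          (lower S).holds (.lit w) Cmp.ge 0 * (lower S).sc (.lit w) * k' τ.summary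
            ≤ 1 * ENNReal.ofReal r * (k R + ⊤ * (1 - kT R)) := by
        refine fun N => (hsafe N).mono fun i _ r R _ hR => ?_
        rw [one_mul]
        refine mul_le_mul' ?_ ?_
        · refine (mul_le_of_le_one_left' (iverson_le_one _)).trans ?_
          exact iInf₂_le (f := fun t _ => ENNReal.ofReal t) r hR.1
        · by_cases h : kT R = 1
          · exact (hkk _ _ (ih hR.2) h).trans le_self_add
          · have h3 : 1 - kT R ≠ 0 := fun h0 => h (le_antisymm (hle R) (tsub_eq_zero_iff_le.1 h0))
            rw [ENNReal.top_mul h3, add_top]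
            exact le_top
      rw [← mul_one (_ * k' τ.summary)]
      refine (mul_le_mul_right h1.symm.le _).trans ?_
      simp only [Interp.wp, ENNReal.mul_iSup]
      refine iSup_mono fun N => (le_run_of_safe N ENNReal.one_ne_top (h2 N)).trans ?_
      rw [one_mul]

theorem compRel_prim {f : S.Op} {I : Fin (S.arity f) → Interval} (k : ℕ) (hk : k ≤ S.arity f) :
    ∀ (M : Fin (S.arity f) → Tm S ℝ [] Ty.real) (M' : Fin (S.arity f) → Tm S Interval [] Ty.real),
      (∀ i, S.arity f - k ≤ i.1 → CompRel (ValRel (.base (I i))) (M i) (M' i)) →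
      (∀ i, i.1 < S.arity f - k → ValRel (.base (I i)) (M i) (M' i)) →
      CompRel (ValRel (.base (Interval.lift (S.fn f) I))) (.prim f M) (.prim f M') := by
  induction k with
  | zero =>
    intro M M' _ h
    have h' : ∀ i, ValRel (.base (I i)) (M i) (M' i) := fun i => h i (by omega)
    have hr : (Tm.prim f M).IsRet := Tm.next_prim_ret f M fun i => (h' i).isRet_left
    have hr' : (Tm.prim f M').IsRet := Tm.next_prim_ret f M' fun i => (h' i).isRet_right
    exact compRel_of_isRet hr hr' ⟨hr', fun N => ⟨hr, Interval.mem_lift fun i => ((h' i).2.1 N).2⟩,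
      ⟨_, fun i => (h' i).2.2, rfl⟩⟩
  | succ k ih =>
    intro M M' hM hV
    let i₀ : Fin (S.arity f) := ⟨S.arity f - (k + 1), by omega⟩
    have hE := Frame.prim f M i₀ fun j hj => (hV j hj).isRet_left
    have hE' := Frame.prim f M' i₀ fun j hj => (hV j hj).isRet_right
    have h1 := CompRel.bind (Q := ValRel (.base (Interval.lift (S.fn f) I))) hE hE' (hM i₀ le_rfl)
    rw [Function.update_eq_self, Function.update_eq_self] at h1
    refine h1 fun V V' hVV => ih (by omega) _ _ (fun i hi => ?_) fun i hi => ?_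
    · have : i ≠ i₀ := by
        rintro rfl
        simp only [i₀] at hi
        omega
      rw [Function.update_of_ne this, Function.update_of_ne this]
      exact hM i (by omega)
    · rcases eq_or_ne i i₀ with rfl | hne
      · rw [Function.update_self, Function.update_self]
        exact hVV
      · rw [Function.update_of_ne hne, Function.update_of_ne hne]
        refine hV i ?_
        have : i.1 ≠ S.arity f - (k + 1) := fun h => hne (Fin.ext h)
        omega

theorem valRel_extend {Γ : List Ty} {Θ : ICtx Γ} {σ : IType α}
    {θ : ∀ τ, Var Γ τ → Tm S ℝ [] τ} {θ' : ∀ τ, Var Γ τ → Tm S Interval [] τ} {V : Tm S ℝ [] α}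
    {V' : Tm S Interval [] α} (hθ : ∀ τ x, ValRel (Θ.lookup x) (θ τ x) (θ' τ x))
    (hV : ValRel σ V V') :
    ∀ τ x, ValRel ((ICtx.cons σ Θ).lookup x) (Tm.extend θ V τ x) (Tm.extend θ' V' τ x) := by
  intro τ x
  cases x with
  | zero => exact hV
  | succ x => exact hθ _ x

/-- Well-typed terms are related to their approximations. -/
theorem compRel_of_deriv {s : ℕ → ℝ} (hs : ∀ i, 0 ≤ s i ∧ s i ≤ 1) {Γ : List Ty}
    {Θ : ICtx Γ} {M : Tm S ℝ Γ α} {A : WType α} (D : Deriv Θ M A) :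
    ∀ (θ : ∀ τ, Var Γ τ → Tm S ℝ [] τ) (θ' : ∀ τ, Var Γ τ → Tm S Interval [] τ),
      (∀ τ x, ValRel (Θ.lookup x) (θ τ x) (θ' τ x)) →
      CompRel (ValRel A.type) (Tm.subst θ (M.close s))
        (Tm.subst θ' (D.approx.close fun i => .point (s i))) := by
  induction D with
  | var x =>
    intro θ θ' hθ
    exact compRel_of_isRet (hθ _ x).isRet_left (hθ _ x).isRet_right (hθ _ x)
  | sub D h ih =>
    intro θ θ' hθ
    exact (ih θ θ' hθ).mono fun _ _ hV => hV.sub h.1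
  | @lam Γ α β Θ M σ A D ih =>
    intro θ θ' hθ
    refine compRel_of_isRet rfl rfl ⟨rfl, fun N => ?_, fun W W' hW => ?_⟩
    · have h := safe_of_deriv hs (Deriv.lam D) N θ fun τ x => (hθ τ x).valSafe N
      exact (Safe.of_isRet (M := Tm.subst θ (Tm.close s (Tm.lam M))) rfl h).2
    · have h1 : Tm.next W = .ret := hW.isRet_left
      have h2 : Tm.next W' = .ret := hW.isRet_right
      have h3 := ih _ _ (valRel_extend hθ hW)
      rw [← Tm.inst_subst_liftSubst, ← Tm.inst_subst_liftSubst] at h3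
      refine compRel_of_next_tau ?_ ?_ h3
      · simp only [Tm.close, Tm.tr, Tm.subst, Tm.next, h1, Act.map, Act.ret_orElse, Tm.betaAct]
      · simp only [Deriv.approx, Tm.close, Tm.tr, Tm.subst, Tm.next, h2, Act.map, Act.ret_orElse,
          Tm.betaAct]
  | @fix Γ α β Θ M σ A D ih =>
    intro θ θ' hθ
    have h1 : Tm.subst θ' ((Deriv.fix D).approx.close fun i => .point (s i))
        = (IType.arr σ A.type A.weight).summary := by
      rw [Deriv.approx, Tm.close, tr_summary, Tm.subst_summary]
    rw [h1]
    refine compRel_of_isRet rfl rfl (valRel_summary _ fun N => ?_)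
    have h := safe_of_deriv hs (Deriv.fix D) N θ fun τ x => (hθ τ x).valSafe N
    exact (Safe.of_isRet (M := Tm.subst θ (Tm.close s (Tm.fix M))) rfl h).2
  | app D E ihD ihE =>
    intro θ θ' hθ
    refine CompRel.bind (E := fun M => .app M _) (E' := fun M => .app M _) (.appLeft _) (.appLeft _)
      (ihD θ θ' hθ) fun V V' hV => ?_
    exact CompRel.bind (E := fun M => .app V M) (E' := fun M => .app V' M)
      (.appRight _ hV.isRet_left) (.appRight _ hV.isRet_right) (ihE θ θ' hθ) hV.2.2
  | lit r =>
    intro θ θ' hθ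
    have h : r ∈ (Interval.point r).toSet := by
      rw [Tm.toSet_point]
      rfl
    exact compRel_of_isRet rfl rfl ⟨rfl, fun N => ⟨rfl, h⟩, h⟩
  | svar i =>
    intro θ θ' hθ
    have h : s i ∈ (Interval.point (s i)).toSet := by
      rw [Tm.toSet_point]
      rfl
    exact compRel_of_isRet rfl rfl ⟨rfl, fun N => ⟨rfl, Interval.mem_unit (hs i)⟩, h⟩
  | sample =>
    intro θ θ' hθ
    refine compRel_sample fun x hx => ?_
    have h : x ∈ (Interval.point x).toSet := by
      rw [Tm.toSet_point]
      rfl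
    exact ⟨rfl, fun N => ⟨rfl, Interval.mem_unit hx⟩, h⟩
  | ite D E F ihD ihE ihF =>
    intro θ θ' hθ
    refine CompRel.bind (E := fun M => .ite M _ _) (E' := fun M => .ite M _ _) (.ite _ _) (.ite _ _)
      (ihD θ θ' hθ) fun V V' hV => ?_
    exact compRel_ite hV.isRet_left hV.isRet_right hV.2.2 (ihE θ θ' hθ) (ihF θ θ' hθ)
  | score D h0 ih =>
    intro θ θ' hθ
    refine CompRel.bind (E := fun M => .score M) (E' := fun M => .score M) .score .score
      (ih θ θ' hθ) fun V V' hV => ?_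
    exact compRel_score hV.isRet_left hV.isRet_right hV.2.2 fun h => ⟨hV.isRet_right,
      fun N => ⟨hV.isRet_left, Interval.mem_meetNonneg h0 (hV.2.1 N).2 h⟩, hV.2.2⟩
  | prim f D ih =>
    intro θ θ' hθ
    exact compRel_prim (S.arity f) le_rfl _ _ (fun i _ => ih i θ θ' hθ)
      fun i hi => absurd hi (by omega)

end ValRel

end SPCF

namespace SPCF

variable {S : Signature}

/-! ### Termination of approximations -/

/-- All symbolic executions of a closed term terminate, with results in `P`. -/
inductive Halts {L : Type} {τ : Ty} (P : Tm S L [] τ → Prop) : Tm S L [] τ → Prop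
  | ret {M : Tm S L [] τ} (h : M.IsRet) (hP : P M) : Halts P M
  | tau {M M' : Tm S L [] τ} (h : M.next = .tau M') (h' : Halts P M') : Halts P M
  | smp {M : Tm S L [] τ} {K : Tm S L [] Ty.real → Tm S L [] τ} (h : M.next = .smp K)
      (h' : ∀ n, Halts P (K (.svar n))) : Halts P M
  | br {M M₁ M₂ : Tm S L [] τ} {V : Tm S L [] Ty.real} (h : M.next = .br V M₁ M₂)
      (h₁ : Halts P M₁) (h₂ : Halts P M₂) : Halts P M
  | sc {M M' : Tm S L [] τ} {V : Tm S L [] Ty.real} (h : M.next = .sc V M') (h' : Halts P M') :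
      Halts P M

section Halts

variable {L : Type} {τ ρ : Ty}

theorem Halts.bind {P : Tm S L [] τ → Prop} {Q : Tm S L [] ρ → Prop}
    {E : Tm S L [] τ → Tm S L [] ρ} (hE : Frame E) {M : Tm S L [] τ} (h : Halts P M)
    (hP : ∀ V, V.IsRet → P V → Halts Q (E V)) : Halts Q (E M) := by
  have hne : ∀ {M : Tm S L [] τ} {a}, M.next = a → a ≠ .ret → (E M).next = a.map E :=
    fun h ha => by rw [← h]; exact hE.next_eq (by rw [Tm.IsRet, h]; exact ha)
  induction h with
  | ret h hM => exact hP _ h hM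
  | tau h _ ih => exact .tau (hne h nofun) ih
  | smp h _ ih => exact .smp (hne h nofun) ih
  | br h _ _ ih₁ ih₂ => exact .br (hne h nofun) ih₁ ih₂
  | sc h _ ih => exact .sc (hne h nofun) ih

theorem symPaths_subset {c : Config S L} :
    symPaths c ⊆ {Ψ | Ψ = c ∨ ∃ c', c.Red c' ∧ Ψ ∈ symPaths c'} := by
  rintro Ψ ⟨h, hv⟩
  rcases Relation.ReflTransGen.cases_head h with rfl | ⟨c', h1, h2⟩
  · exact .inl rfl
  · exact .inr ⟨c', h1, h2, hv⟩

theorem Halts.finite_symPaths {P : Tm S L [] Ty.real → Prop} {M : Tm S L [] Ty.real}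
    (h : Halts P M) : ∀ st : State S L, (symPaths ⟨st, M⟩).Finite := by
  have key : ∀ (st : State S L) (M : Tm S L [] Ty.real) (A : Set (Config S L)), A.Finite →
      (∀ c', Config.Red ⟨st, M⟩ c' → symPaths c' ⊆ A) → (symPaths ⟨st, M⟩).Finite := by
    intro st M A hA h
    refine (hA.insert ⟨st, M⟩).subset fun Ψ hΨ => ?_
    rcases symPaths_subset hΨ with rfl | ⟨c', h1, h2⟩
    · exact .inl rfl
    · exact .inr (h c' h1 h2)
  induction h with
  | ret h _ =>
    intro st
    refine key st _ ∅ Set.finite_empty fun c' hc => ?_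
    rw [red_iff] at hc
    exact absurd h hc.ne_ret
  | tau h _ ih =>
    intro st
    refine key st _ _ (ih st) ?_
    rintro ⟨_, _⟩ hc
    rw [red_iff, h] at hc
    obtain ⟨rfl, rfl⟩ := hc
    exact subset_rfl
  | smp h _ ih =>
    intro st
    refine key st _ _ (ih st.n ⟨st.n + 1, st.constraints, st.scores⟩) ?_
    rintro ⟨_, _⟩ hc
    rw [red_iff, h] at hc
    obtain ⟨rfl, rfl⟩ := hc
    exact subset_rfl
  | @br M M₁ M₂ V h _ _ ih₁ ih₂ =>
    intro st
    refine key st _ _ ((ih₁ ⟨st.n, ⟨V, Cmp.le, 0⟩ :: st.constraints, st.scores⟩).union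
      (ih₂ ⟨st.n, ⟨V, Cmp.gt, 0⟩ :: st.constraints, st.scores⟩)) ?_
    rintro ⟨_, _⟩ hc
    rw [red_iff, h] at hc
    rcases hc with ⟨rfl, rfl⟩ | ⟨rfl, rfl⟩
    · exact Set.subset_union_left
    · exact Set.subset_union_right
  | @sc M M' V h _ ih =>
    intro st
    refine key st _ _ (ih ⟨st.n, ⟨V, Cmp.ge, 0⟩ :: st.constraints, V :: st.scores⟩) ?_
    rintro ⟨_, _⟩ hc
    rw [red_iff, h] at hc
    obtain ⟨rfl, rfl⟩ := hc
    exact subset_rfl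

/-- Hereditarily terminating values. -/
def Reducible : (τ : Ty) → Tm S L [] τ → Prop
  | .real, V => V.IsRet
  | .arr α β, V => V.IsRet ∧ ∀ W, Reducible α W → Halts (Reducible β) (.app V W)

theorem Reducible.isRet {V : Tm S L [] τ} (h : Reducible τ V) : V.IsRet := by
  cases τ with
  | real => exact h
  | arr α β => exact h.1

theorem halts_prim {f : S.Op} (k : ℕ) (hk : k ≤ S.arity f) :
    ∀ M : Fin (S.arity f) → Tm S L [] Ty.real,
      (∀ i, S.arity f - k ≤ i.1 → Halts (Reducible Ty.real) (M i)) →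
      (∀ i, i.1 < S.arity f - k → (M i).IsRet) → Halts (Reducible Ty.real) (.prim f M) := by
  induction k with
  | zero =>
    intro M _ h
    have hr : (Tm.prim f M).IsRet := Tm.next_prim_ret f M fun i => h i (by omega)
    exact .ret hr hr
  | succ k ih =>
    intro M hM hV
    let i₀ : Fin (S.arity f) := ⟨S.arity f - (k + 1), by omega⟩
    have h1 := Halts.bind (Q := Reducible Ty.real) (Frame.prim f M i₀ fun j hj => hV j hj)
      (hM i₀ le_rfl)
    rw [Function.update_eq_self] at h1
    refine h1 fun V hVr _ => ih (by omega) _ (fun i hi => ?_) fun i hi => ?_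
    · have : i ≠ i₀ := by
        rintro rfl
        simp only [i₀] at hi
        omega
      rw [Function.update_of_ne this]
      exact hM i (by omega)
    · rcases eq_or_ne i i₀ with rfl | hne
      · rwa [Function.update_self]
      · rw [Function.update_of_ne hne]
        refine hV i ?_
        have : i.1 ≠ S.arity f - (k + 1) := fun h => hne (Fin.ext h)
        omega

theorem reducible_summary {α : Ty} (σ : IType α) : Reducible α (σ.summary : Tm S Interval [] α) := by
  induction σ with
  | base I => exact rfl
  | @arr α β σ τ w _ ih =>
    refine ⟨rfl, fun W hW => ?_⟩
    have h1 : Tm.next W = .ret := hW.isRet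
    refine .tau (M' := .app (.lam τ.summary) (.score (.lit w))) ?_
      (.sc (V := .lit w) (M' := .app (.lam τ.summary) (.lit w)) ?_
        (.tau (M' := τ.summary) ?_ (.ret (isRet_summary τ) ih)))
    · simp only [IType.summary, Tm.next, h1, Act.map, Act.ret_orElse, Tm.betaAct, Tm.inst,
        Tm.subst, Tm.subst_summary]
    · simp only [Tm.next, Act.map, Act.orElse]
    · simp only [Tm.next, Act.map, Act.ret_orElse, Tm.betaAct, Tm.inst, Tm.subst_summary]

theorem halts_approx {Γ : List Ty} {α : Ty} {Θ : ICtx Γ} {M : Tm S ℝ Γ α} {A : WType α}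
    (D : Deriv Θ M A) : ∀ θ : ∀ τ, Var Γ τ → Tm S Interval [] τ, (∀ τ x, Reducible τ (θ τ x)) →
      Halts (Reducible α) (Tm.subst θ D.approx) := by
  have hret : ∀ {τ : Ty} {V : Tm S Interval [] τ}, Reducible τ V → Halts (Reducible τ) V :=
    fun h => .ret h.isRet h
  induction D with
  | var x => exact fun θ hθ => hret (hθ _ x)
  | sub D h ih => exact ih
  | @lam Γ α β Θ M σ A D ih =>
    intro θ hθ
    refine hret ⟨rfl, fun W hW => ?_⟩
    have h1 : Tm.next W = .ret := hW.isRet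
    have h2 := ih (Tm.extend θ W) fun τ x => by
      cases x with
      | zero => exact hW
      | succ x => exact hθ _ x
    rw [← Tm.inst_subst_liftSubst] at h2
    refine .tau ?_ h2
    simp only [Deriv.approx, Tm.subst, Tm.next, h1, Act.map, Act.ret_orElse, Tm.betaAct]
  | fix D _ =>
    intro θ hθ
    rw [Deriv.approx, Tm.subst_summary]
    exact hret (reducible_summary _)
  | app D E ihD ihE =>
    intro θ hθ
    refine Halts.bind (E := fun M => .app M _) (.appLeft _) (ihD θ hθ) fun V hV h => ?_
    exact Halts.bind (E := fun M => .app V M) (.appRight _ hV) (ihE θ hθ) fun W _ hW => h.2 W hW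
  | lit r => exact fun θ hθ => hret (τ := Ty.real) rfl
  | svar i => exact fun θ hθ => hret (τ := Ty.real) rfl
  | sample =>
    exact fun θ hθ => .smp (K := fun t => t) rfl fun n => hret (τ := Ty.real) rfl
  | ite D E F ihD ihE ihF =>
    intro θ hθ
    refine Halts.bind (E := fun M => .ite M _ _) (.ite _ _) (ihD θ hθ) fun V hV _ => ?_
    refine .br (V := V) ?_ (ihE θ hθ) (ihF θ hθ)
    rw [Tm.IsRet] at hV
    simp only [Tm.next, hV, Act.map, Act.ret_orElse]
  | score D h ih =>
    intro θ hθ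
    refine Halts.bind (E := fun M => .score M) .score (ih θ hθ) fun V hV h => ?_
    refine .sc (V := V) ?_ (hret h)
    rw [Tm.IsRet] at hV
    simp only [Tm.next, hV, Act.map, Act.ret_orElse]
  | prim f D ih =>
    intro θ hθ
    exact halts_prim (S.arity f) le_rfl _ (fun i _ => ih i θ hθ) fun i hi => absurd hi (by omega)

end Halts

/-! ### Approximated configurations -/

theorem svarsBelow_summary (n : ℕ) {α : Ty} (σ : IType α) {Γ : List Ty} :
    (σ.summary : Tm S Interval Γ α).SvarsBelow n := by
  induction σ generalizing Γ with
  | base I => trivial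
  | arr σ τ w _ ih => exact ⟨ih, trivial⟩

theorem svarsBelow_approx {n : ℕ} {Γ : List Ty} {α : Ty} {Θ : ICtx Γ} {M : Tm S ℝ Γ α}
    {A : WType α} (D : Deriv Θ M A) (hM : M.SvarsBelow n) : D.approx.SvarsBelow n := by
  induction D with
  | sub D h ih => exact ih hM
  | lam D ih => exact ih hM
  | fix D _ => exact svarsBelow_summary n _
  | app D E ihD ihE => exact ⟨ihD hM.1, ihE hM.2⟩
  | svar i => exact hM
  | ite D E F ihD ihE ihF => exact ⟨ihD hM.1, ihE hM.2.1, ihF hM.2.2⟩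
  | score D h ih => exact ih hM
  | prim f D ih => exact fun i => ih i (hM i)
  | _ => trivial

theorem svarsBelow_mapLit {n : ℕ} {L L' : Type} (g : L → L') {Γ : List Ty} {τ : Ty}
    {M : Tm S L Γ τ} (hM : M.SvarsBelow n) : (M.mapLit g).SvarsBelow n := by
  induction M with
  | lam M ih => exact ih hM
  | fix M ih => exact ih hM
  | app M N ihM ihN => exact ⟨ihM hM.1, ihN hM.2⟩
  | svar i => exact hM
  | ite M N P ihM ihN ihP => exact ⟨ihM hM.1, ihN hM.2.1, ihP hM.2.2⟩
  | score M ih => exact ih hM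
  | prim f M ih => exact fun i => ih i (hM i)
  | _ => trivial

theorem evalSet_mapLit_point (s : ℕ → ℝ) {V : Tm S ℝ [] Ty.real} (hV : V.IsValue) :
    (V.mapLit Interval.point).evalSet s = {V.eval s} := by
  have aux : ∀ {Γ : List Ty} {τ : Ty} {V : Tm S ℝ Γ τ}, V.IsValue → Γ = [] → τ = Ty.real →
      (V.mapLit Interval.point).evalSet s = {V.eval s} := by
    intro Γ τ V hV hΓ hτ
    induction hV with
    | var x => subst hΓ; cases x
    | lit l => exact Tm.toSet_point l
    | svar i => rfl
    | lam M => cases hτ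
    | fix M => cases hτ
    | prim f M h ih =>
      have h1 : {x : Fin (S.arity f) → ℝ | ∀ i, x i ∈ ((M i).mapLit Interval.point).evalSet s}
          = {fun i => (M i).eval s} := by
        ext x
        simp only [ih _ rfl, Set.mem_ofPred_eq, Set.mem_singleton_iff, funext_iff]
      simp only [Tm.mapLit, Tm.evalSet, Tm.eval]
      rw [h1, Set.image_singleton]
  exact aux hV rfl rfl

theorem Config.WellFormed.below {ψ : Config S ℝ} (h : ψ.WellFormed) : ψ.Below :=
  ⟨h.term_below, h.constraint_below, h.score_below⟩

theorem below_approxFix {ψ : Config S ℝ} (h : ψ.WellFormed) {A : WType Ty.real}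
    (D : Deriv ICtx.nil ψ.term A) : (approxFix ψ D).Below where
  term_below := svarsBelow_approx D h.term_below
  constraint_below C hC := by
    obtain ⟨C', hC', rfl⟩ := List.mem_map.1 hC
    exact svarsBelow_mapLit _ (h.constraint_below C' hC')
  score_below W hW := by
    obtain ⟨W', hW', rfl⟩ := List.mem_map.1 hW
    exact svarsBelow_mapLit _ (h.score_below W' hW')

/-! ### Denotations of paths as masses -/

theorem val_inject_conc (s : ℕ → ℝ) (V : Tm S ℝ [] Ty.real) :
    ((conc S).inject V s).val = V.eval s := Tm.val_close s V

theorem val_inject_term (s : ℕ → ℝ) (V : Tm S ℝ [] Ty.real) :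
    ((probTerm S).inject V s).val = V.eval s := Tm.val_close s V

theorem vals_inject_lower (s : ℕ → ℝ) (V : Tm S Interval [] Ty.real) :
    ((lower S).inject V s).vals = V.evalSet s := Tm.vals_close s V

theorem vals_inject_upper (s : ℕ → ℝ) (V : Tm S Interval [] Ty.real) :
    ((upper S).inject V s).vals = V.evalSet s := Tm.vals_close s V

theorem weight_conc (st : State S ℝ) (s : ℕ → ℝ) : (conc S).weight st s
    = (st.constraints.map fun C => iverson (C.cmp.Holds (C.val.eval s) C.bound)).prod
      * (st.scores.map fun W => ENNReal.ofReal (W.eval s)).prod := by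
  simp only [← val_inject_conc]
  rfl

theorem weight_term (st : State S ℝ) (s : ℕ → ℝ) : (probTerm S).weight st s
    = iverson (∀ C ∈ st.constraints, C.cmp.Holds (C.val.eval s) C.bound) := by
  have h1 : (probTerm S).weight st s
      = (st.constraints.map fun C => iverson (C.cmp.Holds (C.val.eval s) C.bound)).prod := by
    simp only [← val_inject_term]
    simp [Interp.weight, probTerm]
  rw [h1]
  induction st.constraints with
  | nil => simp [iverson]
  | cons C l ih =>
    rw [List.map_cons, List.prod_cons, ih]
    simp only [List.forall_mem_cons]
    by_cases h : C.cmp.Holds (C.val.eval s) C.bound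
    · rw [iverson_of h, one_mul]
      simp only [h, true_and]
    · rw [iverson_of_not h, zero_mul, iverson_of_not fun h' => h h'.1]

theorem weight_lower (st : State S Interval) (s : ℕ → ℝ) : (lower S).weight st s
    = (st.constraints.map fun C => iverson (∀ t ∈ C.val.evalSet s, C.cmp.Holds t C.bound)).prod
      * (st.scores.map fun W => ⨅ t ∈ W.evalSet s, ENNReal.ofReal t).prod := by
  simp only [← vals_inject_lower]
  rfl

theorem weight_upper (st : State S Interval) (s : ℕ → ℝ) : (upper S).weight st s
    = (st.constraints.map fun C => iverson (∃ t ∈ C.val.evalSet s, C.cmp.Holds t C.bound)).prod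
      * (st.scores.map fun W => ⨆ t ∈ W.evalSet s, ENNReal.ofReal t).prod := by
  simp only [← vals_inject_upper]
  rfl

theorem den_eq_pathMass (Ψ : Config S ℝ) (U : Set ℝ) :
    den Ψ U = (conc S).pathMass (fun V => iverson (V.val ∈ U)) Ψ := by
  refine lintegral_congr fun s => ?_
  simp only [weight_conc, val_inject_conc]
  ring

theorem denLB_eq_pathMass (Ψ : Config S Interval) (U : Set ℝ) :
    denLB Ψ U = (lower S).pathMass (fun V => iverson (V.vals ⊆ U)) Ψ := by
  refine lintegral_congr fun s => ?_
  simp only [weight_lower, vals_inject_lower]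
  ring

theorem denUB_eq_pathMass (Ψ : Config S Interval) (U : Set ℝ) :
    denUB Ψ U = (upper S).pathMass (fun V => iverson ((V.vals ∩ U).Nonempty)) Ψ := by
  refine lintegral_congr fun s => ?_
  simp only [weight_upper, vals_inject_upper]
  ring

theorem measurable_eval {Γ : List Ty} {τ : Ty} (M : Tm S ℝ Γ τ) : Measurable fun s => M.eval s := by
  simp only [← Tm.val_close, ← Tm.fill_tag]
  exact Tm.measurable_val_fill M.tag

theorem volume_sat (ψ : Config S ℝ) :
    volume ψ.sat = ∫⁻ s in cube ψ.n, (probTerm S).weight ψ.toState (assign s) := by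
  have hm : MeasurableSet {s : Fin ψ.n → ℝ |
      ∀ C ∈ ψ.constraints, C.cmp.Holds (C.val.eval (assign s)) C.bound} := by
    have h1 : ∀ l : List (Constraint S ℝ), MeasurableSet {s : Fin ψ.n → ℝ |
        ∀ C ∈ l, C.cmp.Holds (C.val.eval (assign s)) C.bound} := by
      intro l
      induction l with
      | nil => simp
      | cons C l ih =>
        simp only [List.forall_mem_cons]
        exact (((measurable_eval C.val).comp measurable_assign)
          (C.cmp.measurableSet_holds C.bound)).inter ih
    exact h1 _
  have h2 : ∀ s : Fin ψ.n → ℝ, (probTerm S).weight ψ.toState (assign s)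
      = {s : Fin ψ.n → ℝ | ∀ C ∈ ψ.constraints,
          C.cmp.Holds (C.val.eval (assign s)) C.bound}.indicator 1 s := by
    intro s
    rw [weight_term]
    by_cases h : ∀ C ∈ ψ.constraints, C.cmp.Holds (C.val.eval (assign s)) C.bound
    · rw [iverson_of h]
      exact (Set.indicator_of_mem (s := {s : Fin ψ.n → ℝ |
          ∀ C ∈ ψ.constraints, C.cmp.Holds (C.val.eval (assign s)) C.bound}) h 1).symm
    · rw [iverson_of_not h]
      exact (Set.indicator_of_notMem (s := {s : Fin ψ.n → ℝ |
          ∀ C ∈ ψ.constraints, C.cmp.Holds (C.val.eval (assign s)) C.bound}) h 1).symm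
  simp only [h2]
  rw [lintegral_indicator_one hm, Measure.restrict_apply hm, Set.inter_comm]
  rfl

theorem volume_sat_eq_pathMass (Ψ : Config S ℝ) :
    volume Ψ.sat = (probTerm S).pathMass (fun _ => 1) Ψ := by
  rw [volume_sat, Interp.pathMass]
  simp only [mul_one]

/-- Almost surely terminating configurations terminate with probability `1` on almost all traces
that satisfy their constraints. -/
theorem Config.AST.ae_wp_eq_one {ψ : Config S ℝ} (hψ : ψ.WellFormed) (h : ψ.AST) :
    ∀ᵐ s ∂(volume.restrict (cube ψ.n)), (probTerm S).weight ψ.toState (assign s) = 0 ∨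
      (probTerm S).wp ((probTerm S).inject ψ.term (assign s)) (fun _ => 1) = 1 := by
  have hone : (probTerm S).MeasFun fun _ : Tm S ℝ [] Ty.real => 1 := Interp.MeasFun.const 1
  have h1 : ∫⁻ s in cube ψ.n, (probTerm S).weight ψ.toState (assign s)
        * (probTerm S).wp ((probTerm S).inject ψ.term (assign s)) (fun _ => 1)
      = ∫⁻ s in cube ψ.n, (probTerm S).weight ψ.toState (assign s) := by
    rw [← Interp.tsum_symPaths hone hψ.below, ← volume_sat, ← h]
    exact tsum_congr fun Ψ => (volume_sat_eq_pathMass _).symm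
  have h2 : AEMeasurable (fun s : Fin ψ.n → ℝ => (probTerm S).weight ψ.toState (assign s))
      (volume.restrict (cube ψ.n)) :=
    (Interp.weight_meas ψ.toState).comp_measurable measurable_assign _ inferInstance
  have h3 := ae_eq_of_ae_le_of_lintegral_le (μ := volume.restrict (cube ψ.n))
    (.of_forall fun s => mul_le_of_le_one_right' (term_wp_le_one (fun _ => le_rfl) _))
    (by rw [h1, ← volume_sat]
        refine ne_top_of_le_ne_top ?_ (measure_mono fun s hs => hs.1)
        rw [← Measure.restrict_apply_univ, measure_univ]
        exact ENNReal.one_ne_top) h2 h1.symm.le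
  filter_upwards [h3] with s hs
  rw [weight_term] at hs ⊢
  by_cases hC : ∀ C ∈ ψ.constraints, C.cmp.Holds (C.val.eval (assign s)) C.bound
  · rw [iverson_of hC, one_mul] at hs
    exact .inr hs
  · exact .inl (iverson_of_not hC)

theorem weight_lower_approxFix {ψ : Config S ℝ} (h : ψ.WellFormed) {A : WType Ty.real}
    (D : Deriv ICtx.nil ψ.term A) (s : ℕ → ℝ) :
    (lower S).weight (approxFix ψ D).toState s = (conc S).weight ψ.toState s := by
  rw [weight_lower, weight_conc]
  simp only [approxFix, List.map_map]
  congr 2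
  · refine List.map_congr_left fun C hC => ?_
    simp [evalSet_mapLit_point s (h.constraint_value C hC)]
  · refine List.map_congr_left fun W hW => ?_
    simp [evalSet_mapLit_point s (h.score_value W hW)]

theorem weight_upper_approxFix {ψ : Config S ℝ} (h : ψ.WellFormed) {A : WType Ty.real}
    (D : Deriv ICtx.nil ψ.term A) (s : ℕ → ℝ) :
    (upper S).weight (approxFix ψ D).toState s = (conc S).weight ψ.toState s := by
  rw [weight_upper, weight_conc]
  simp only [approxFix, List.map_map]
  congr 2
  · refine List.map_congr_left fun C hC => ?_
    simp [evalSet_mapLit_point s (h.constraint_value C hC)]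
  · refine List.map_congr_left fun W hW => ?_
    simp [evalSet_mapLit_point s (h.score_value W hW)]

theorem weight_conc_eq_zero {st : State S ℝ} {s : ℕ → ℝ} (h : (probTerm S).weight st s = 0) :
    (conc S).weight st s = 0 := by
  have h1 : (probTerm S).weight st s
      = (st.constraints.map fun C => iverson (C.cmp.Holds (C.val.eval s) C.bound)).prod := by
    simp only [← val_inject_term]
    simp [Interp.weight, probTerm]
  rw [weight_conc, ← h1, h, zero_mul]

theorem ae_mem_cube (n : ℕ) : ∀ᵐ s ∂(volume.restrict (cube n)), s ∈ cube n :=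
  ae_restrict_mem (measurableSet_cube n)

theorem measFun_conc_mem {U : Set ℝ} (hU : MeasurableSet U) :
    (conc S).MeasFun fun V : Tm S ℝ [] Ty.real => iverson (V.val ∈ U) := fun M =>
  UMeas.iverson fun _ _ => ((Tm.measurable_val_fill M) hU).nullMeasurableSet

theorem measFun_lower_subset {U : Set ℝ} (hU : MeasurableSet U) :
    (lower S).MeasFun fun V : Tm S Interval [] Ty.real => iverson (V.vals ⊆ U) := fun M =>
  UMeas.iverson fun μ _ => Tm.nullMeasurableSet_forall_vals M hU μ

theorem measFun_upper_inter {U : Set ℝ} (hU : MeasurableSet U) :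
    (upper S).MeasFun fun V : Tm S Interval [] Ty.real => iverson ((V.vals ∩ U).Nonempty) := fun M =>
  UMeas.iverson fun μ _ => Tm.nullMeasurableSet_exists_vals M hU μ

theorem compRel_approxFix {s : ℕ → ℝ} (hs : ∀ i, 0 ≤ s i ∧ s i ≤ 1) {M : Tm S ℝ [] Ty.real}
    {A : WType Ty.real} (D : Deriv ICtx.nil M A) :
    CompRel (ValRel A.type) (M.close s) (D.approx.close fun i => .point (s i)) := by
  have h := compRel_of_deriv hs D (fun _ => .var) (fun _ => .var) fun τ x => nomatch x
  rwa [Tm.subst_var, Tm.subst_var] at h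

theorem val_mem_vals_of_valRel {σ : IType Ty.real} {V : Tm S ℝ [] Ty.real}
    {V' : Tm S Interval [] Ty.real} (h : ValRel σ V V') : V.val ∈ V'.vals := by
  cases σ with
  | base I => exact h.2.2

end SPCF

end

theorem mainTheorem6 (S : SPCF.Signature) (ψ : SPCF.Config S ℝ) (hψ : ψ.WellFormed)
    (A : SPCF.WType SPCF.Ty.real) (D : SPCF.Deriv SPCF.ICtx.nil ψ.term A)
    (U : Set ℝ) (hU : MeasurableSet U) :
    (SPCF.symPaths (SPCF.approxFix ψ D)).Finite ∧
    (ψ.AST →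
      ∑' Ψ : SPCF.symPaths (SPCF.approxFix ψ D), SPCF.denLB Ψ.1 U
        ≤ ∑' Ψ : SPCF.symPaths ψ, SPCF.den Ψ.1 U) ∧
    ∑' Ψ : SPCF.symPaths ψ, SPCF.den Ψ.1 U
      ≤ ∑' Ψ : SPCF.symPaths (SPCF.approxFix ψ D), SPCF.denUB Ψ.1 U := by
  simp only [SPCF.den_eq_pathMass, SPCF.denLB_eq_pathMass, SPCF.denUB_eq_pathMass]
  rw [SPCF.Interp.tsum_symPaths (SPCF.measFun_conc_mem hU) hψ.below,
    SPCF.Interp.tsum_symPaths (SPCF.measFun_lower_subset hU) (SPCF.below_approxFix hψ D),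
    SPCF.Interp.tsum_symPaths (SPCF.measFun_upper_inter hU) (SPCF.below_approxFix hψ D)]
  refine ⟨?_, fun hAST => ?_, ?_⟩
  · have h := SPCF.halts_approx D (fun _ => SPCF.Tm.var) fun τ x => nomatch x
    rw [SPCF.Tm.subst_var] at h
    exact h.finite_symPaths _
  · refine lintegral_mono_ae (μ := volume.restrict (SPCF.cube ψ.n)) ?_
    filter_upwards [hAST.ae_wp_eq_one hψ, SPCF.ae_mem_cube ψ.n] with s h1 hs
    rw [SPCF.weight_lower_approxFix hψ D]
    rcases h1 with h1 | h1
    · have h0 := SPCF.weight_conc_eq_zero h1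
      exact (mul_eq_zero_of_left h0 _).trans_le zero_le
    · refine mul_le_mul_right ?_ _
      refine (SPCF.compRel_approxFix (SPCF.assign_mem hs) D).2 _ (fun _ => 1) _
        (SPCF.measFun_conc_mem hU) (SPCF.Interp.MeasFun.const 1) (SPCF.measFun_lower_subset hU)
        (fun _ => le_rfl) (fun V V' hV _ => ?_) h1
      exact SPCF.iverson_mono fun h => h (SPCF.val_mem_vals_of_valRel hV)
  · refine lintegral_mono_ae (μ := volume.restrict (SPCF.cube ψ.n)) ?_
    filter_upwards [SPCF.ae_mem_cube ψ.n] with s hs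
    rw [SPCF.weight_upper_approxFix hψ D]
    refine mul_le_mul_right ?_ _
    refine (SPCF.compRel_approxFix (SPCF.assign_mem hs) D).1 _ _
      (SPCF.measFun_conc_mem hU) (SPCF.measFun_upper_inter hU) (fun V V' hV => ?_)
    exact SPCF.iverson_mono fun h => ⟨_, SPCF.val_mem_vals_of_valRel hV, h⟩
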